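/- Let $g\ge 3$. Let $p_k=2k-(2g+3)$ for $k=1,\dots,2g+2$, and let $$\Sigma_g^2=\Big\{(x,y)\in\mathbb C^2 : y^2=\prod_{k=1}^{2g+2}(x-p_k),\ |x|\le 8(g+1)\Big\},$$ with its complex orientation: a compact connected oriented surface of genus $g$ with two boundary components, $\partial\Sigma_g^2=\{|x|=8(g+1)\}$. Let $\Gamma_g^2=\pi_0\{\psi\in\mathrm{Diff}^+(\Sigma_g^2):\psi|_{\partial\Sigma_g^2}=\mathrm{id}\}$, with multiplication induced by composition of maps (the right-hand factor acts first), and let $t_c\in\Gamma_g^2$ denote the positive (right-handed) Dehn twist along a simple closed curve $c$. Let $c_i$ $(1\le i\le 2g+1)$ be the preimage of the segment $[p_i,p_{i+1}]$ under $(x,y)\mapsto x$; thus $c_1,\dots,c_{2g+1}$ is a chain: $c_i$ and $c_{i+1}$ intersect transversally in one point, $c_i\cap c_j=\emptyset$ if $|i-j|\ge2$, and the complement of the chain is a collar of the boundary. Let $\delta_1,\delta_1'$ be the two components of $\{|x|=4(g+1)\}$, which are parallel to the two boundary components. For $j=4,\dots,2g+1$ put $$d_j=t_{c_{j-3}}^{-1}t_{c_{j-2}}^{-1}t_{c_{j-1}}^{-1}(c_j),\qquad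 e_j=t_{c_{j-3}}t_{c_{j-2}}t_{c_{j-1}}(c_j),$$ and set $D_g=t_{d_4}t_{d_5}\cdots t_{d_{2g+1}}$ and $E_g=t_{e_{2g+1}}\cdots t_{e_5}t_{e_4}$. Then in $\Gamma_g^2$ $$t_{\delta_1}t_{\delta_1'}=(t_{c_1}t_{c_2}t_{c_3})^{4g}\,D_g\,E_g\,(t_{c_5}t_{c_6}\cdots t_{c_{2g+1}})^{2g-2}\qquad (g \text{ odd}),$$ $$t_{\delta_1}t_{\delta_1'}=(t_{c_1}t_{c_2}t_{c_3})^{4(g-1)+2}\,(t_{c_3}t_{c_2}t_{c_1})^{2}\,D_g\,E_g\,(t_{c_5}t_{c_6}\cdots t_{c_{2g+1}})^{2g-2}\qquad (g \text{ even}).$$ Moreover, in each case the right-hand side, read as a word in positive Dehn twists, is Hurwitz equivalent to the word $(t_{c_1}t_{c_2}\cdots t_{c_{2g+1}})^{2g+2}$ of the odd chain relation $(t_{c_1}\cdots t_{c_{2g+1}})^{2g+2}=t_{\delta_1}t_{\delta_1'}$. Here two words in elements of a group are Hurwitz equivalent if they are related by finitely many moves $(\dots,a,b,\dots)\mapsto(\dots,b,b^{-1}ab,\dots)$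 and their inverses. -/

import Mathlib

open scoped ContDiff Topology

namespace SurfaceMCG

noncomputable section

/-! ### Smooth maps on subsets of Euclidean space -/

/-- Let `X` sit in the normed space `E` by `ι` (here `X` is always a subset of `E` or a product of
such). A map `f` on `X` is smooth at `p` when, near `p`, it is the restriction of a smooth map
defined on a neighbourhood of `p` in the ambient space. -/
def SmoothAt {X E F : Type*} [NormedAddCommGroup E] [NormedSpace ℝ E]
    [NormedAddCommGroup F] [NormedSpace ℝ F] (ι : X → E) (f : X → F) (p : X) : Prop :=
  ∃ V ∈ 𝓝 (ι p), ∃ f' : E → F, ContDiffOn ℝ ∞ f' V ∧ ∀ q, ι q ∈ V → f q = f' (ι q)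

section SmoothAt

variable {X Y E F G : Type*} [NormedAddCommGroup E] [NormedSpace ℝ E]
  [NormedAddCommGroup F] [NormedSpace ℝ F] [NormedAddCommGroup G] [NormedSpace ℝ G]

theorem SmoothAt.comp {ιX : X → E} {ιY : Y → F} {f : X → Y} {g : Y → G} {p : X}
    (hg : SmoothAt ιY g (f p)) (hf : SmoothAt ιX (fun x => ιY (f x)) p) :
    SmoothAt ιX (fun x => g (f x)) p := by
  obtain ⟨V, hV, g', hg', hgV⟩ := hg
  obtain ⟨U, hU, f', hf', hfU⟩ := hf
  have hp : f' (ιX p) = ιY (f p) := (hfU p (mem_of_mem_nhds hU)).symm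
  have hc : ContinuousAt f' (ιX p) := (hf'.continuousOn).continuousAt hU
  have hV' : f' ⁻¹' V ∈ 𝓝 (ιX p) := hc (by rwa [hp])
  refine ⟨U ∩ f' ⁻¹' V, Filter.inter_mem hU hV', g' ∘ f', ?_, ?_⟩
  · exact hg'.comp (hf'.mono Set.inter_subset_left) (fun x hx => hx.2)
  · intro q hq
    have h1 : ιY (f q) = f' (ιX q) := hfU q hq.1
    have h2 : ιY (f q) ∈ V := by rw [h1]; exact hq.2
    change g (f q) = g' (f' (ιX q))
    rw [hgV _ h2, h1]

theorem SmoothAt.of_contDiffAt {ι : X → E} {p : X} {f' : E → F} {s : Set E} (hs : s ∈ 𝓝 (ι p))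
    (hf : ContDiffOn ℝ ∞ f' s) : SmoothAt ι (fun q => f' (ι q)) p :=
  ⟨s, hs, f', hf, fun _ _ => rfl⟩

theorem SmoothAt.incl (ι : X → E) (p : X) : SmoothAt ι ι p :=
  ⟨Set.univ, Filter.univ_mem, id, contDiff_id.contDiffOn, fun _ _ => rfl⟩

theorem SmoothAt.congr [TopologicalSpace X] {ι : X → E} (hι : Topology.IsInducing ι)
    {f g : X → F} {p : X} (hf : SmoothAt ι f p) (h : ∀ᶠ q in 𝓝 p, g q = f q) :
    SmoothAt ι g p := by
  obtain ⟨V, hV, f', hf', hfV⟩ := hf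
  rw [hι.nhds_eq_comap] at h
  obtain ⟨W, hW, hWs⟩ := Filter.mem_comap.1 h
  refine ⟨V ∩ W, Filter.inter_mem hV hW, f', hf'.mono Set.inter_subset_left, fun q hq => ?_⟩
  have : g q = f q := hWs hq.2
  rw [this, hfV q hq.1]

theorem SmoothAt.continuousAt [TopologicalSpace X] {ι : X → E} (hι : Topology.IsInducing ι)
    {f : X → F} {p : X} (hf : SmoothAt ι f p) : ContinuousAt f p := by
  obtain ⟨V, hV, f', hf', hfV⟩ := hf
  have hc : ContinuousAt f' (ι p) := (hf'.continuousOn).continuousAt hV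
  have h2 : ContinuousAt (fun q => f' (ι q)) p := hc.comp hι.continuous.continuousAt
  refine h2.congr ?_
  filter_upwards [hι.continuous.continuousAt hV] with q hq using (hfV q hq).symm

theorem SmoothAt.of_contDiffWithin {f : E → F} {p : E} {s : Set E} (hs : s ∈ 𝓝 p)
    (hf : ContDiffOn ℝ ∞ f s) : SmoothAt (id : E → E) f p :=
  ⟨s, hs, f, hf, fun _ _ => rfl⟩

theorem SmoothAt.differentiableAt {f : E → F} {p : E} (hf : SmoothAt (id : E → E) f p) :
    DifferentiableAt ℝ f p := by
  obtain ⟨V, hV, f', hf', hfV⟩ := hf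
  have h := (hf'.contDiffAt hV).differentiableAt (by simp)
  refine h.congr_of_eventuallyEq ?_
  filter_upwards [hV] with q hq using hfV q hq

end SmoothAt

/-! ### Orientation

A complex curve in `ℂ × ℂ` is oriented by its complex structure; the imaginary part of the standard
Hermitian form restricts to a positive area form on it. -/

/-- The standard Kähler form `Im (v̄₁ w₁ + v̄₂ w₂)` of `ℂ × ℂ`. -/
def areaForm (v w : ℂ × ℂ) : ℝ :=
  (starRingEnd ℂ v.1 * w.1 + starRingEnd ℂ v.2 * w.2).im

/-- The map `φ` from the plane to `ℂ × ℂ` has positive Jacobian at `z`; for a map into a complex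
curve this says that it is an orientation-preserving local diffeomorphism at `z`. -/
def PosAt (φ : ℂ → ℂ × ℂ) (z : ℂ) : Prop :=
  0 < areaForm (fderiv ℝ φ z 1) (fderiv ℝ φ z Complex.I)

/-- A self-map of a complex curve `S` preserves orientation: it carries positive local
parametrizations to positive ones. -/
def OrientationPreserving {S : Set (ℂ × ℂ)} (f : S → S) : Prop :=
  ∀ (φ : ℂ → S) (z : ℂ), SmoothAt id (fun w => (φ w : ℂ × ℂ)) z →
    PosAt (fun w => (φ w : ℂ × ℂ)) z → PosAt (fun w => (f (φ w) : ℂ × ℂ)) z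

/-! ### The mapping class group -/

section MCG

variable (S B : Set (ℂ × ℂ))

/-- The group (under composition) of orientation-preserving diffeomorphisms of the surface `S`
which fix its boundary `B` pointwise. -/
def DiffPlus : Subgroup (Equiv.Perm S) where
  carrier := {f | (∀ p, SmoothAt Subtype.val (fun q => (f q : ℂ × ℂ)) p) ∧
    (∀ p, SmoothAt Subtype.val (fun q => (f.symm q : ℂ × ℂ)) p) ∧
    OrientationPreserving f ∧ OrientationPreserving f.symm ∧
    ∀ p : S, (p : ℂ × ℂ) ∈ B → f p = p}
  mul_mem' := by
    rintro f h ⟨f1, f2, f3, f4, f5⟩ ⟨h1, h2, h3, h4, h5⟩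
    refine ⟨fun p => (f1 (h p)).comp (h1 p), fun p => (h2 (f.symm p)).comp (f2 p), ?_, ?_, ?_⟩
    · intro φ z hφ hp
      exact f3 (fun w => h (φ w)) z ((h1 (φ z)).comp hφ) (h3 φ z hφ hp)
    · intro φ z hφ hp
      exact h4 (fun w => f.symm (φ w)) z ((f2 (φ z)).comp hφ) (f4 φ z hφ hp)
    · intro p hp
      rw [Equiv.Perm.mul_apply, h5 p hp, f5 p hp]
  one_mem' := ⟨fun p => SmoothAt.incl _ p, fun p => SmoothAt.incl _ p, fun _ _ _ h => h,
    fun _ _ _ h => h, fun _ _ => rfl⟩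
  inv_mem' := by
    rintro f ⟨f1, f2, f3, f4, f5⟩
    refine ⟨f2, f1, f4, f3, fun p hp => ?_⟩
    exact (Equiv.symm_apply_eq f).2 (f5 p hp).symm

variable {S B}

/-- A path `H` in `DiffPlus S B` is a smooth isotopy when `(t, p) ↦ H t p` is smooth on
`ℝ × S`. -/
def SmoothIsotopy (H : ℝ → DiffPlus S B) : Prop :=
  ∀ x : ℝ × S, SmoothAt (fun y : ℝ × S => (y.1, (y.2 : ℂ × ℂ)))
    (fun y : ℝ × S => ((H y.1 : Equiv.Perm S) y.2 : ℂ × ℂ)) x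

variable (S B)

/-- The diffeomorphisms which are smoothly isotopic to the identity through elements of
`DiffPlus S B`: the identity component. -/
def IsotopicToId : Subgroup (DiffPlus S B) where
  carrier := {f | ∃ H : ℝ → DiffPlus S B, SmoothIsotopy H ∧ H 0 = 1 ∧ H 1 = f}
  mul_mem' := by
    rintro f h ⟨H, H1, H2, H3⟩ ⟨K, K1, K2, K3⟩
    refine ⟨fun t => H t * K t, fun x => ?_, by simp [H2, K2], by simp [H3, K3]⟩
    have key : SmoothAt (fun y : ℝ × S => (y.1, (y.2 : ℂ × ℂ)))
        (fun y : ℝ × S => (y.1, ((K y.1 : Equiv.Perm S) y.2 : ℂ × ℂ))) x := by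
      obtain ⟨V, hV, k, hk, hkV⟩ := K1 x
      exact ⟨V, hV, fun y => (y.1, k y), contDiff_fst.contDiffOn.prodMk hk,
        fun q hq => Prod.ext rfl (hkV q hq)⟩
    exact SmoothAt.comp (f := fun y : ℝ × S => (y.1, (K y.1 : Equiv.Perm S) y.2))
      (g := fun y : ℝ × S => ((H y.1 : Equiv.Perm S) y.2 : ℂ × ℂ)) (H1 _) key
  one_mem' := by
    refine ⟨fun _ => 1, fun x => ?_, rfl, rfl⟩
    exact ⟨Set.univ, Filter.univ_mem, Prod.snd, contDiff_snd.contDiffOn, fun _ _ => rfl⟩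
  inv_mem' := by
    rintro f ⟨H, H1, H2, H3⟩
    refine ⟨fun t => H (1 - t) * f⁻¹, fun x => ?_, by simp [H3], by simp [H2]⟩
    have key : SmoothAt (fun y : ℝ × S => (y.1, (y.2 : ℂ × ℂ)))
        (fun y : ℝ × S => (1 - y.1, ((f⁻¹ : DiffPlus S B) : Equiv.Perm S) y.2 |>.1)) x := by
      obtain ⟨V, hV, k, hk, hkV⟩ := (f⁻¹).2.1 x.2
      refine ⟨Set.univ ×ˢ V, prod_mem_nhds Filter.univ_mem hV, fun y => (1 - y.1, k y.2), ?_,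
        fun q hq => Prod.ext rfl (hkV q.2 hq.2)⟩
      exact (contDiff_const.sub contDiff_fst).contDiffOn.prodMk
        (hk.comp contDiff_snd.contDiffOn fun y hy => hy.2)
    exact SmoothAt.comp
      (f := fun y : ℝ × S => (1 - y.1, ((f⁻¹ : DiffPlus S B) : Equiv.Perm S) y.2))
      (g := fun y : ℝ × S => ((H y.1 : Equiv.Perm S) y.2 : ℂ × ℂ)) (H1 _) key

instance : (IsotopicToId S B).Normal where
  conj_mem := by
    rintro f ⟨H, H1, H2, H3⟩ h
    refine ⟨fun t => h * H t * h⁻¹, fun x => ?_, by simp [H2], by simp [H3]⟩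
    have key : SmoothAt (fun y : ℝ × S => (y.1, (y.2 : ℂ × ℂ)))
        (fun y : ℝ × S => (y.1, ((h⁻¹ : DiffPlus S B) : Equiv.Perm S) y.2 |>.1)) x := by
      obtain ⟨V, hV, k, hk, hkV⟩ := (h⁻¹).2.1 x.2
      refine ⟨Set.univ ×ˢ V, prod_mem_nhds Filter.univ_mem hV, fun y => (y.1, k y.2), ?_,
        fun q hq => Prod.ext rfl (hkV q.2 hq.2)⟩
      exact contDiff_fst.contDiffOn.prodMk
        (hk.comp contDiff_snd.contDiffOn fun y hy => hy.2)
    have key2 := SmoothAt.comp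
      (f := fun y : ℝ × S => (y.1, ((h⁻¹ : DiffPlus S B) : Equiv.Perm S) y.2))
      (g := fun y : ℝ × S => ((H y.1 : Equiv.Perm S) y.2 : ℂ × ℂ)) (H1 _) key
    exact SmoothAt.comp
      (f := fun y : ℝ × S => (H y.1 : Equiv.Perm S) (((h⁻¹ : DiffPlus S B) : Equiv.Perm S) y.2))
      (g := fun q : S => ((h : Equiv.Perm S) q : ℂ × ℂ)) (h.2.1 _) key2

/-- The mapping class group `π₀ (Diff⁺ (S, ∂S))`, with multiplication induced by composition. -/
abbrev MappingClassGroup : Type := DiffPlus S B ⧸ IsotopicToId S B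

end MCG

/-! ### Annuli and Dehn twists -/

/-- The open planar annulus `1/2 < |z| < 2`. -/
def planarAnnulus : Set ℂ := {z | 1 / 2 < ‖z‖ ∧ ‖z‖ < 2}

/-- The `n`-fold right-handed twist of the planar annulus: it rotates the circle `|z| = r` by the
angle `-2πn β(r)`, where `β` increases smoothly from `0` (for `r² ≤ 1/2`) to `1` (for `r² ≥ 3/2`),
so for `n = 1` a path that crosses the annulus turns to the right, once around. -/
def planarTwist (n : ℤ) (z : ℂ) : ℂ :=
  z * Complex.exp
    (((-(2 * Real.pi * n * Real.smoothTransition (‖z‖ ^ 2 - 1 / 2)) : ℝ) : ℂ) * Complex.I)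

theorem isOpen_planarAnnulus : IsOpen planarAnnulus :=
  (isOpen_lt continuous_const continuous_norm).inter (isOpen_lt continuous_norm continuous_const)

theorem norm_planarTwist (n : ℤ) (z : ℂ) : ‖planarTwist n z‖ = ‖z‖ := by
  rw [planarTwist, norm_mul, Complex.norm_exp_ofReal_mul_I, mul_one]

theorem planarTwist_mem {n : ℤ} {z : ℂ} (hz : z ∈ planarAnnulus) :
    planarTwist n z ∈ planarAnnulus := by
  change 1 / 2 < ‖planarTwist n z‖ ∧ ‖planarTwist n z‖ < 2
  rw [norm_planarTwist]
  exact hz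

theorem planarTwist_neg (n : ℤ) (z : ℂ) : planarTwist (-n) (planarTwist n z) = z := by
  rw [planarTwist, norm_planarTwist, planarTwist, mul_assoc, ← Complex.exp_add, ← add_mul,
    ← Complex.ofReal_add]
  have : -(2 * Real.pi * n * Real.smoothTransition (‖z‖ ^ 2 - 1 / 2)) +
      -(2 * Real.pi * ((-n : ℤ) : ℝ) * Real.smoothTransition (‖z‖ ^ 2 - 1 / 2)) = 0 := by
    push_cast; ring
  rw [this]; simp

theorem planarTwist_eq_self {n : ℤ} {z : ℂ} (hz : ‖z‖ ^ 2 ≤ 1 / 2 ∨ 3 / 2 ≤ ‖z‖ ^ 2) :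
    planarTwist n z = z := by
  rw [planarTwist]
  rcases hz with h | h
  · rw [Real.smoothTransition.zero_of_nonpos (by linarith)]; simp
  · rw [Real.smoothTransition.one_of_one_le (by linarith), mul_one]
    have : Complex.exp (((-(2 * Real.pi * n) : ℝ) : ℂ) * Complex.I) = 1 := by
      rw [Complex.exp_eq_one_iff]
      exact ⟨-n, by push_cast; ring⟩
    rw [this, mul_one]

theorem contDiff_planarTwist (n : ℤ) : ContDiff ℝ ∞ (planarTwist n) := by
  have h : ContDiff ℝ ∞ (fun z : ℂ =>
      (-(2 * Real.pi * n * Real.smoothTransition (‖z‖ ^ 2 - 1 / 2)) : ℝ)) := by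
    refine (contDiff_const.mul (Real.smoothTransition.contDiff.comp ?_)).neg
    exact (contDiff_norm_sq ℝ).sub contDiff_const
  have h2 : ContDiff ℝ ∞ (fun z : ℂ =>
      ((-(2 * Real.pi * n * Real.smoothTransition (‖z‖ ^ 2 - 1 / 2)) : ℝ) : ℂ)) :=
    Complex.ofRealCLM.contDiff.comp h
  exact contDiff_id.mul (h2.mul contDiff_const).cexp

/-- The planar twist preserves the area form of the plane. -/
theorem planarTwist_area (n : ℤ) (z v w : ℂ) :
    (starRingEnd ℂ (fderiv ℝ (planarTwist n) z v) * fderiv ℝ (planarTwist n) z w).im =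
      (starRingEnd ℂ v * w).im := by
  set β : ℝ → ℝ := fun s => -(2 * Real.pi * n * Real.smoothTransition (s - 1 / 2)) with hβ
  have hβd : Differentiable ℝ β := by
    have : ContDiff ℝ 1 β :=
      (contDiff_const.mul (Real.smoothTransition.contDiff.comp
        (contDiff_id.sub contDiff_const))).neg
    exact this.differentiable (by simp)
  set c : ℝ := deriv β (‖z‖ ^ 2) with hc
  have h1 : HasFDerivAt (fun z : ℂ => β (‖z‖ ^ 2)) (c • (2 • innerSL ℝ z)) z :=
    (hβd _).hasDerivAt.comp_hasFDerivAt z (hasStrictFDerivAt_norm_sq z).hasFDerivAt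
  have h2 : HasFDerivAt (fun z : ℂ => ((β (‖z‖ ^ 2) : ℝ) : ℂ) * Complex.I)
      ((Complex.ofRealCLM.comp (c • (2 • innerSL ℝ z))).smulRight Complex.I) z :=
    (Complex.ofRealCLM.hasFDerivAt.comp z h1).mul_const' Complex.I
  have h3 := (hasFDerivAt_id (𝕜 := ℝ) z).mul h2.cexp
  have h4 : fderiv ℝ (planarTwist n) z = _ := h3.fderiv
  set e : ℂ := Complex.exp (((β (‖z‖ ^ 2) : ℝ) : ℂ) * Complex.I) with he
  have hee : starRingEnd ℂ e * e = 1 := by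
    rw [← Complex.normSq_eq_conj_mul_self, Complex.normSq_eq_norm_sq, he,
      Complex.norm_exp_ofReal_mul_I]
    simp
  have h5 : ∀ u : ℂ, fderiv ℝ (planarTwist n) z u =
      e * (u + z * ((c * (2 * (starRingEnd ℂ z * u).re) : ℝ) : ℂ) * Complex.I) := by
    intro u
    rw [h4]
    simp [Complex.inner]
    ring
  rw [h5, h5, map_mul]
  have : ∀ a b : ℂ, starRingEnd ℂ e * a * (e * b) = a * b := by
    intro a b
    calc _ = (starRingEnd ℂ e * e) * (a * b) := by ring
      _ = _ := by rw [hee, one_mul]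
  rw [this]
  simp
  ring

section Annulus

variable (S B : Set (ℂ × ℂ))

/-- An oriented embedding of the open planar annulus onto an open subset of the surface `S`, away
from the boundary `B`: a diffeomorphism onto its image which preserves orientation. Its core is the
image of the circle `|z| = 1`. -/
structure EmbeddedAnnulus extends PartialEquiv ℂ S where
  source_eq : source = planarAnnulus
  isOpen_target : IsOpen target
  disjoint_boundary : ∀ p ∈ target, (p : ℂ × ℂ) ∉ B
  smooth_toFun : ∀ z ∈ source, SmoothAt id (fun w => (toFun w : ℂ × ℂ)) z
  smooth_invFun : ∀ p ∈ target, SmoothAt Subtype.val invFun p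
  orientation : ∀ z ∈ source, PosAt (fun w => (toFun w : ℂ × ℂ)) z

variable {S B}

namespace EmbeddedAnnulus

/-- The simple closed curve at the core of the annulus. -/
def core (A : EmbeddedAnnulus S B) : Set S := A.toFun '' {z | ‖z‖ = 1}

/-- The image of an annulus under a diffeomorphism. Its core is the image of the core. -/
def map (f : DiffPlus S B) (A : EmbeddedAnnulus S B) : EmbeddedAnnulus S B where
  toPartialEquiv := A.toPartialEquiv.transEquiv (f : Equiv.Perm S)
  source_eq := A.source_eq
  isOpen_target := by
    have hc : Continuous (f : Equiv.Perm S).symm :=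
      continuous_induced_rng.2 (continuous_iff_continuousAt.2 fun p =>
        (f.2.2.1 p).continuousAt Topology.IsInducing.subtypeVal)
    exact A.isOpen_target.preimage hc
  disjoint_boundary := by
    intro p hp hB
    have h1 : (f : Equiv.Perm S).symm p ∈ A.target := hp
    have h2 : (f : Equiv.Perm S).symm p = p :=
      (Equiv.symm_apply_eq _).2 (f.2.2.2.2.2 p hB).symm
    rw [h2] at h1
    exact A.disjoint_boundary p h1 hB
  smooth_toFun := fun z hz => (f.2.1 _).comp (A.smooth_toFun z hz)
  smooth_invFun := fun p hp => (A.smooth_invFun _ hp).comp (f.2.2.1 p)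
  orientation := fun z hz => f.2.2.2.1 _ z (A.smooth_toFun z hz) (A.orientation z hz)

open Classical in
/-- The `n`-fold twist of `S`: the planar twist on the annulus, the identity elsewhere. -/
def twistFun (A : EmbeddedAnnulus S B) (n : ℤ) (p : S) : S :=
  if p ∈ A.target then A.toFun (planarTwist n (A.invFun p)) else p

theorem invFun_mem (A : EmbeddedAnnulus S B) {p : S} (hp : p ∈ A.target) :
    A.invFun p ∈ planarAnnulus := by
  have := A.map_target' hp
  rwa [A.source_eq] at this

theorem toFun_mem (A : EmbeddedAnnulus S B) {z : ℂ} (hz : z ∈ planarAnnulus) :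
    A.toFun z ∈ A.target := by
  rw [← A.source_eq] at hz
  exact A.map_source' hz

theorem invFun_toFun (A : EmbeddedAnnulus S B) {z : ℂ} (hz : z ∈ planarAnnulus) :
    A.invFun (A.toFun z) = z := by
  rw [← A.source_eq] at hz
  exact A.left_inv' hz

theorem twistFun_neg (A : EmbeddedAnnulus S B) (n : ℤ) (p : S) :
    A.twistFun (-n) (A.twistFun n p) = p := by
  by_cases hp : p ∈ A.target
  · have h1 := planarTwist_mem (n := n) (A.invFun_mem hp)
    have h2 : A.twistFun n p = A.toFun (planarTwist n (A.invFun p)) := if_pos hp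
    rw [h2, twistFun, if_pos (A.toFun_mem h1), A.invFun_toFun h1, planarTwist_neg]
    exact A.right_inv' hp
  · have h2 : A.twistFun n p = p := if_neg hp
    rw [h2, h2.symm.trans h2, twistFun, if_neg hp]

theorem twistFun_local (A : EmbeddedAnnulus S B) (n : ℤ) (p : S) (hp : p ∉ A.target) :
    ∀ᶠ q in 𝓝 p, A.twistFun n q = q := by
  set K : Set ℂ := {z | 1 / 2 ≤ ‖z‖ ^ 2 ∧ ‖z‖ ^ 2 ≤ 3 / 2} with hK
  have hKs : K ⊆ planarAnnulus := by
    intro z hz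
    have h0 := norm_nonneg z
    constructor <;> nlinarith [hz.1, hz.2]
  have hKc : IsCompact K := by
    refine Metric.isCompact_of_isClosed_isBounded ?_ ?_
    · have hn : Continuous fun z : ℂ => ‖z‖ ^ 2 := by fun_prop
      exact (isClosed_le continuous_const hn).inter (isClosed_le hn continuous_const)
    · refine (Metric.isBounded_closedBall (x := (0 : ℂ)) (r := 2)).subset fun z hz => ?_
      rw [mem_closedBall_zero_iff]
      exact (hKs hz).2.le
  have hcont : ContinuousOn A.toFun K := by
    intro z hz
    have h1 := A.smooth_toFun z (by rw [A.source_eq]; exact hKs hz)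
    have h2 : ContinuousAt (fun w => (A.toFun w : ℂ × ℂ)) z :=
      h1.continuousAt Topology.IsInducing.id
    exact (Topology.IsInducing.subtypeVal.continuousAt_iff.2 h2).continuousWithinAt
  have hcl : IsClosed (A.toFun '' K) := (hKc.image_of_continuousOn hcont).isClosed
  have hpK : p ∉ A.toFun '' K := by
    rintro ⟨z, hz, rfl⟩
    exact hp (A.toFun_mem (hKs hz))
  filter_upwards [hcl.isOpen_compl.mem_nhds hpK] with q hq
  by_cases hqt : q ∈ A.target
  · rw [twistFun, if_pos hqt, planarTwist_eq_self]
    · exact A.right_inv' hqt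
    · by_contra hcon
      push Not at hcon
      exact hq ⟨A.invFun q, ⟨hcon.1.le, hcon.2.le⟩, A.right_inv' hqt⟩
  · rw [twistFun, if_neg hqt]

theorem twistFun_smooth (A : EmbeddedAnnulus S B) (n : ℤ) (p : S) :
    SmoothAt Subtype.val (fun q => (A.twistFun n q : ℂ × ℂ)) p := by
  by_cases hp : p ∈ A.target
  · have h1 : SmoothAt Subtype.val (fun q => planarTwist n (A.invFun q)) p :=
      SmoothAt.comp (ιY := id) (SmoothAt.of_contDiffWithin Filter.univ_mem
        (contDiff_planarTwist n).contDiffOn) (A.smooth_invFun p hp)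
    have h2 : planarTwist n (A.invFun p) ∈ A.source := by
      rw [A.source_eq]; exact planarTwist_mem (A.invFun_mem hp)
    have h3 : SmoothAt Subtype.val
        (fun q => (A.toFun (planarTwist n (A.invFun q)) : ℂ × ℂ)) p :=
      SmoothAt.comp (ιY := id) (f := fun q => planarTwist n (A.invFun q))
        (g := fun w => (A.toFun w : ℂ × ℂ)) (A.smooth_toFun _ h2) h1
    refine h3.congr Topology.IsInducing.subtypeVal ?_
    filter_upwards [A.isOpen_target.mem_nhds hp] with q hq
    rw [twistFun, if_pos hq]
  · refine (SmoothAt.incl _ p).congr Topology.IsInducing.subtypeVal ?_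
    filter_upwards [A.twistFun_local n p hp] with q hq
    rw [hq]

theorem areaForm_map (L : ℂ →L[ℝ] ℂ × ℂ) (v w : ℂ) :
    areaForm (L v) (L w) = (starRingEnd ℂ v * w).im * areaForm (L 1) (L Complex.I) := by
  have h : ∀ u : ℂ, L u = u.re • L 1 + u.im • L Complex.I := by
    intro u
    rw [← map_smul, ← map_smul, ← map_add]
    congr 1
    apply Complex.ext <;> simp
  rw [h v, h w]
  simp [areaForm]
  ring

theorem posAt_comp (A : EmbeddedAnnulus S B) {ψ : ℂ → ℂ} {z : ℂ}
    (hψ : DifferentiableAt ℝ ψ z) (hz : ψ z ∈ planarAnnulus) :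
    PosAt (fun w => (A.toFun (ψ w) : ℂ × ℂ)) z ↔
      0 < (starRingEnd ℂ (fderiv ℝ ψ z 1) * fderiv ℝ ψ z Complex.I).im := by
  have hz' : ψ z ∈ A.source := by rw [A.source_eq]; exact hz
  have h1 := (A.smooth_toFun _ hz').differentiableAt
  have h2 : fderiv ℝ (fun w => (A.toFun (ψ w) : ℂ × ℂ)) z =
      (fderiv ℝ (fun w => (A.toFun w : ℂ × ℂ)) (ψ z)).comp (fderiv ℝ ψ z) :=
    fderiv_comp z h1 hψ
  have h3 : 0 < areaForm (fderiv ℝ (fun w => (A.toFun w : ℂ × ℂ)) (ψ z) 1)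
      (fderiv ℝ (fun w => (A.toFun w : ℂ × ℂ)) (ψ z) Complex.I) := A.orientation _ hz'
  rw [PosAt, h2, ContinuousLinearMap.comp_apply, ContinuousLinearMap.comp_apply, areaForm_map]
  exact mul_pos_iff_of_pos_right h3

theorem twistFun_orientation (A : EmbeddedAnnulus S B) (n : ℤ) :
    OrientationPreserving (A.twistFun n) := by
  intro φ z hφ hpos
  have hcont : ContinuousAt φ z :=
    Topology.IsInducing.subtypeVal.continuousAt_iff.2
      (hφ.continuousAt Topology.IsInducing.id)
  by_cases hp : φ z ∈ A.target
  · have hev : ∀ᶠ w in 𝓝 z, φ w ∈ A.target := hcont (A.isOpen_target.mem_nhds hp)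
    have hψ : SmoothAt id (fun w => A.invFun (φ w)) z := (A.smooth_invFun _ hp).comp hφ
    have hψd := hψ.differentiableAt
    have hτd : DifferentiableAt ℝ (planarTwist n) (A.invFun (φ z)) :=
      (contDiff_planarTwist n).differentiable (by simp) _
    have hmem := A.invFun_mem hp
    have e1 : (fun w => (φ w : ℂ × ℂ)) =ᶠ[𝓝 z] fun w => (A.toFun (A.invFun (φ w)) : ℂ × ℂ) := by
      filter_upwards [hev] with w hw
      exact congrArg Subtype.val (A.right_inv' hw).symm
    have e2 : (fun w => (A.twistFun n (φ w) : ℂ × ℂ)) =ᶠ[𝓝 z]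
        fun w => (A.toFun (planarTwist n (A.invFun (φ w))) : ℂ × ℂ) := by
      filter_upwards [hev] with w hw
      rw [twistFun, if_pos hw]
    rw [PosAt, e1.fderiv_eq] at hpos
    have h1 := (A.posAt_comp hψd hmem).1 hpos
    rw [PosAt, e2.fderiv_eq]
    have e5 : DifferentiableAt ℝ (fun w => planarTwist n (A.invFun (φ w))) z :=
      DifferentiableAt.comp (g := planarTwist n) z hτd hψd
    have e3 : fderiv ℝ (fun w => planarTwist n (A.invFun (φ w))) z =
        (fderiv ℝ (planarTwist n) (A.invFun (φ z))).comp
          (fderiv ℝ (fun w => A.invFun (φ w)) z) :=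
      fderiv_comp (g := planarTwist n) z hτd hψd
    refine (A.posAt_comp (ψ := fun w => planarTwist n (A.invFun (φ w))) e5
      (planarTwist_mem hmem)).2 ?_
    rw [e3, ContinuousLinearMap.comp_apply, ContinuousLinearMap.comp_apply, planarTwist_area]
    exact h1
  · have e1 : (fun w => (A.twistFun n (φ w) : ℂ × ℂ)) =ᶠ[𝓝 z] fun w => (φ w : ℂ × ℂ) := by
      filter_upwards [hcont (A.twistFun_local n _ hp)] with w hw
      exact congrArg Subtype.val hw
    rw [PosAt, e1.fderiv_eq]
    exact hpos

/-- The positive (right-handed) Dehn twist along the core of the annulus `A`, as a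
diffeomorphism supported in `A`. -/
def dehnTwist (A : EmbeddedAnnulus S B) : DiffPlus S B :=
  ⟨{ toFun := A.twistFun 1
     invFun := A.twistFun (-1)
     left_inv := A.twistFun_neg 1
     right_inv := fun p => by simpa using A.twistFun_neg (-1) p },
    A.twistFun_smooth 1, A.twistFun_smooth (-1), A.twistFun_orientation 1,
    A.twistFun_orientation (-1),
    fun p hp => if_neg fun h => A.disjoint_boundary p h hp⟩

/-- The mapping class `t_c` of the positive Dehn twist along the core `c` of the annulus. -/
def twistClass (A : EmbeddedAnnulus S B) : MappingClassGroup S B :=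
  QuotientGroup.mk A.dehnTwist

open Classical in
/-- The embedded annulus parametrized by a holomorphic map `F` into the complex curve `S`, with
image the points of `S` in the open set `Ω` where the holomorphic left inverse `G` takes values in
the planar annulus (`s` is an irrelevant value outside of the annulus). -/
def ofHolomorphic (s : S) (F : ℂ → ℂ × ℂ) (G : ℂ × ℂ → ℂ) (Ω : Set (ℂ × ℂ)) (hΩ : IsOpen Ω)
    (hF : ContDiffOn ℂ ∞ F planarAnnulus) (hG : ContDiffOn ℂ ∞ G Ω)
    (hFS : ∀ z ∈ planarAnnulus, F z ∈ S) (hFB : ∀ z ∈ planarAnnulus, F z ∉ B)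
    (hFΩ : ∀ z ∈ planarAnnulus, F z ∈ Ω) (hGF : ∀ z ∈ planarAnnulus, G (F z) = z)
    (hFG : ∀ p ∈ S, p ∈ Ω → G p ∈ planarAnnulus → F (G p) = p) : EmbeddedAnnulus S B where
  toFun z := if h : z ∈ planarAnnulus then ⟨F z, hFS z h⟩ else s
  invFun p := G p
  source := planarAnnulus
  target := {p | (p : ℂ × ℂ) ∈ Ω ∧ G p ∈ planarAnnulus}
  map_source' := fun z hz => by
    rw [dif_pos hz]
    exact ⟨hFΩ z hz, by simpa only [hGF z hz] using hz⟩
  map_target' := fun p hp => hp.2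
  left_inv' := fun z hz => by rw [dif_pos hz]; exact hGF z hz
  right_inv' := fun p hp => by rw [dif_pos hp.2]; exact Subtype.ext (hFG p p.2 hp.1 hp.2)
  source_eq := rfl
  isOpen_target :=
    (hG.continuousOn.isOpen_inter_preimage hΩ isOpen_planarAnnulus).preimage continuous_subtype_val
  disjoint_boundary := fun p hp hB => by
    rw [← hFG p p.2 hp.1 hp.2] at hB
    exact hFB _ hp.2 hB
  smooth_toFun := fun z hz => by
    refine SmoothAt.congr (f := F) Topology.IsInducing.id
      (SmoothAt.of_contDiffWithin (isOpen_planarAnnulus.mem_nhds hz) (hF.restrict_scalars ℝ)) ?_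
    filter_upwards [isOpen_planarAnnulus.mem_nhds hz] with w hw
    rw [dif_pos hw]
  smooth_invFun := fun p hp =>
    SmoothAt.of_contDiffAt (hΩ.mem_nhds hp.1) (hG.restrict_scalars ℝ)
  orientation := fun z hz => by
    have hnear := isOpen_planarAnnulus.mem_nhds hz
    have hd : DifferentiableAt ℂ F z := (hF.contDiffAt hnear).differentiableAt (by simp)
    have hdG : DifferentiableAt ℂ G (F z) :=
      (hG.contDiffAt (hΩ.mem_nhds (hFΩ z hz))).differentiableAt (by simp)
    have e : (fun w => ((if h : w ∈ planarAnnulus then ⟨F w, hFS w h⟩ else s : S) : ℂ × ℂ))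
        =ᶠ[𝓝 z] F := by
      filter_upwards [hnear] with w hw
      rw [dif_pos hw]
    have hne : deriv F z ≠ 0 := by
      intro h0
      have h1 : HasDerivAt (fun w => G (F w)) (fderiv ℂ G (F z) (deriv F z)) z :=
        hdG.hasFDerivAt.comp_hasDerivAt z hd.hasDerivAt
      have h2 : HasDerivAt (fun w => G (F w)) 1 z := by
        refine (hasDerivAt_id z).congr_of_eventuallyEq ?_
        filter_upwards [hnear] with w hw using hGF w hw
      have h3 := h1.unique h2
      rw [h0, map_zero] at h3
      exact zero_ne_one h3
    have hv : ∀ v : ℂ, fderiv ℝ F z v = v • deriv F z := by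
      intro v
      rw [(hd.hasDerivAt.hasFDerivAt.restrictScalars ℝ).fderiv]
      simp
    rw [PosAt, e.fderiv_eq, hv, hv, one_smul, areaForm]
    clear hv e
    generalize deriv F z = D at hne ⊢
    obtain ⟨a, b⟩ := D
    have hab : a ≠ 0 ∨ b ≠ 0 := by
      by_contra hcon
      push Not at hcon
      exact hne (Prod.ext hcon.1 hcon.2)
    have h4 : (starRingEnd ℂ a * (Complex.I * a) + starRingEnd ℂ b * (Complex.I * b)).im =
        Complex.normSq a + Complex.normSq b := by
      simp [Complex.normSq_apply]
    simp only [Prod.smul_mk, smul_eq_mul]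
    rw [h4]
    rcases hab with h | h
    · exact add_pos_of_pos_of_nonneg (Complex.normSq_pos.2 h) (Complex.normSq_nonneg b)
    · exact add_pos_of_nonneg_of_pos (Complex.normSq_nonneg a) (Complex.normSq_pos.2 h)

end EmbeddedAnnulus

end Annulus

/-! ### The surface of genus `g` with two boundary components, and its curves -/

section Model

/-- The `2g + 2` branch points `p₁ < ⋯ < p_{2g+2}`, namely the odd integers from `-(2g+1)` to
`2g+1`. -/
def branchPoint (g k : ℕ) : ℝ := 2 * k - (2 * g + 3)

/-- The radius `8 (g + 1)` of the disc which carries the double covering. -/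
def radius (g : ℕ) : ℝ := 8 * (g + 1)

/-- The surface `Σ_g²`: the compact part `|x| ≤ 8 (g + 1)` of the smooth affine complex curve
`y² = (x - p₁) ⋯ (x - p_{2g+2})`. By `(x, y) ↦ x` it is the double covering of a closed disc
branched at `2g + 2` interior points; hence it is a compact connected surface with two boundary
circles and Euler characteristic `2 - (2g + 2) = -2g`, that is, of genus `g`. -/
def surface (g : ℕ) : Set (ℂ × ℂ) :=
  {p | p.2 ^ 2 = ∏ k ∈ Finset.Icc 1 (2 * g + 2), (p.1 - branchPoint g k) ∧ ‖p.1‖ ≤ radius g}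

/-- The boundary `|x| = 8 (g + 1)` of the surface `Σ_g²`. -/
def surfaceBoundary (g : ℕ) : Set (ℂ × ℂ) := {p | p ∈ surface g ∧ ‖p.1‖ = radius g}

/-- The mapping class group `Γ_g²` of `Σ_g²` relative to its boundary. -/
abbrev Gamma (g : ℕ) : Type := MappingClassGroup (surface g) (surfaceBoundary g)

/-- Embedded annuli in the interior of `Σ_g²`. -/
abbrev Annulus (g : ℕ) : Type := EmbeddedAnnulus (surface g) (surfaceBoundary g)

/-- The ramification point `(p₁, 0)`. -/
def basePoint (g : ℕ) : surface g :=
  ⟨(branchPoint g 1, 0), by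
    constructor
    · rw [Finset.prod_eq_zero (i := 1) (by simp) (by simp)]; simp
    · have h : (0 : ℝ) ≤ g := Nat.cast_nonneg g
      simp only [Complex.norm_real, Real.norm_eq_abs, abs_le, branchPoint, radius]
      push_cast
      constructor <;> linarith⟩

/-- The principal square root on the plane cut along the negative real axis. -/
def csqrt (w : ℂ) : ℂ := Complex.exp (Complex.log w / 2)

theorem csqrt_sq {w : ℂ} (hw : w ≠ 0) : csqrt w ^ 2 = w := by
  rw [csqrt, ← Complex.exp_nat_mul]
  have : ((2 : ℕ) : ℂ) * (Complex.log w / 2) = Complex.log w := by push_cast; ring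
  rw [this, Complex.exp_log hw]

theorem csqrt_ne_zero (w : ℂ) : csqrt w ≠ 0 := Complex.exp_ne_zero _

theorem contDiffAt_csqrt {w : ℂ} (hw : w ∈ Complex.slitPlane) : ContDiffAt ℂ ∞ csqrt w :=
  ((Complex.contDiffAt_log hw).div_const 2).cexp

/-- The midpoint `p_i + 1` of the branch points `p_i` and `p_{i+1} = p_i + 2`. -/
def midPoint (g i : ℕ) : ℝ := branchPoint g i + 1

/-- The strip `|Re x - midPoint g i| < 3`, which contains no other branch points than `p_i` and
`p_{i+1}`. -/
def strip (g i : ℕ) : Set ℂ := {x | |x.re - midPoint g i| < 3}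

theorem isOpen_strip (g i : ℕ) : IsOpen (strip g i) :=
  isOpen_lt (by fun_prop) continuous_const

/-- The factor with index `k` of the function `coRoot`. -/
def coRootFactor (g i k : ℕ) (x : ℂ) : ℂ :=
  if k < i then csqrt (x - branchPoint g k)
  else if i + 1 < k then Complex.I * csqrt (branchPoint g k - x) else 1

/-- On the strip, a holomorphic square root of the product of the `x - p_k` over all
`k ≠ i, i + 1`. -/
def coRoot (g i : ℕ) (x : ℂ) : ℂ := ∏ k ∈ Finset.Icc 1 (2 * g + 2), coRootFactor g i k x

theorem strip_left {g i k : ℕ} {x : ℂ} (hx : x ∈ strip g i) (hk : k < i) :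
    0 < (x - branchPoint g k).re := by
  have h1 := (abs_lt.1 (show |x.re - midPoint g i| < 3 from hx)).1
  have h2 : (k : ℝ) + 1 ≤ i := by exact_mod_cast hk
  simp only [midPoint, branchPoint] at h1
  simp only [branchPoint, Complex.sub_re, Complex.ofReal_re]
  linarith

theorem strip_right {g i k : ℕ} {x : ℂ} (hx : x ∈ strip g i) (hk : i + 1 < k) :
    0 < (branchPoint g k - x).re := by
  have h1 := (abs_lt.1 (show |x.re - midPoint g i| < 3 from hx)).2
  have h2 : (i : ℝ) + 2 ≤ k := by exact_mod_cast hk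
  simp only [midPoint, branchPoint] at h1
  simp only [branchPoint, Complex.sub_re, Complex.ofReal_re]
  linarith

theorem ne_zero_of_re_pos {w : ℂ} (h : 0 < w.re) : w ≠ 0 := by
  rintro rfl
  simp at h

theorem coRootFactor_ne_zero (g i k : ℕ) (x : ℂ) : coRootFactor g i k x ≠ 0 := by
  unfold coRootFactor
  split_ifs
  · exact csqrt_ne_zero _
  · exact mul_ne_zero Complex.I_ne_zero (csqrt_ne_zero _)
  · exact one_ne_zero

theorem coRoot_ne_zero (g i : ℕ) (x : ℂ) : coRoot g i x ≠ 0 :=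
  Finset.prod_ne_zero_iff.2 fun k _ => coRootFactor_ne_zero g i k x

theorem contDiffOn_coRoot (g i : ℕ) : ContDiffOn ℂ ∞ (coRoot g i) (strip g i) := by
  unfold coRoot
  refine contDiffOn_prod fun k _ x hx => ContDiffAt.contDiffWithinAt ?_
  unfold coRootFactor
  split_ifs with h1 h2
  · exact ContDiffAt.comp (g := csqrt) x (contDiffAt_csqrt (Or.inl (strip_left hx h1)))
      (contDiffAt_id.sub contDiffAt_const)
  · exact contDiffAt_const.mul (ContDiffAt.comp (g := csqrt) x
      (contDiffAt_csqrt (Or.inl (strip_right hx h2))) (contDiffAt_const.sub contDiffAt_id))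
  · exact contDiffAt_const

theorem prod_eq_coRoot {g i : ℕ} (hi : 1 ≤ i ∧ i ≤ 2 * g + 1) {x : ℂ} (hx : x ∈ strip g i) :
    ∏ k ∈ Finset.Icc 1 (2 * g + 2), (x - branchPoint g k) =
      ((x - midPoint g i) ^ 2 - 1) * coRoot g i x ^ 2 := by
  have h : ∀ k ∈ Finset.Icc 1 (2 * g + 2), (x - branchPoint g k) =
      (if k = i then (x - branchPoint g i) else 1) *
      (if k = i + 1 then (x - branchPoint g (i + 1)) else 1) * coRootFactor g i k x ^ 2 := by
    intro k _
    unfold coRootFactor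
    rcases lt_trichotomy k i with h | h | h
    · rw [if_neg (by omega), if_neg (by omega), if_pos h,
        csqrt_sq (ne_zero_of_re_pos (strip_left hx h))]
      ring
    · subst h
      simp
    · rcases eq_or_ne k (i + 1) with h' | h'
      · subst h'
        simp
      · have h2 : i + 1 < k := by omega
        rw [if_neg (by omega), if_neg h', if_neg (by omega), if_pos h2, mul_pow,
          csqrt_sq (ne_zero_of_re_pos (strip_right hx h2)), Complex.I_sq]
        ring
  rw [Finset.prod_congr rfl h, Finset.prod_mul_distrib, Finset.prod_mul_distrib,
    Finset.prod_ite_eq', Finset.prod_ite_eq', if_pos (by simp; omega), if_pos (by simp; omega),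
    Finset.prod_pow, coRoot]
  congr 1
  simp only [midPoint, branchPoint]
  push_cast
  ring

theorem joukowski_bound {z : ℂ} (hz : z ∈ planarAnnulus) : ‖(z + z⁻¹) / 2‖ < 2 := by
  have h0 : 0 < ‖z‖ := by linarith [hz.1]
  have h1 : ‖z‖⁻¹ < 2 := by
    rw [inv_lt_comm₀ h0 (by norm_num)]
    linarith [hz.1]
  rw [norm_div, Complex.norm_two]
  have h2 := norm_add_le z z⁻¹
  rw [norm_inv] at h2
  linarith [hz.2]

theorem joukowski_strip (g i : ℕ) {z : ℂ} (hz : z ∈ planarAnnulus) :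
    (midPoint g i : ℂ) + (z + z⁻¹) / 2 ∈ strip g i := by
  have h1 := (Complex.abs_re_le_norm ((z + z⁻¹) / 2)).trans_lt (joukowski_bound hz)
  change |((midPoint g i : ℂ) + (z + z⁻¹) / 2).re - midPoint g i| < 3
  rw [Complex.add_re, Complex.ofReal_re, add_sub_cancel_left]
  linarith

theorem joukowski_norm {g i : ℕ} (hi : 1 ≤ i ∧ i ≤ 2 * g + 1) {z : ℂ} (hz : z ∈ planarAnnulus) :
    ‖(midPoint g i : ℂ) + (z + z⁻¹) / 2‖ < radius g := by
  have h1 := joukowski_bound hz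
  have h2 := norm_add_le (midPoint g i : ℂ) ((z + z⁻¹) / 2)
  have h3 : ‖(midPoint g i : ℂ)‖ ≤ 2 * g := by
    have h4 : (1 : ℝ) ≤ i := by exact_mod_cast hi.1
    have h5 : (i : ℝ) ≤ 2 * g + 1 := by exact_mod_cast hi.2
    rw [Complex.norm_real, Real.norm_eq_abs, abs_le, midPoint, branchPoint]
    constructor <;> linarith
  have h6 : (0 : ℝ) ≤ g := Nat.cast_nonneg g
  rw [radius]
  linarith

/-- For `1 ≤ i ≤ 2g+1`, the annulus around the curve `c_i`, the preimage of the segment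
`[p_i, p_{i+1}]` under `(x, y) ↦ x`. It is the preimage of the interior of an ellipse with foci
`p_i` and `p_{i+1}`, parametrized by `x = (p_i + p_{i+1}) / 2 + (z + z⁻¹) / 2`. -/
def chainAnnulus (g i : ℕ) (hi : 1 ≤ i ∧ i ≤ 2 * g + 1) : Annulus g :=
  EmbeddedAnnulus.ofHolomorphic (basePoint g)
    (fun z => (midPoint g i + (z + z⁻¹) / 2,
      (z - z⁻¹) / 2 * coRoot g i (midPoint g i + (z + z⁻¹) / 2)))
    (fun p => (p.1 - midPoint g i) + p.2 / coRoot g i p.1)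
    (Prod.fst ⁻¹' strip g i)
    ((isOpen_strip g i).preimage continuous_fst)
    (by
      have hinv : ContDiffOn ℂ ∞ (fun z : ℂ => z⁻¹) planarAnnulus :=
        contDiffOn_id.inv fun z hz => by
          have : 0 < ‖z‖ := by linarith [hz.1]
          exact norm_pos_iff.1 this
      have hx : ContDiffOn ℂ ∞ (fun z : ℂ => (midPoint g i : ℂ) + (z + z⁻¹) / 2)
          planarAnnulus := contDiffOn_const.add ((contDiffOn_id.add hinv).div_const 2)
      exact hx.prodMk (((contDiffOn_id.sub hinv).div_const 2).mul
        ((contDiffOn_coRoot g i).comp hx fun z hz => joukowski_strip g i hz)))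
    (by
      refine (contDiff_fst.contDiffOn.sub contDiffOn_const).add
        (contDiff_snd.contDiffOn.div ?_ fun p _ => coRoot_ne_zero g i p.1)
      exact (contDiffOn_coRoot g i).comp contDiff_fst.contDiffOn fun p hp => hp)
    (fun z hz => by
      have hz0 : z ≠ 0 := norm_pos_iff.1 (by linarith [hz.1])
      refine ⟨?_, (joukowski_norm hi hz).le⟩
      rw [prod_eq_coRoot hi (joukowski_strip g i hz), mul_pow]
      congr 1
      field_simp
      ring)
    (fun z hz hB => (joukowski_norm hi hz).ne hB.2)
    (fun z hz => joukowski_strip g i hz)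
    (fun z hz => by
      have hne := coRoot_ne_zero g i (midPoint g i + (z + z⁻¹) / 2)
      simp only [mul_div_assoc, div_self hne]
      ring)
    (fun p hp hs hz => by
      have hne := coRoot_ne_zero g i p.1
      have h1 := hp.1
      rw [prod_eq_coRoot hi hs] at h1
      have h2 : ((p.1 - midPoint g i) + p.2 / coRoot g i p.1)⁻¹ =
          (p.1 - midPoint g i) - p.2 / coRoot g i p.1 := by
        refine inv_eq_of_mul_eq_one_right ?_
        have h3 : (p.2 / coRoot g i p.1) ^ 2 = (p.1 - midPoint g i) ^ 2 - 1 := by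
          rw [div_pow, h1, mul_div_assoc, div_self (pow_ne_zero 2 hne), mul_one]
        linear_combination -h3
      have h4 : (midPoint g i : ℂ) + (((p.1 - midPoint g i) + p.2 / coRoot g i p.1) +
          ((p.1 - midPoint g i) + p.2 / coRoot g i p.1)⁻¹) / 2 = p.1 := by
        rw [h2]; ring
      refine Prod.ext h4 ?_
      change _ * coRoot g i _ = p.2
      rw [h4, h2]
      field_simp
      ring)

/-- On `|x| > 2g + 2`, a holomorphic square root of `(x - p₁) ⋯ (x - p_{2g+2})`. -/
def outerRoot (g : ℕ) (x : ℂ) : ℂ :=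
  x ^ (g + 1) * ∏ k ∈ Finset.Icc 1 (2 * g + 2), csqrt (1 - branchPoint g k / x)

/-- The region `|x| > 2g + 2`. -/
def outerRegion (g : ℕ) : Set ℂ := {x | 2 * (g + 1 : ℝ) < ‖x‖}

theorem outer_ne_zero {g : ℕ} {x : ℂ} (hx : x ∈ outerRegion g) : x ≠ 0 := by
  have h : (0 : ℝ) ≤ g := Nat.cast_nonneg g
  have h1 : 2 * (g + 1 : ℝ) < ‖x‖ := hx
  exact norm_pos_iff.1 (by linarith)

theorem outer_re_pos {g k : ℕ} (hk : k ∈ Finset.Icc 1 (2 * g + 2)) {x : ℂ}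
    (hx : x ∈ outerRegion g) : 0 < (1 - branchPoint g k / x).re := by
  have h1 : 2 * (g + 1 : ℝ) < ‖x‖ := hx
  have h2 : ‖(branchPoint g k : ℂ) / x‖ < 1 := by
    rw [norm_div, div_lt_one (norm_pos_iff.2 (outer_ne_zero hx))]
    refine lt_of_le_of_lt ?_ h1
    rw [Finset.mem_Icc] at hk
    have h4 : (1 : ℝ) ≤ k := by exact_mod_cast hk.1
    have h5 : (k : ℝ) ≤ 2 * g + 2 := by exact_mod_cast hk.2
    rw [Complex.norm_real, Real.norm_eq_abs, abs_le, branchPoint]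
    constructor <;> linarith
  have h3 := (Complex.re_le_norm _).trans_lt h2
  rw [Complex.sub_re, Complex.one_re]
  linarith

theorem outerRoot_ne_zero {g : ℕ} {x : ℂ} (hx : x ∈ outerRegion g) : outerRoot g x ≠ 0 :=
  mul_ne_zero (pow_ne_zero _ (outer_ne_zero hx))
    (Finset.prod_ne_zero_iff.2 fun _ _ => csqrt_ne_zero _)

theorem outerRoot_sq {g : ℕ} {x : ℂ} (hx : x ∈ outerRegion g) :
    outerRoot g x ^ 2 = ∏ k ∈ Finset.Icc 1 (2 * g + 2), (x - branchPoint g k) := by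
  have hx0 := outer_ne_zero hx
  have h1 : ∀ k ∈ Finset.Icc 1 (2 * g + 2),
      x - (branchPoint g k : ℂ) = x * csqrt (1 - branchPoint g k / x) ^ 2 := by
    intro k hk
    rw [csqrt_sq (ne_zero_of_re_pos (outer_re_pos hk hx))]
    field_simp
  rw [Finset.prod_congr rfl h1, Finset.prod_mul_distrib, Finset.prod_const, Nat.card_Icc,
    Finset.prod_pow, outerRoot, mul_pow, ← pow_mul]
  congr 2
  omega

theorem contDiffOn_outerRoot (g : ℕ) : ContDiffOn ℂ ∞ (outerRoot g) (outerRegion g) := by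
  refine (contDiff_id.pow _).contDiffOn.mul
    (contDiffOn_prod fun k hk x hx => ContDiffAt.contDiffWithinAt ?_)
  exact ContDiffAt.comp (g := csqrt) (f := fun x : ℂ => 1 - branchPoint g k / x) x
    (contDiffAt_csqrt (Or.inl (outer_re_pos hk hx))) (contDiffAt_const.sub (contDiffAt_const.div contDiffAt_id (outer_ne_zero hx)))

theorem isOpen_outerRegion (g : ℕ) : IsOpen (outerRegion g) :=
  isOpen_lt continuous_const continuous_norm

theorem outer_mem (g : ℕ) {z : ℂ} (hz : z ∈ planarAnnulus) :
    4 * (g + 1 : ℂ) * z ∈ outerRegion g ∧ ‖4 * (g + 1 : ℂ) * z‖ < radius g := by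
  have h : (0 : ℝ) ≤ g := Nat.cast_nonneg g
  have h1 : ‖4 * (g + 1 : ℂ) * z‖ = 4 * (g + 1) * ‖z‖ := by
    have : (4 * (g + 1 : ℂ)) = ((4 * (g + 1) : ℝ) : ℂ) := by push_cast; ring
    rw [norm_mul, this, Complex.norm_real, Real.norm_eq_abs, abs_of_nonneg (by linarith)]
  constructor
  · change 2 * (g + 1 : ℝ) < ‖4 * (g + 1 : ℂ) * z‖
    rw [h1]
    nlinarith [hz.1]
  · rw [h1, radius]
    nlinarith [hz.2]

/-- The two annuli `2g + 2 < |x| < 8g + 8`, `y = ± outerRoot g x`, one on each sheet of the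
covering (`s = 1` or `s = -1`). They are collars of the two boundary circles; their cores
`|x| = 4g + 4` are parallel to the boundary. -/
def collarAnnulus (g : ℕ) (s : ℤˣ) : Annulus g :=
  EmbeddedAnnulus.ofHolomorphic (basePoint g)
    (fun z => (4 * (g + 1 : ℂ) * z, ((s : ℤ) : ℂ) * outerRoot g (4 * (g + 1 : ℂ) * z)))
    (fun p => p.1 / (4 * (g + 1 : ℂ)))
    {p | p ∈ Prod.fst ⁻¹' outerRegion g ∧ 0 < (((s : ℤ) : ℂ) * (p.2 / outerRoot g p.1)).re}
    (by
      have h1 : IsOpen (Prod.fst ⁻¹' outerRegion g : Set (ℂ × ℂ)) :=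
        (isOpen_outerRegion g).preimage continuous_fst
      have h2 : ContinuousOn (fun p : ℂ × ℂ => (((s : ℤ) : ℂ) * (p.2 / outerRoot g p.1)).re)
          (Prod.fst ⁻¹' outerRegion g) :=
        Complex.continuous_re.comp_continuousOn (continuousOn_const.mul
          (continuousOn_snd.div ((contDiffOn_outerRoot g).continuousOn.comp continuousOn_fst
            fun p hp => hp) fun p hp => outerRoot_ne_zero hp))
      exact h2.isOpen_inter_preimage h1 isOpen_Ioi)
    (by
      have h1 : ContDiffOn ℂ ∞ (fun z : ℂ => 4 * (g + 1 : ℂ) * z) planarAnnulus :=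
        contDiffOn_const.mul contDiffOn_id
      exact h1.prodMk (contDiffOn_const.mul
        ((contDiffOn_outerRoot g).comp h1 fun z hz => (outer_mem g hz).1)))
    (contDiff_fst.contDiffOn.div_const _)
    (fun z hz => by
      refine ⟨?_, (outer_mem g hz).2.le⟩
      have hs : (((s : ℤ) : ℂ)) ^ 2 = 1 := by
        rcases Int.units_eq_one_or s with rfl | rfl <;> simp
      rw [mul_pow, hs, one_mul]
      exact outerRoot_sq (outer_mem g hz).1)
    (fun z hz hB => (outer_mem g hz).2.ne hB.2)
    (fun z hz => by
      refine ⟨(outer_mem g hz).1, ?_⟩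
      have hs : (((s : ℤ) : ℂ)) * ((s : ℤ) : ℂ) = 1 := by
        rcases Int.units_eq_one_or s with rfl | rfl <;> simp
      have hne := outerRoot_ne_zero (outer_mem g hz).1
      simp only [mul_div_assoc, div_self hne, mul_one, hs]
      simp)
    (fun z hz => by
      have : (g + 1 : ℂ) ≠ 0 := by exact_mod_cast Nat.succ_ne_zero g
      field_simp)
    (fun p hp hs hz => by
      have hg : (g + 1 : ℂ) ≠ 0 := by exact_mod_cast Nat.succ_ne_zero g
      have h1 : 4 * (g + 1 : ℂ) * (p.1 / (4 * (g + 1 : ℂ))) = p.1 := by field_simp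
      have hne := outerRoot_ne_zero hs.1
      have h2 : (p.2 / outerRoot g p.1) ^ 2 = 1 := by
        rw [div_pow, hp.1, outerRoot_sq hs.1]
        rw [← outerRoot_sq hs.1]
        exact div_self (pow_ne_zero 2 hne)
      have hre := hs.2
      have hsw : ((s : ℤ) : ℂ) = p.2 / outerRoot g p.1 := by
        rcases Int.units_eq_one_or s with rfl | rfl <;>
          rcases mul_self_eq_one_iff.1 ((sq _).symm.trans h2) with h3 | h3 <;>
          rw [h3] at hre <;> norm_num at hre <;> rw [h3] <;> norm_num
      refine Prod.ext h1 ?_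
      change ((s : ℤ) : ℂ) * outerRoot g _ = p.2
      rw [h1, hsw]
      exact div_mul_cancel₀ _ hne)

/-- The annulus around the curve `c_i`, `1 ≤ i ≤ 2g+1` (for other `i`, which are never used, it is
the annulus around `c_1`). The curves `c_1, …, c_{2g+1}` form a chain: `c_i` and `c_{i+1}` meet
transversally in the single point over `p_{i+1}`, and `c_i`, `c_j` are disjoint for
`|i - j| ≥ 2`. The complement of the chain is a collar of the boundary. -/
def c (g i : ℕ) : Annulus g :=
  if h : 1 ≤ i ∧ i ≤ 2 * g + 1 then chainAnnulus g i h
  else chainAnnulus g 1 ⟨le_rfl, Nat.le_add_left 1 (2 * g)⟩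

/-- The annulus around the boundary-parallel curve `δ₁`. -/
def delta (g : ℕ) : Annulus g := collarAnnulus g 1

/-- The annulus around the other boundary-parallel curve `δ₁'`. -/
def delta' (g : ℕ) : Annulus g := collarAnnulus g (-1)

/-- The annulus around `d_j = t_{c_{j-3}}⁻¹ t_{c_{j-2}}⁻¹ t_{c_{j-1}}⁻¹ (c_j)`, `4 ≤ j ≤ 2g+1`. -/
def d (g j : ℕ) : Annulus g :=
  (c g j).map ((c g (j - 3)).dehnTwist⁻¹ * (c g (j - 2)).dehnTwist⁻¹ * (c g (j - 1)).dehnTwist⁻¹)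

/-- The annulus around `e_j = t_{c_{j-3}} t_{c_{j-2}} t_{c_{j-1}} (c_j)`, `4 ≤ j ≤ 2g+1`. -/
def e (g j : ℕ) : Annulus g :=
  (c g j).map ((c g (j - 3)).dehnTwist * (c g (j - 2)).dehnTwist * (c g (j - 1)).dehnTwist)

end Model

/-! ### Factorizations and Hurwitz equivalence -/

/-- An elementary transformation (Hurwitz move) of a tuple of elements of a group:
`(…, a, b, …) ↦ (…, b, b⁻¹ a b, …)`. -/
inductive HurwitzMove {G : Type*} [Group G] : List G → List G → Prop
  | move (l r : List G) (a b : G) :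
      HurwitzMove (l ++ a :: b :: r) (l ++ b :: (b⁻¹ * a * b) :: r)

/-- Two tuples are Hurwitz equivalent when they are related by a finite sequence of Hurwitz moves
and their inverses. -/
def HurwitzEquiv {G : Type*} [Group G] : List G → List G → Prop :=
  Relation.EqvGen HurwitzMove

/-- The `n`-th power of a word. -/
def wordPow {G : Type*} (w : List G) (n : ℕ) : List G := (List.replicate n w).flatten

section Words

variable (g : ℕ)

/-- The mapping class `t_{c_i}`. -/
def tc (i : ℕ) : Gamma g := (c g i).twistClass

/-- The word `t_{c_a} t_{c_{a+1}} ⋯ t_{c_b}`. -/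
def chainWord (a b : ℕ) : List (Gamma g) := (List.Ico a (b + 1)).map (tc g)

/-- The word `D_g = t_{d_4} t_{d_5} ⋯ t_{d_{2g+1}}`. -/
def wordD : List (Gamma g) := (List.Ico 4 (2 * g + 2)).map fun j => (d g j).twistClass

/-- The word `E_g = t_{e_{2g+1}} ⋯ t_{e_5} t_{e_4}`. -/
def wordE : List (Gamma g) := ((List.Ico 4 (2 * g + 2)).map fun j => (e g j).twistClass).reverse

/-- The word `(t_{c_1} t_{c_2} ⋯ t_{c_{2g+1}})^{2g+2}` of the odd chain relation. -/
def chainFactorization : List (Gamma g) := wordPow (chainWord g 1 (2 * g + 1)) (2 * g + 2)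

/-- The word `(t_{c_1} t_{c_2} t_{c_3})^{4g} D_g E_g (t_{c_5} ⋯ t_{c_{2g+1}})^{2g-2}`. -/
def oddFactorization : List (Gamma g) :=
  wordPow [tc g 1, tc g 2, tc g 3] (4 * g) ++ wordD g ++ wordE g ++
    wordPow (chainWord g 5 (2 * g + 1)) (2 * g - 2)

/-- The word `(t_{c_1} t_{c_2} t_{c_3})^{4(g-1)+2} (t_{c_3} t_{c_2} t_{c_1})² D_g E_g
(t_{c_5} ⋯ t_{c_{2g+1}})^{2g-2}`. -/
def evenFactorization : List (Gamma g) :=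
  wordPow [tc g 1, tc g 2, tc g 3] (4 * (g - 1) + 2) ++ wordPow [tc g 3, tc g 2, tc g 1] 2 ++
    wordD g ++ wordE g ++ wordPow (chainWord g 5 (2 * g + 1)) (2 * g - 2)

end Words

end

end SurfaceMCG

namespace SurfaceMCG

noncomputable section

/-! ### Diffeomorphisms of the plane which lift to the surface -/

/-! The surface is a double covering of a disc branched at p_1, …, p_{2g+2}, and the geometry is
done downstairs. A diffeomorphism f of the plane, trivial near infinity, lifts by (x, y) ↦ (f x, r x
· y) once `poly` ∘ f / `poly` has a smooth nowhere zero square root r equal to 1 far out. Such r is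
unique, so lifting is a homomorphism (`BaseDiffeo.lift`), and isotopies which permute the branch
points and are affine near them lift as well (`SmoothFamily.cl_eq`).

Geometry. The half twist σ_i of p_i and p_{i+1} lifts to t_{c_i} (`tc_eq_halfTwist`), and the full
twist of all branch points lifts to the product of the two boundary twists (`delta_mul_delta'`). The
braid relations among the σ_i, and the expression of the full twist by the chain word, both come
from the half turns Δ_{i,j} of blocks p_i, …, p_j. A half turn of a large disc conjugates the twist
of a smaller disc into that of the mirror image (`diskTwist_conj`), and σ_j Δ_{i,j} Δ_{i+1,j}⁻¹ =
Δ_{i,j+1} Δ_{i+1,j+1}⁻¹ (`block_step`), because the two sides move the branch points along paths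
joined by a linear homotopy without collisions (`cl_eq_of_linear_homotopy`).

Algebra. If a and b satisfy the braid relation in a group, so do the one-letter words a and b in the
monoid of words modulo Hurwitz moves (`letter_braid`). Hence every identity of positive words that
follows from the braid relations in an arbitrary monoid is a Hurwitz equivalence. The identity
needed (`IsBraid.chain_eq`) says that the full twist on m + 4 strands, m = 2g − 2, consists of the
full twist of the first four, a passage of four strands across m and back, and the full twist of the
last m: X^{m+4} = A⁴ · P · Q · B^m, with X = σ_1 ⋯ σ_{m+3}, A = σ_1σ_2σ_3, B = σ_5 ⋯ σ_{m+3}. In P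
each block σ_j σ_{j-1} σ_{j-2} σ_{j-3} becomes σ_{j-1} σ_{j-2} σ_{j-3} · t_{d_j} by Hurwitz moves,
and the triples slide to the left, where they turn into C = σ_3σ_2σ_1; so P = C^m D_g, and
symmetrically Q = E_g A^m. The factor A^m commutes with B^m, and since X^{m+4} commutes with its
letters it may be rotated to the front, which gives A^{m+4} C^m D_g E_g B^m
(`IsBraid.hurwitz_chain`). Finally C⁴ = A⁴, and m is 0 modulo 4 for odd g and 2 modulo 4 for even g;
in the even case a factor C² survives. Hurwitz moves preserve products, so the relation in the group
follows from the chain relation. -/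

/-- The polynomial `(x - p₁) ⋯ (x - p_{2g+2})`. -/
def poly (g : ℕ) (x : ℂ) : ℂ := ∏ k ∈ Finset.Icc 1 (2 * g + 2), (x - branchPoint g k)

/-- Base diffeomorphisms are the identity outside of the disc of this radius. -/
def innerRadius (g : ℕ) : ℝ := 7 * (g + 1)

theorem innerRadius_pos (g : ℕ) : 0 < innerRadius g := by
  unfold innerRadius; positivity

theorem innerRadius_lt (g : ℕ) : innerRadius g < radius g := by
  unfold innerRadius radius
  have : (0 : ℝ) ≤ g := Nat.cast_nonneg g
  linarith

theorem contDiff_poly (g : ℕ) {n : ℕ∞ω} : ContDiff ℂ n (poly g) :=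
  contDiff_prod fun _ _ => contDiff_id.sub contDiff_const

theorem branchPoint_injective (g : ℕ) : Function.Injective (branchPoint g) := by
  intro a b h
  simp only [branchPoint] at h
  exact_mod_cast (by linarith : (a : ℝ) = b)

theorem poly_eq_zero_iff {g : ℕ} {x : ℂ} :
    poly g x = 0 ↔ ∃ k ∈ Finset.Icc 1 (2 * g + 2), x = branchPoint g k := by
  simp [poly, Finset.prod_eq_zero_iff, sub_eq_zero]

/-- The branch points are simple zeros. This is why y serves as a local coordinate of the curve at a
ramification point. -/
theorem deriv_poly_ne_zero {g : ℕ} {x : ℂ} (hx : poly g x = 0) : deriv (poly g) x ≠ 0 := by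
  obtain ⟨k, hk, rfl⟩ := poly_eq_zero_iff.1 hx
  have h1 : poly g = fun x : ℂ => (x - branchPoint g k) *
      ∏ j ∈ (Finset.Icc 1 (2 * g + 2)).erase k, (x - branchPoint g j) := by
    funext x
    exact (Finset.mul_prod_erase _ (fun j => x - (branchPoint g j : ℂ)) hk).symm
  have hd : DifferentiableAt ℂ (fun x : ℂ =>
      ∏ j ∈ (Finset.Icc 1 (2 * g + 2)).erase k, (x - (branchPoint g j : ℂ)))
      (branchPoint g k) := by
    fun_prop
  have h2 := ((hasDerivAt_id (branchPoint g k : ℂ)).sub_const (branchPoint g k : ℂ)).mul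
    hd.hasDerivAt
  have h3 : deriv (poly g) (branchPoint g k : ℂ) = _ := (congrArg (deriv · _) h1).trans h2.deriv
  rw [h3]
  simp only [id, sub_self, zero_mul, add_zero, one_mul]
  refine Finset.prod_ne_zero_iff.2 fun j hj => sub_ne_zero.2 fun h => ?_
  exact (Finset.mem_erase.1 hj).1 (branchPoint_injective g (by exact_mod_cast h.symm))

theorem dense_poly_ne_zero (g : ℕ) : Dense {x : ℂ | poly g x ≠ 0} := by
  have h : {x : ℂ | poly g x ≠ 0} =
      ((fun k => (branchPoint g k : ℂ)) '' (Finset.Icc 1 (2 * g + 2) : Set ℕ))ᶜ := by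
    ext x
    refine not_congr (poly_eq_zero_iff.trans ?_)
    simp only [Set.mem_image, SetLike.mem_coe, eq_comm]
  rw [h]
  exact (((Finset.finite_toSet _).image _).countable).dense_compl ℝ

/-- A square root `r` of `poly g ∘ f / poly g`: the map `(x, y) ↦ (f x, r x * y)` preserves the
curve `y² = poly g x`. -/
structure IsLiftRoot (g : ℕ) (f r : ℂ → ℂ) : Prop where
  smooth : ContDiff ℝ ∞ r
  ne_zero : ∀ x, r x ≠ 0
  sq : ∀ x, r x ^ 2 * poly g x = poly g (f x)
  one : ∀ x, innerRadius g ≤ ‖x‖ → r x = 1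

/-- The squares agree off the zeros of `poly`, by density everywhere, so r = ± s on the connected
plane, and the value 1 far out decides the sign. Uniqueness makes the root multiplicative in f,
which turns lifting into a homomorphism. -/
theorem IsLiftRoot.unique {g : ℕ} {f r s : ℂ → ℂ} (hr : IsLiftRoot g f r)
    (hs : IsLiftRoot g f s) : r = s := by
  have h1 : r ^ 2 = s ^ 2 := by
    refine Continuous.ext_on (dense_poly_ne_zero g) (hr.smooth.continuous.pow 2)
      (hs.smooth.continuous.pow 2) fun x hx => ?_
    exact mul_right_cancel₀ hx ((hr.sq x).trans (hs.sq x).symm)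
  rcases isPreconnected_univ.eq_or_eq_neg_of_sq_eq hr.smooth.continuous.continuousOn
    hs.smooth.continuous.continuousOn (fun x _ => congrFun h1 x) (fun {x} _ => hs.ne_zero x)
    with h | h
  · exact funext fun x => h (Set.mem_univ x)
  · have h2 := h (Set.mem_univ ((innerRadius g : ℝ) : ℂ))
    have h3 : innerRadius g ≤ ‖((innerRadius g : ℝ) : ℂ)‖ := by
      rw [Complex.norm_real]; exact le_abs_self _
    rw [Pi.neg_apply, hr.one _ h3, hs.one _ h3] at h2
    norm_num at h2

theorem norm_perm_lt {g : ℕ} {f : Equiv.Perm ℂ} (hf : ∀ x, innerRadius g ≤ ‖x‖ → f x = x)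
    {x : ℂ} (hx : ‖x‖ < innerRadius g) : ‖f x‖ < innerRadius g := by
  by_contra hcon
  push Not at hcon
  rw [f.injective (hf _ hcon)] at hcon
  exact hcon.not_gt hx

theorem symm_eq_self {g : ℕ} {f : Equiv.Perm ℂ} (hf : ∀ x, innerRadius g ≤ ‖x‖ → f x = x)
    (x : ℂ) (hx : innerRadius g ≤ ‖x‖) : f.symm x = x :=
  (Equiv.symm_apply_eq f).2 (hf x hx).symm

/-- The group of diffeomorphisms of the plane which are the identity near infinity and lift to the
curve `y² = poly g x`. -/
def BaseDiffeo (g : ℕ) : Subgroup (Equiv.Perm ℂ) where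
  carrier := {f | ContDiff ℝ ∞ f ∧ ContDiff ℝ ∞ f.symm ∧
    (∀ x, innerRadius g ≤ ‖x‖ → f x = x) ∧ ∃ r, IsLiftRoot g f r}
  mul_mem' := by
    rintro f h ⟨f1, f2, f3, r, hr⟩ ⟨h1, h2, h3, s, hs⟩
    refine ⟨f1.comp h1, h2.comp f2, fun x hx => ?_, fun x => r (h x) * s x, ?_, ?_, ?_, ?_⟩
    · rw [Equiv.Perm.mul_apply, h3 x hx, f3 x hx]
    · exact (hr.smooth.comp h1).mul hs.smooth
    · exact fun x => mul_ne_zero (hr.ne_zero _) (hs.ne_zero _)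
    · intro x
      rw [Equiv.Perm.mul_apply, ← hr.sq, ← hs.sq]
      ring
    · intro x hx
      rw [h3 x hx, hr.one x hx, hs.one x hx, one_mul]
  one_mem' := ⟨contDiff_id, contDiff_id, fun _ _ => rfl, fun _ => 1, contDiff_const,
    fun _ => one_ne_zero, fun x => by simp, fun _ _ => rfl⟩
  inv_mem' := by
    rintro f ⟨f1, f2, f3, r, hr⟩
    refine ⟨f2, f1, symm_eq_self f3, fun x => (r (f.symm x))⁻¹, ?_, ?_, ?_, ?_⟩
    · exact (hr.smooth.comp f2).inv fun x => hr.ne_zero _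
    · exact fun x => inv_ne_zero (hr.ne_zero _)
    · intro x
      have h := hr.sq (f.symm x)
      rw [f.apply_symm_apply] at h
      rw [← h]
      change _ = poly g (f.symm x)
      have := hr.ne_zero (f.symm x)
      field_simp
    · intro x hx
      rw [symm_eq_self f3 x hx, hr.one x hx, inv_one]

namespace BaseDiffeo

variable {g : ℕ}

/-- The normalized square root of `poly g ∘ f / poly g`. -/
def root (f : BaseDiffeo g) : ℂ → ℂ := f.2.2.2.2.choose

theorem root_spec (f : BaseDiffeo g) : IsLiftRoot g (f : Equiv.Perm ℂ) (root f) :=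
  f.2.2.2.2.choose_spec

theorem root_eq (f : BaseDiffeo g) {r : ℂ → ℂ} (hr : IsLiftRoot g (f : Equiv.Perm ℂ) r) :
    (root f) = r :=
  (root_spec f).unique hr

theorem root_one : (root (1 : BaseDiffeo g)) = fun _ => 1 :=
  root_eq _ ⟨contDiff_const, fun _ => one_ne_zero, fun x => by simp, fun _ _ => rfl⟩

theorem root_mul (f h : BaseDiffeo g) :
    (root (f * h)) = fun x => (root f) ((h : Equiv.Perm ℂ) x) * (root h) x := by
  refine root_eq _ ⟨((root_spec f).smooth.comp h.2.1).mul (root_spec h).smooth,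
    fun x => mul_ne_zero ((root_spec f).ne_zero _) ((root_spec h).ne_zero _), fun x => ?_,
    fun x hx => ?_⟩
  · rw [Subgroup.coe_mul, Equiv.Perm.mul_apply, ← (root_spec f).sq, ← (root_spec h).sq]
    ring
  · rw [h.2.2.2.1 x hx, (root_spec f).one x hx, (root_spec h).one x hx, one_mul]

/-- The lift of a base diffeomorphism to the surface, as a map. -/
def liftFun (f : BaseDiffeo g) (p : surface g) : surface g :=
  ⟨((f : Equiv.Perm ℂ) p.1.1, (root f) p.1.1 * p.1.2), by
    constructor
    · change ((root f) p.1.1 * p.1.2) ^ 2 = poly g ((f : Equiv.Perm ℂ) p.1.1)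
      rw [mul_pow, p.2.1, ← (root_spec f).sq]
      rfl
    · change ‖(f : Equiv.Perm ℂ) p.1.1‖ ≤ radius g
      rcases le_or_gt (innerRadius g) ‖p.1.1‖ with h | h
      · rw [f.2.2.2.1 _ h]
        exact p.2.2
      · exact ((norm_perm_lt f.2.2.2.1 h).trans (innerRadius_lt g)).le⟩

theorem liftFun_mul (f h : BaseDiffeo g) (p : surface g) :
    (liftFun (f * h)) p = (liftFun f) ((liftFun h) p) := by
  refine Subtype.ext (Prod.ext rfl ?_)
  change (root (f * h)) p.1.1 * p.1.2 =
    (root f) ((h : Equiv.Perm ℂ) p.1.1) * ((root h) p.1.1 * p.1.2)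
  rw [root_mul]
  ring

theorem liftFun_one (p : surface g) : (liftFun (1 : BaseDiffeo g)) p = p := by
  refine Subtype.ext (Prod.ext rfl ?_)
  change (root (1 : BaseDiffeo g)) p.1.1 * p.1.2 = _
  rw [root_one, one_mul]

theorem liftFun_smooth (f : BaseDiffeo g) (p : surface g) :
    SmoothAt Subtype.val (fun q => ((liftFun f) q : ℂ × ℂ)) p := by
  refine ⟨Set.univ, Filter.univ_mem, fun q => ((f : Equiv.Perm ℂ) q.1, (root f) q.1 * q.2), ?_,
    fun _ _ => rfl⟩
  exact ((f.2.1.comp contDiff_fst).prodMk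
    (((root_spec f).smooth.comp contDiff_fst).mul contDiff_snd)).contDiffOn

/-! ### Lifts preserve orientation -/

/-- The Jacobian determinant of a map of the plane. -/
def jac (L : ℂ →L[ℝ] ℂ) : ℝ := (starRingEnd ℂ (L 1) * L Complex.I).im

theorem jac_map (L : ℂ →L[ℝ] ℂ) (v w : ℂ) :
    (starRingEnd ℂ (L v) * L w).im = (starRingEnd ℂ v * w).im * jac L := by
  have h : ∀ u : ℂ, L u = u.re • L 1 + u.im • L Complex.I := by
    intro u
    rw [← map_smul, ← map_smul, ← map_add]
    congr 1
    apply Complex.ext <;> simp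
  rw [h v, h w]
  simp [jac]
  ring

theorem jac_ne_zero {L : ℂ →L[ℝ] ℂ} (hL : Function.Injective L) : jac L ≠ 0 := by
  intro h
  set a := L 1
  set b := L Complex.I
  have ha : a ≠ 0 := fun h0 => one_ne_zero (hL (h0.trans (map_zero L).symm))
  have h1 : starRingEnd ℂ a * b = ((starRingEnd ℂ a * b).re : ℂ) :=
    Complex.ext rfl (h.trans (Complex.ofReal_im _).symm)
  set t : ℝ := (starRingEnd ℂ a * b).re with ht
  -- If ā b is the real number t, then |a|² b = t a, so |a|² i − t lies in the kernel.
  have h2 : L (((Complex.normSq a : ℝ) : ℂ) * Complex.I - t) = 0 := by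
    have e1 : ((Complex.normSq a : ℝ) : ℂ) * Complex.I - t =
        (Complex.normSq a) • Complex.I - t • (1 : ℂ) := by simp
    rw [e1, map_sub, map_smul, map_smul]
    change Complex.normSq a • b - t • a = 0
    rw [Complex.real_smul, Complex.real_smul, ← h1, Complex.normSq_eq_conj_mul_self]
    ring
  have h3 := hL (h2.trans (map_zero L).symm)
  have h4 := congrArg Complex.im h3
  simp only [Complex.sub_im, Complex.mul_im, Complex.ofReal_re, Complex.I_im, mul_one,
    Complex.ofReal_im, Complex.I_re, mul_zero, add_zero, sub_zero, Complex.zero_im] at h4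
  exact ha (Complex.normSq_eq_zero.1 h4)

/-- The Jacobian never vanishes because f has a smooth inverse, and it is 1 where f is the identity;
on the connected plane it cannot change sign. -/
theorem jac_pos (f : BaseDiffeo g) (x : ℂ) : 0 < jac (fderiv ℝ (f : Equiv.Perm ℂ) x) := by
  set F : ℂ → ℂ := ⇑(f : Equiv.Perm ℂ) with hF
  have hF1 : ContDiff ℝ ∞ F := f.2.1
  have hc : Continuous fun x => jac (fderiv ℝ F x) := by
    have h1 : Continuous (fderiv ℝ F) := hF1.continuous_fderiv (by simp)
    unfold jac
    fun_prop
  have hne : ∀ x, jac (fderiv ℝ F x) ≠ 0 := by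
    intro x
    refine jac_ne_zero (Function.LeftInverse.injective
      (g := fderiv ℝ (f : Equiv.Perm ℂ).symm (F x)) fun v => ?_)
    have h2 : HasFDerivAt F (fderiv ℝ F x) x := (hF1.differentiable (by simp) x).hasFDerivAt
    have h3 : HasFDerivAt (f : Equiv.Perm ℂ).symm (fderiv ℝ (f : Equiv.Perm ℂ).symm (F x)) (F x) :=
      (f.2.2.1.differentiable (by simp) _).hasFDerivAt
    have h4 := h3.comp x h2
    have h5 : (f : Equiv.Perm ℂ).symm ∘ F = id := funext fun y => (f : Equiv.Perm ℂ).symm_apply_apply y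
    rw [h5] at h4
    exact congrArg (fun L : ℂ →L[ℝ] ℂ => L v) (h4.unique (hasFDerivAt_id x))
  by_contra hcon
  push Not at hcon
  set y : ℂ := ((radius g : ℝ) : ℂ)
  have hy : jac (fderiv ℝ F y) = 1 := by
    have h3 : ‖y‖ = |radius g| := Complex.norm_real _
    have h1 : F =ᶠ[𝓝 y] id := by
      have h2 : ∀ᶠ z in 𝓝 y, innerRadius g < ‖z‖ :=
        continuous_norm.continuousAt.eventually (lt_mem_nhds
          (((innerRadius_lt g).trans_le (le_abs_self _)).trans_eq h3.symm))
      filter_upwards [h2] with z hz using f.2.2.2.1 z hz.le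
    rw [h1.fderiv_eq, fderiv_id]
    simp [jac]
  obtain ⟨z, hz⟩ := mem_range_of_exists_le_of_exists_ge hc ⟨x, hcon⟩
    ⟨y, by rw [hy]; exact zero_le_one⟩
  exact hne z hz

theorem fderiv_curve {ξ η : ℂ → ℂ} {z : ℂ} (hξ : DifferentiableAt ℝ ξ z)
    (hη : DifferentiableAt ℝ η z) (h : ∀ w, η w ^ 2 = poly g (ξ w)) (v : ℂ) :
    2 * η z * fderiv ℝ η z v = deriv (poly g) (ξ z) * fderiv ℝ ξ z v := by
  have hd : HasDerivAt (poly g) (deriv (poly g) (ξ z)) (ξ z) :=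
    ((contDiff_poly g (n := 1)).differentiable (by simp) _).hasDerivAt
  have h1 : HasFDerivAt (fun w => poly g (ξ w)) _ z :=
    (hd.hasFDerivAt.restrictScalars ℝ).comp z hξ.hasFDerivAt
  have h2 := hη.hasFDerivAt.pow 2
  have h3 : (fun w => poly g (ξ w)) = fun w => η w ^ 2 := funext fun w => (h w).symm
  rw [h3] at h1
  have h4 := congrArg (fun L : ℂ →L[ℝ] ℂ => L v) (h2.unique h1)
  simp at h4
  rw [← mul_comm (fderiv ℝ ξ z v), ← h4]

/-- Where y ≠ 0 the equation of the curve gives dη = k dξ with k = poly′(ξ) / 2η, so the area form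
of the curve is 1 + |k|² times that of the x-plane. Orientation can be read off from x. -/
theorem posAt_curve {ξ η : ℂ → ℂ} {z : ℂ} (hξ : DifferentiableAt ℝ ξ z)
    (hη : DifferentiableAt ℝ η z) (h : ∀ w, η w ^ 2 = poly g (ξ w)) (h0 : η z ≠ 0) :
    PosAt (fun w => (ξ w, η w)) z ↔ 0 < jac (fderiv ℝ ξ z) := by
  have h1 : fderiv ℝ (fun w => (ξ w, η w)) z = (fderiv ℝ ξ z).prod (fderiv ℝ η z) :=
    (hξ.hasFDerivAt.prodMk hη.hasFDerivAt).fderiv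
  set k : ℂ := deriv (poly g) (ξ z) / (2 * η z)
  have h2 : ∀ v, fderiv ℝ η z v = k * fderiv ℝ ξ z v := by
    intro v
    have := fderiv_curve hξ hη h v
    have h20 : (2 : ℂ) * η z ≠ 0 := mul_ne_zero two_ne_zero h0
    rw [div_mul_eq_mul_div, ← this]
    field_simp
  have h3 : areaForm (fderiv ℝ ξ z 1, fderiv ℝ η z 1)
      (fderiv ℝ ξ z Complex.I, fderiv ℝ η z Complex.I) =
      (1 + Complex.normSq k) * jac (fderiv ℝ ξ z) := by
    rw [h2, h2]
    simp only [areaForm, jac, Complex.normSq_apply]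
    simp
    ring
  rw [PosAt, h1]
  simp only [ContinuousLinearMap.prod_apply]
  rw [h3]
  exact mul_pos_iff_of_pos_left (by linarith [Complex.normSq_nonneg k])

theorem posAt_curve_zero {ξ η : ℂ → ℂ} {z : ℂ} (hξ : DifferentiableAt ℝ ξ z)
    (hη : DifferentiableAt ℝ η z) (h : fderiv ℝ ξ z = 0) :
    PosAt (fun w => (ξ w, η w)) z ↔ 0 < jac (fderiv ℝ η z) := by
  have h1 : fderiv ℝ (fun w => (ξ w, η w)) z = (fderiv ℝ ξ z).prod (fderiv ℝ η z) :=
    (hξ.hasFDerivAt.prodMk hη.hasFDerivAt).fderiv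
  rw [PosAt, h1, h]
  simp [areaForm, jac]

theorem liftFun_orientation (f : BaseDiffeo g) : OrientationPreserving (liftFun f) := by
  intro φ z hφ hpos
  set F : ℂ → ℂ := ⇑(f : Equiv.Perm ℂ) with hF
  have hd := hφ.differentiableAt
  have hξ : DifferentiableAt ℝ (fun w => (φ w : ℂ × ℂ).1) z := hd.fst
  have hη : DifferentiableAt ℝ (fun w => (φ w : ℂ × ℂ).2) z := hd.snd
  have hcurve : ∀ w, (φ w : ℂ × ℂ).2 ^ 2 = poly g (φ w : ℂ × ℂ).1 := fun w => (φ w).2.1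
  set ξ : ℂ → ℂ := fun w => (φ w : ℂ × ℂ).1
  set η : ℂ → ℂ := fun w => (φ w : ℂ × ℂ).2
  have hFd : DifferentiableAt ℝ F (ξ z) := f.2.1.differentiable (by simp) _
  have hrd : DifferentiableAt ℝ (root f) (ξ z) := (root_spec f).smooth.differentiable (by simp) _
  have hξ' : DifferentiableAt ℝ (fun w => F (ξ w)) z := hFd.comp z hξ
  have hr' : DifferentiableAt ℝ (fun w => (root f) (ξ w)) z := hrd.comp z hξ
  have hη' : DifferentiableAt ℝ (fun w => (root f) (ξ w) * η w) z := hr'.mul hη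
  have hcurve' : ∀ w, ((root f) (ξ w) * η w) ^ 2 = poly g (F (ξ w)) :=
    fun w => ((liftFun f) (φ w)).2.1
  have e1 : fderiv ℝ (fun w => F (ξ w)) z = (fderiv ℝ F (ξ z)).comp (fderiv ℝ ξ z) :=
    fderiv_comp z hFd hξ
  change PosAt (fun w => (ξ w, η w)) z at hpos
  change PosAt (fun w => (F (ξ w), (root f) (ξ w) * η w)) z
  have hr0 := (root_spec f).ne_zero (ξ z)
  by_cases h0 : η z = 0
  -- At a ramification point dξ = 0 because `poly` has a simple zero, and y is the coordinate. The
  -- lift multiplies dη by the nonzero complex number `root f`, which preserves orientation.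
  · have hp : poly g (ξ z) = 0 := by rw [← hcurve z]; change η z ^ 2 = 0; rw [h0]; simp
    have h1 : fderiv ℝ ξ z = 0 := by
      ext1 v
      have := fderiv_curve hξ hη hcurve v
      rw [h0, mul_zero, zero_mul] at this
      exact (mul_eq_zero.1 this.symm).resolve_left (deriv_poly_ne_zero hp)
    rw [posAt_curve_zero hξ hη h1] at hpos
    rw [posAt_curve_zero hξ' hη' (by rw [e1, h1]; simp)]
    have h2 : fderiv ℝ (fun w => (root f) (ξ w) * η w) z = (root f) (ξ z) • fderiv ℝ η z := by
      rw [fderiv_fun_mul hr' hη, h0, zero_smul, add_zero]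
    have h3 : jac ((root f) (ξ z) • fderiv ℝ η z) =
        Complex.normSq ((root f) (ξ z)) * jac (fderiv ℝ η z) := by
      simp only [jac, Complex.normSq_apply]
      simp
      ring
    rw [h2, h3]
    exact mul_pos (Complex.normSq_pos.2 hr0) hpos
  · rw [posAt_curve hξ hη hcurve h0] at hpos
    rw [posAt_curve hξ' hη' hcurve' (mul_ne_zero hr0 h0), e1]
    have h3 : jac ((fderiv ℝ F (ξ z)).comp (fderiv ℝ ξ z)) =
        jac (fderiv ℝ ξ z) * jac (fderiv ℝ F (ξ z)) :=
      jac_map (fderiv ℝ F (ξ z)) (fderiv ℝ ξ z 1) (fderiv ℝ ξ z Complex.I)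
    rw [h3]
    exact mul_pos hpos (jac_pos f _)

/-- The lift of a base diffeomorphism to the surface. -/
def lift : BaseDiffeo g →* DiffPlus (surface g) (surfaceBoundary g) where
  toFun f := ⟨{ toFun := (liftFun f)
                invFun := liftFun f⁻¹
                left_inv := fun p => by rw [← liftFun_mul, inv_mul_cancel, liftFun_one]
                right_inv := fun p => by rw [← liftFun_mul, mul_inv_cancel, liftFun_one] },
    (liftFun_smooth f), (liftFun_smooth f⁻¹), (liftFun_orientation f), (liftFun_orientation f⁻¹),
    fun p hp => by
      have h : innerRadius g ≤ ‖p.1.1‖ := by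
        rw [hp.2]; exact (innerRadius_lt g).le
      refine Subtype.ext (Prod.ext (f.2.2.2.1 _ h) ?_)
      change (root f) p.1.1 * p.1.2 = _
      rw [(root_spec f).one _ h, one_mul]⟩
  map_one' := Subtype.ext (Equiv.ext liftFun_one)
  map_mul' f h := Subtype.ext (Equiv.ext (liftFun_mul f h))

/-- The mapping class of the lift of a base diffeomorphism. -/
def cl : BaseDiffeo g →* Gamma g := (QuotientGroup.mk' _).comp lift

end BaseDiffeo

/-! ### Isotopies of base diffeomorphisms -/

theorem csqrt_re_pos {w : ℂ} (hw : w ∈ Complex.slitPlane) : 0 < (csqrt w).re := by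
  rw [Complex.mem_slitPlane_iff_arg] at hw
  have h1 := Complex.neg_pi_lt_arg w
  have h2 := lt_of_le_of_ne (Complex.arg_le_pi w) hw.1
  rw [csqrt, Complex.exp_re]
  refine mul_pos (Real.exp_pos _) (Real.cos_pos_of_mem_Ioo ⟨?_, ?_⟩)
  all_goals
    have : (Complex.log w / 2).im = w.arg / 2 := by
      rw [show Complex.log w / 2 = Complex.log w / ((2 : ℝ) : ℂ) by simp,
        Complex.div_ofReal_im, Complex.log_im]
    rw [this]
    linarith

theorem sq_mem_slitPlane {w : ℂ} (hw : 0 < w.re) : w ^ 2 ∈ Complex.slitPlane := by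
  rw [Complex.mem_slitPlane_iff, pow_two, Complex.mul_re, Complex.mul_im]
  by_cases h : w.im = 0
  · left
    rw [h]
    nlinarith
  · right
    have := mul_ne_zero hw.ne' h
    intro h2
    exact this (by linarith)

/-- A square root with positive real part is the principal one. -/
theorem eq_csqrt {w v : ℂ} (hw : 0 < w.re) (h : w ^ 2 = v) : csqrt v = w := by
  have hv : v ∈ Complex.slitPlane := h ▸ sq_mem_slitPlane hw
  have h1 := csqrt_re_pos hv
  have h2 : csqrt v ^ 2 = w ^ 2 := by
    rw [h, csqrt_sq (Complex.slitPlane_ne_zero hv)]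
  rcases sq_eq_sq_iff_eq_or_eq_neg.1 h2 with h3 | h3
  · exact h3
  · rw [h3, Complex.neg_re] at h1
    linarith

/-- A continuous root r exists because the space is simply connected. Near x it equals r x times the
principal root of q y / q x, the quotient r y / r x having positive real part there; hence it is
smooth. -/
theorem exists_smooth_sqrt {E : Type*} [NormedAddCommGroup E] [NormedSpace ℝ E] {q : E → ℂ}
    (hq : ContDiff ℝ ∞ q) (h0 : ∀ x, q x ≠ 0) :
    ∃ r : E → ℂ, ContDiff ℝ ∞ r ∧ ∀ x, r x ^ 2 = q x := by
  have hs : IsSimplyConnected (Set.univ : Set E) :=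
    haveI := (convex_univ (𝕜 := ℝ) (E := E)).contractibleSpace Set.univ_nonempty
    SimplyConnectedSpace.ofContractible _
  obtain ⟨r, hr, hrq⟩ := Complex.exists_continuousOn_pow_eq (U := (Set.univ : Set E)) hs
    isOpen_univ hq.continuous.continuousOn (by rintro ⟨x, -, hx⟩; exact h0 x hx) two_ne_zero
  rw [continuousOn_univ] at hr
  refine ⟨r, contDiff_iff_contDiffAt.2 fun x => ?_, hrq⟩
  have hrx : ∀ y, r y ≠ 0 := fun y hy => h0 y (by rw [← hrq, hy]; simp)
  have hsm : ContDiffAt ℝ ∞ (fun y => r x * csqrt (q y / q x)) x := by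
    refine contDiffAt_const.mul (ContDiffAt.comp (g := csqrt) x
      ((contDiffAt_csqrt ?_).restrict_scalars ℝ) (hq.contDiffAt.div_const _))
    rw [div_self (h0 x)]
    exact Complex.one_mem_slitPlane
  refine hsm.congr_of_eventuallyEq ?_
  have hc : ContinuousAt (fun y => (r y / r x).re) x :=
    Complex.continuous_re.continuousAt.comp (hr.continuousAt.div_const _)
  have hpos : ∀ᶠ y in 𝓝 x, 0 < (r y / r x).re := by
    refine hc.eventually (lt_mem_nhds ?_)
    simp [div_self (hrx x)]
  filter_upwards [hpos] with y hy
  rw [eq_csqrt hy (v := q y / q x) (by rw [div_pow, hrq, hrq]), mul_div_cancel₀ _ (hrx x)]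

/-! ### Smooth families of plane diffeomorphisms and their lifts -/

/-- The family `K` of maps of the plane is, near `(s₀, x₀)`, affine in the second variable. -/
def AffineNear (K : ℝ → Equiv.Perm ℂ) (s₀ : ℝ) (x₀ : ℂ) : Prop :=
  ∃ A B : ℝ → ℂ, ContDiff ℝ ∞ A ∧ ContDiff ℝ ∞ B ∧ (∀ s, B s ≠ 0) ∧
    ∀ᶠ p : ℝ × ℂ in 𝓝 (s₀, x₀), K p.1 p.2 = A p.1 + B p.1 * p.2

/-- A smooth family of diffeomorphisms of the plane which are the identity near infinity. -/
structure SmoothFamily (g : ℕ) (K : ℝ → Equiv.Perm ℂ) : Prop where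
  smooth : ContDiff ℝ ∞ fun p : ℝ × ℂ => K p.1 p.2
  smooth_symm : ContDiff ℝ ∞ fun p : ℝ × ℂ => (K p.1).symm p.2
  support : ∀ s x, innerRadius g ≤ ‖x‖ → K s x = x

theorem SmoothFamily.mul {g : ℕ} {K L : ℝ → Equiv.Perm ℂ} (hK : SmoothFamily g K)
    (hL : SmoothFamily g L) : SmoothFamily g (fun s => K s * L s) where
  smooth := hK.smooth.comp (contDiff_fst.prodMk hL.smooth)
  smooth_symm := hL.smooth_symm.comp (contDiff_fst.prodMk hK.smooth_symm)
  support s x hx := by rw [Equiv.Perm.mul_apply, hL.support s x hx, hK.support s x hx]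

theorem SmoothFamily.inv {g : ℕ} {K : ℝ → Equiv.Perm ℂ} (hK : SmoothFamily g K) :
    SmoothFamily g (fun s => (K s)⁻¹) where
  smooth := hK.smooth_symm
  smooth_symm := hK.smooth
  support s x hx := symm_eq_self (hK.support s) x hx

theorem SmoothFamily.one (g : ℕ) : SmoothFamily g (fun _ => 1) where
  smooth := contDiff_snd
  smooth_symm := contDiff_snd
  support _ _ _ := rfl

theorem AffineNear.one (s₀ : ℝ) (x₀ : ℂ) : AffineNear (fun _ => 1) s₀ x₀ :=
  ⟨fun _ => 0, fun _ => 1, contDiff_const, contDiff_const, fun _ => one_ne_zero,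
    Filter.Eventually.of_forall fun p => by simp⟩

theorem AffineNear.mul {g : ℕ} {K L : ℝ → Equiv.Perm ℂ} {s₀ : ℝ} {x₀ : ℂ}
    (hLs : SmoothFamily g L) (hK : AffineNear K s₀ (L s₀ x₀)) (hL : AffineNear L s₀ x₀) :
    AffineNear (fun s => K s * L s) s₀ x₀ := by
  obtain ⟨A, B, hA, hB, hB0, h⟩ := hK
  obtain ⟨A', B', hA', hB', hB0', h'⟩ := hL
  refine ⟨fun s => A s + B s * A' s, fun s => B s * B' s, hA.add (hB.mul hA'), hB.mul hB',
    fun s => mul_ne_zero (hB0 s) (hB0' s), ?_⟩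
  have hc : ContinuousAt (fun p : ℝ × ℂ => (p.1, L p.1 p.2)) (s₀, x₀) :=
    (continuous_fst.prodMk hLs.smooth.continuous).continuousAt
  filter_upwards [h', hc.eventually h] with p hp hp'
  rw [Equiv.Perm.mul_apply, hp', hp]
  ring

theorem AffineNear.inv {g : ℕ} {K : ℝ → Equiv.Perm ℂ} {s₀ : ℝ} {x₀ : ℂ}
    (hKs : SmoothFamily g K) (hK : AffineNear K s₀ x₀) :
    AffineNear (fun s => (K s)⁻¹) s₀ (K s₀ x₀) := by
  obtain ⟨A, B, hA, hB, hB0, h⟩ := hK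
  refine ⟨fun s => -((B s)⁻¹ * A s), fun s => (B s)⁻¹, ((hB.inv hB0).mul hA).neg, hB.inv hB0,
    fun s => inv_ne_zero (hB0 s), ?_⟩
  have hc : Filter.Tendsto (fun p : ℝ × ℂ => (p.1, (K p.1).symm p.2)) (𝓝 (s₀, K s₀ x₀))
      (𝓝 (s₀, x₀)) := by
    have h1 : ContinuousAt (fun p : ℝ × ℂ => (p.1, (K p.1).symm p.2)) (s₀, K s₀ x₀) :=
      (continuous_fst.prodMk hKs.smooth_symm.continuous).continuousAt
    have h2 := h1.tendsto
    simpa using h2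
  filter_upwards [hc.eventually h] with p hp
  rw [Equiv.apply_symm_apply] at hp
  change (K p.1).symm p.2 = _
  have := hB0 p.1
  generalize (K p.1).symm p.2 = w at hp ⊢
  rw [hp]
  field_simp
  ring

theorem AffineNear.congr {K L : ℝ → Equiv.Perm ℂ} {s₀ : ℝ} {x₀ : ℂ} (hK : AffineNear K s₀ x₀)
    (h : ∀ᶠ s in 𝓝 s₀, L s = K s) : AffineNear L s₀ x₀ := by
  obtain ⟨A, B, hA, hB, hB0, hAB⟩ := hK
  refine ⟨A, B, hA, hB, hB0, ?_⟩
  have h1 : ∀ᶠ p : ℝ × ℂ in 𝓝 (s₀, x₀), L p.1 = K p.1 :=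
    (continuous_fst.continuousAt (x := (s₀, x₀))).eventually h
  filter_upwards [hAB, h1] with p hp hp'
  rw [hp', hp]

theorem norm_branchPoint_lt {g k : ℕ} (hk : k ∈ Finset.Icc 1 (2 * g + 2)) :
    ‖(branchPoint g k : ℂ)‖ < 2 * (g + 1 : ℝ) := by
  rw [Finset.mem_Icc] at hk
  have h4 : (1 : ℝ) ≤ k := by exact_mod_cast hk.1
  have h5 : (k : ℝ) ≤ 2 * g + 2 := by exact_mod_cast hk.2
  rw [Complex.norm_real, Real.norm_eq_abs, abs_lt, branchPoint]
  constructor <;> linarith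

theorem poly_ne_zero_of_large {g : ℕ} {x : ℂ} (hx : innerRadius g ≤ ‖x‖) : poly g x ≠ 0 := by
  intro h
  obtain ⟨k, hk, rfl⟩ := poly_eq_zero_iff.1 h
  have := norm_branchPoint_lt hk
  rw [innerRadius] at hx
  have : (0 : ℝ) ≤ g := Nat.cast_nonneg g
  linarith

theorem isPreconnected_outside (R : ℝ) (hR : 0 < R) : IsPreconnected {x : ℂ | R ≤ ‖x‖} := by
  have h1 : IsPreconnected (Metric.sphere (0 : ℂ) 1) :=
    isPreconnected_sphere (Complex.rank_real_complex ▸ Nat.one_lt_ofNat) 0 1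
  have h2 := (isPreconnected_Ici (a := R)).prod h1
  have h3 := h2.image (fun p : ℝ × ℂ => (p.1 : ℂ) * p.2) (by fun_prop)
  convert! h3 using 1
  ext x
  constructor
  · intro hx
    have hx0 : (0 : ℝ) < ‖x‖ := hR.trans_le hx
    refine ⟨(‖x‖, x / ‖x‖), ⟨hx, ?_⟩, ?_⟩
    · simp [hx0.ne']
    · have : (‖x‖ : ℂ) ≠ 0 := by exact_mod_cast hx0.ne'
      field_simp
  · rintro ⟨⟨t, y⟩, ⟨ht, hy⟩, rfl⟩
    have ht' : R ≤ t := ht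
    have hy' : ‖y‖ = 1 := by simpa using hy
    change R ≤ ‖(t : ℂ) * y‖
    rw [norm_mul, hy', mul_one, Complex.norm_real]
    exact ht'.trans (le_abs_self t)

/-- The branch points are permuted by the map `f`. -/
def PermutesBranchPoints (g : ℕ) (f : ℂ → ℂ) : Prop :=
  ∀ k ∈ Finset.Icc 1 (2 * g + 2), ∃ l ∈ Finset.Icc 1 (2 * g + 2),
    f (branchPoint g k) = branchPoint g l

theorem PermutesBranchPoints.prod {g : ℕ} {f : Equiv.Perm ℂ} (hf : PermutesBranchPoints g f)
    (x : ℂ) : poly g x = ∏ k ∈ Finset.Icc 1 (2 * g + 2), (x - f (branchPoint g k)) := by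
  choose! e he hfe using hf
  have hinj : Set.InjOn e (Finset.Icc 1 (2 * g + 2)) := by
    intro a ha b hb hab
    have h1 := hfe a ha
    rw [hab, ← hfe b hb] at h1
    exact branchPoint_injective g (by exact_mod_cast f.injective h1)
  rw [poly]
  symm
  refine Finset.prod_nbij e he hinj (Finset.surjOn_of_injOn_of_card_le e he hinj le_rfl) ?_
  intro k hk
  rw [hfe k hk]

/-- This is why families are required to be affine near the branch points: for a map that is smooth
only in the real sense, (K x − K a) / (x − a) need not extend continuously to x = a, whereas for a
complex affine map it is constant near a. Elsewhere it is smooth, and nonzero by injectivity. -/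
theorem contDiff_dslope {g : ℕ} {K : ℝ → Equiv.Perm ℂ} (hK : SmoothFamily g K) {a : ℂ}
    (hA : ∀ s, AffineNear K s a) :
    ContDiff ℝ ∞ (fun p : ℝ × ℂ => dslope (K p.1) a p.2) ∧
      ∀ s x, dslope (K s) a x ≠ 0 := by
  have key : ∀ s₀, ∃ B : ℝ → ℂ, ContDiff ℝ ∞ B ∧ (∀ s, B s ≠ 0) ∧
      ∀ᶠ p : ℝ × ℂ in 𝓝 (s₀, a), dslope (K p.1) a p.2 = B p.1 := by
    intro s₀
    obtain ⟨A, B, hA, hB, hB0, h⟩ := hA s₀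
    refine ⟨B, hB, hB0, ?_⟩
    have h1 := h.eventually_nhds
    have h2 : Filter.Tendsto (fun p : ℝ × ℂ => (p.1, a)) (𝓝 (s₀, a)) (𝓝 (s₀, a)) := by
      have : Continuous fun p : ℝ × ℂ => (p.1, a) := by fun_prop
      simpa using this.tendsto (s₀, a)
    filter_upwards [h, h2.eventually h1] with p hp hp'
    by_cases hx : p.2 = a
    · rw [hx, dslope_same]
      have h3 : ∀ᶠ x in 𝓝 a, K p.1 x = A p.1 + B p.1 * x :=
        ((Continuous.prodMk_right p.1).tendsto a).eventually hp'
      have h4 : HasDerivAt (fun x => A p.1 + B p.1 * x) (B p.1) a := by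
        simpa using ((hasDerivAt_id a).const_mul (B p.1)).const_add (A p.1)
      exact (h4.congr_of_eventuallyEq h3).deriv
    · have h5 : K p.1 a = A p.1 + B p.1 * a := hp'.self_of_nhds
      rw [dslope_of_ne _ hx, slope_def_field, hp, h5]
      have : p.2 - a ≠ 0 := sub_ne_zero.2 hx
      field_simp
      ring
  constructor
  · rw [contDiff_iff_contDiffAt]
    rintro ⟨s, x⟩
    by_cases hx : x = a
    · subst hx
      obtain ⟨B, hB, -, h⟩ := key s
      exact ((hB.comp contDiff_fst).contDiffAt).congr_of_eventuallyEq h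
    · have h1 : ∀ᶠ p : ℝ × ℂ in 𝓝 (s, x), p.2 ≠ a :=
        (continuous_snd.continuousAt (x := (s, x))).eventually_ne hx
      have h2 : ContDiffAt ℝ ∞ (fun p : ℝ × ℂ => (K p.1 p.2 - K p.1 a) / (p.2 - a)) (s, x) := by
        simp only [div_eq_mul_inv]
        refine ContDiffAt.mul ?_ (ContDiffAt.inv ?_ (sub_ne_zero.2 hx))
        · exact (hK.smooth.sub (hK.smooth.comp (contDiff_fst.prodMk contDiff_const))).contDiffAt
        · exact (contDiff_snd.sub contDiff_const).contDiffAt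
      refine h2.congr_of_eventuallyEq ?_
      filter_upwards [h1] with p hp
      rw [dslope_of_ne _ hp, slope_def_field]
  · intro s x
    by_cases hx : x = a
    · obtain ⟨B, -, hB0, h⟩ := key s
      have h1 : dslope (K s) a a = B s := h.self_of_nhds
      rw [hx, h1]
      exact hB0 s
    · rw [dslope_of_ne _ hx, slope_def_field]
      exact div_ne_zero (sub_ne_zero.2 fun h => hx ((K s).injective h)) (sub_ne_zero.2 hx)

/-- A smooth family of diffeomorphisms of the plane which permute the branch points and are affine
near them lifts to a smooth family. -/
theorem SmoothFamily.exists_root {g : ℕ} {K : ℝ → Equiv.Perm ℂ} (hK : SmoothFamily g K)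
    (hA : ∀ s, ∀ k ∈ Finset.Icc 1 (2 * g + 2), AffineNear K s (branchPoint g k))
    (hP : ∀ s, PermutesBranchPoints g (K s)) :
    ∃ r : ℝ × ℂ → ℂ, ContDiff ℝ ∞ r ∧ ∀ s, IsLiftRoot g (K s) fun x => r (s, x) := by
  -- As K s permutes the branch points, `poly` ∘ K s is the product of the K s x − K s p_k. So this
  -- product of difference quotients is `poly` ∘ K s / `poly`, extended smoothly and without zeros
  -- over the branch points.
  set q : ℝ × ℂ → ℂ := fun p =>
    ∏ k ∈ Finset.Icc 1 (2 * g + 2), dslope (K p.1) (branchPoint g k) p.2 with hq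
  have hqs : ContDiff ℝ ∞ q :=
    contDiff_prod fun k hk => (contDiff_dslope hK fun s => hA s k hk).1
  have hq0 : ∀ p, q p ≠ 0 := fun p =>
    Finset.prod_ne_zero_iff.2 fun k hk => (contDiff_dslope hK fun s => hA s k hk).2 p.1 p.2
  have hqp : ∀ s x, q (s, x) * poly g x = poly g (K s x) := by
    intro s x
    rw [(hP s).prod (K s x), hq, poly, ← Finset.prod_mul_distrib]
    refine Finset.prod_congr rfl fun k _ => ?_
    rw [mul_comm]
    exact sub_smul_dslope (K s) (branchPoint g k : ℂ) x
  have hq1 : ∀ s x, innerRadius g ≤ ‖x‖ → q (s, x) = 1 := by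
    intro s x hx
    have h1 := hqp s x
    rw [hK.support s x hx] at h1
    exact mul_right_cancel₀ (poly_ne_zero_of_large hx) (h1.trans (one_mul _).symm)
  obtain ⟨r, hr, hrq⟩ := exists_smooth_sqrt hqs hq0
  have hr0 : ∀ p, r p ≠ 0 := fun p hp => hq0 p (by rw [← hrq, hp]; simp)
  -- On the connected set of all (s, x) with x far out the root has square 1, so it is constantly 1
  -- or −1 there, and a single sign normalizes it for all s at once.
  have hpre : IsPreconnected ((Set.univ : Set ℝ) ×ˢ {x : ℂ | innerRadius g ≤ ‖x‖}) :=
    isPreconnected_univ.prod (isPreconnected_outside _ (innerRadius_pos g))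
  have hsgn : ∃ ε : ℂ, ε ^ 2 = 1 ∧ ∀ s x, innerRadius g ≤ ‖x‖ → ε * r (s, x) = 1 := by
    rcases hpre.eq_or_eq_neg_of_sq_eq (f := r) (g := fun _ => 1) hr.continuous.continuousOn
      continuousOn_const (fun p hp => by
        change r p ^ 2 = 1 ^ 2
        rw [hrq, one_pow]; exact hq1 p.1 p.2 hp.2) (fun _ => one_ne_zero) with h | h
    · exact ⟨1, by norm_num, fun s x hx => by rw [one_mul]; exact h ⟨Set.mem_univ s, hx⟩⟩
    · refine ⟨-1, by norm_num, fun s x hx => ?_⟩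
      have h1 : r (s, x) = -1 := h ⟨Set.mem_univ s, hx⟩
      rw [h1]; norm_num
  obtain ⟨ε, hε, hε1⟩ := hsgn
  have hε0 : ε ≠ 0 := by rintro rfl; norm_num at hε
  refine ⟨fun p => ε * r p, contDiff_const.mul hr, fun s => ⟨?_, ?_, ?_, hε1 s⟩⟩
  · exact (contDiff_const.mul hr).comp (contDiff_const.prodMk contDiff_id)
  · exact fun x => mul_ne_zero hε0 (hr0 _)
  · intro x
    rw [mul_pow, hε, one_mul, hrq, hqp]

theorem SmoothFamily.mem_baseDiffeo {g : ℕ} {K : ℝ → Equiv.Perm ℂ} (hK : SmoothFamily g K)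
    (hA : ∀ s, ∀ k ∈ Finset.Icc 1 (2 * g + 2), AffineNear K s (branchPoint g k))
    (hP : ∀ s, PermutesBranchPoints g (K s)) (s : ℝ) : K s ∈ BaseDiffeo g := by
  obtain ⟨r, -, hr⟩ := hK.exists_root hA hP
  exact ⟨hK.smooth.comp (contDiff_const.prodMk contDiff_id),
    hK.smooth_symm.comp (contDiff_const.prodMk contDiff_id), hK.support s, _, hr s⟩

/-- Isotopic base diffeomorphisms have the same mapping class. -/
theorem SmoothFamily.cl_eq {g : ℕ} {K : ℝ → Equiv.Perm ℂ} (hK : SmoothFamily g K)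
    (hA : ∀ s, ∀ k ∈ Finset.Icc 1 (2 * g + 2), AffineNear K s (branchPoint g k))
    (hP : ∀ s, PermutesBranchPoints g (K s)) (f h : BaseDiffeo g)
    (hf : (f : Equiv.Perm ℂ) = K 0) (hh : (h : Equiv.Perm ℂ) = K 1) :
    BaseDiffeo.cl f = BaseDiffeo.cl h := by
  obtain ⟨r, hrs, hr⟩ := hK.exists_root hA hP
  set F : ℝ → BaseDiffeo g := fun s => ⟨K s, hK.mem_baseDiffeo hA hP s⟩ with hF
  have hf' : f = F 0 := Subtype.ext hf
  have hh' : h = F 1 := Subtype.ext hh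
  rw [hf', hh']
  refine QuotientGroup.eq.2 ⟨fun t => (BaseDiffeo.lift (F 0))⁻¹ * BaseDiffeo.lift (F t), ?_,
    inv_mul_cancel _, rfl⟩
  intro x
  have hsm : SmoothAt (fun y : ℝ × surface g => (y.1, (y.2 : ℂ × ℂ)))
      (fun y : ℝ × surface g => (BaseDiffeo.liftFun (F y.1) y.2 : ℂ × ℂ)) x := by
    refine ⟨Set.univ, Filter.univ_mem,
      fun y => (K y.1 y.2.1, r (y.1, y.2.1) * y.2.2), ?_, fun y _ => ?_⟩
    · have h1 : ContDiff ℝ ∞ fun y : ℝ × ℂ × ℂ => (y.1, y.2.1) :=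
        contDiff_fst.prodMk (contDiff_fst.comp contDiff_snd)
      exact ((hK.smooth.comp h1).prodMk ((hrs.comp h1).mul
        (contDiff_snd.comp contDiff_snd))).contDiffOn
    · change (_, BaseDiffeo.root (F y.1) y.2.1.1 * y.2.1.2) = _
      -- The root of each F s was chosen separately; by uniqueness it is the slice of the jointly
      -- smooth r.
      rw [BaseDiffeo.root_eq (F y.1) (hr y.1)]
  exact SmoothAt.comp (f := fun y : ℝ × surface g => BaseDiffeo.liftFun (F y.1) y.2)
    (g := fun q : surface g => (((BaseDiffeo.lift (F 0))⁻¹ :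
      DiffPlus (surface g) (surfaceBoundary g)) : Equiv.Perm (surface g)) q |>.1)
    (((BaseDiffeo.lift (F 0))⁻¹).2.1 _) hsm

/-! ### Twists of discs -/

/-- A smooth function which is `1` on `t ≤ u` and `0` on `t ≥ v`. -/
def cutoff (u v t : ℝ) : ℝ := 1 - Real.smoothTransition ((t - u) / (v - u))

theorem contDiff_cutoff (u v : ℝ) {n : ℕ∞} : ContDiff ℝ n (cutoff u v) :=
  contDiff_const.sub (Real.smoothTransition.contDiff.comp
    ((contDiff_id.sub contDiff_const).div_const _))

theorem cutoff_eq_one {u v t : ℝ} (huv : u < v) (ht : t ≤ u) : cutoff u v t = 1 := by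
  rw [cutoff, Real.smoothTransition.zero_of_nonpos, sub_zero]
  exact div_nonpos_of_nonpos_of_nonneg (by linarith) (by linarith)

theorem cutoff_eq_zero {u v t : ℝ} (huv : u < v) (ht : v ≤ t) : cutoff u v t = 0 := by
  rw [cutoff, Real.smoothTransition.one_of_one_le, sub_self]
  rw [one_le_div (by linarith)]
  linarith

/-- The rotation of the disc `‖x - c‖² ≤ u` by the angle `θ`, damped out at `‖x - c‖² = v`. -/
def diskTwistFun (c : ℂ) (u v θ : ℝ) (x : ℂ) : ℂ :=
  c + (x - c) * Complex.exp (((θ * cutoff u v (‖x - c‖ ^ 2) : ℝ) : ℂ) * Complex.I)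

theorem norm_diskTwistFun (c : ℂ) (u v θ : ℝ) (x : ℂ) :
    ‖diskTwistFun c u v θ x - c‖ = ‖x - c‖ := by
  rw [diskTwistFun, add_sub_cancel_left, norm_mul, Complex.norm_exp_ofReal_mul_I, mul_one]

theorem diskTwistFun_add (c : ℂ) (u v θ θ' : ℝ) (x : ℂ) :
    diskTwistFun c u v θ (diskTwistFun c u v θ' x) = diskTwistFun c u v (θ + θ') x := by
  rw [diskTwistFun, norm_diskTwistFun, diskTwistFun, add_sub_cancel_left, mul_assoc,
    ← Complex.exp_add, diskTwistFun]
  push_cast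
  ring_nf

theorem diskTwistFun_zero (c : ℂ) (u v : ℝ) (x : ℂ) : diskTwistFun c u v 0 x = x := by
  simp [diskTwistFun]

/-- The twist of a disc as a permutation of the plane. -/
def diskTwist (c : ℂ) (u v θ : ℝ) : Equiv.Perm ℂ where
  toFun := diskTwistFun c u v θ
  invFun := diskTwistFun c u v (-θ)
  left_inv x := by rw [diskTwistFun_add, neg_add_cancel, diskTwistFun_zero]
  right_inv x := by rw [diskTwistFun_add, add_neg_cancel, diskTwistFun_zero]

theorem diskTwist_mul (c : ℂ) (u v θ θ' : ℝ) :
    diskTwist c u v θ * diskTwist c u v θ' = diskTwist c u v (θ + θ') :=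
  Equiv.ext (diskTwistFun_add c u v θ θ')

theorem diskTwist_zero (c : ℂ) (u v : ℝ) : diskTwist c u v 0 = 1 :=
  Equiv.ext (diskTwistFun_zero c u v)

theorem diskTwist_inv (c : ℂ) (u v θ : ℝ) : (diskTwist c u v θ)⁻¹ = diskTwist c u v (-θ) :=
  inv_eq_of_mul_eq_one_right (by rw [diskTwist_mul, add_neg_cancel, diskTwist_zero])

theorem diskTwist_inner {c : ℂ} {u v : ℝ} (huv : u < v) (θ : ℝ) {x : ℂ}
    (hx : ‖x - c‖ ^ 2 ≤ u) :
    diskTwist c u v θ x = c + (x - c) * Complex.exp ((θ : ℂ) * Complex.I) := by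
  change diskTwistFun c u v θ x = _
  rw [diskTwistFun, cutoff_eq_one huv hx, mul_one]

theorem diskTwist_outer {c : ℂ} {u v : ℝ} (huv : u < v) (θ : ℝ) {x : ℂ}
    (hx : v ≤ ‖x - c‖ ^ 2) : diskTwist c u v θ x = x := by
  change diskTwistFun c u v θ x = _
  rw [diskTwistFun, cutoff_eq_zero huv hx]
  simp

theorem diskTwist_pi_inner {c : ℂ} {u v : ℝ} (huv : u < v) {x : ℂ} (hx : ‖x - c‖ ^ 2 ≤ u) :
    diskTwist c u v Real.pi x = 2 * c - x := by
  rw [diskTwist_inner huv _ hx, Complex.exp_pi_mul_I]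
  ring

theorem smoothFamily_diskTwist {g : ℕ} {c : ℝ → ℂ} {θ : ℝ → ℝ} {u v : ℝ} (huv : u < v)
    (hc : ContDiff ℝ ∞ c) (hθ : ContDiff ℝ ∞ θ)
    (hsupp : ∀ s x, innerRadius g ≤ ‖x‖ → v ≤ ‖x - c s‖ ^ 2) :
    SmoothFamily g fun s => diskTwist (c s) u v (θ s) := by
  have key : ∀ θ : ℝ → ℝ, ContDiff ℝ ∞ θ →
      ContDiff ℝ ∞ fun p : ℝ × ℂ => diskTwistFun (c p.1) u v (θ p.1) p.2 := by
    intro θ hθ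
    have h1 : ContDiff ℝ ∞ fun p : ℝ × ℂ => p.2 - c p.1 :=
      contDiff_snd.sub (hc.comp contDiff_fst)
    have h2 : ContDiff ℝ ∞ fun p : ℝ × ℂ => θ p.1 * cutoff u v (‖p.2 - c p.1‖ ^ 2) :=
      (hθ.comp contDiff_fst).mul ((contDiff_cutoff u v).comp (h1.norm_sq ℝ))
    exact (hc.comp contDiff_fst).add
      (h1.mul ((Complex.ofRealCLM.contDiff.comp h2).mul contDiff_const).cexp)
  exact ⟨key θ hθ, key (fun s => -θ s) hθ.neg, fun s x hx =>
    diskTwist_outer huv _ (hsupp s x hx)⟩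

theorem affineNear_diskTwist {c : ℝ → ℂ} {θ : ℝ → ℝ} {u v : ℝ} (huv : u < v)
    (hc : ContDiff ℝ ∞ c) (hθ : ContDiff ℝ ∞ θ) {s₀ : ℝ} {x₀ : ℂ}
    (h : ‖x₀ - c s₀‖ ^ 2 < u ∨ v < ‖x₀ - c s₀‖ ^ 2) :
    AffineNear (fun s => diskTwist (c s) u v (θ s)) s₀ x₀ := by
  have hcont : ContinuousAt (fun p : ℝ × ℂ => ‖p.2 - c p.1‖ ^ 2) (s₀, x₀) := by
    have := hc.continuous
    exact Continuous.continuousAt (by fun_prop)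
  rcases h with h | h
  · have he : ContDiff ℝ ∞ fun s => Complex.exp ((θ s : ℂ) * Complex.I) :=
      ((Complex.ofRealCLM.contDiff.comp hθ).mul contDiff_const).cexp
    refine ⟨fun s => c s - c s * Complex.exp ((θ s : ℂ) * Complex.I),
      fun s => Complex.exp ((θ s : ℂ) * Complex.I), hc.sub (hc.mul he), he,
      fun s => Complex.exp_ne_zero _, ?_⟩
    filter_upwards [hcont.eventually (gt_mem_nhds h)] with p hp
    rw [diskTwist_inner huv _ (le_of_lt hp)]
    ring
  · refine ⟨fun _ => 0, fun _ => 1, contDiff_const, contDiff_const, fun _ => one_ne_zero, ?_⟩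
    filter_upwards [hcont.eventually (lt_mem_nhds h)] with p hp
    rw [diskTwist_outer huv _ (le_of_lt hp)]
    ring

/-! ### Motions of points -/

/-- There is a smooth family of diffeomorphisms which carries the points `α k s` to the points
`β k s`, is affine near them, and is trivial at `s = 0` and `s = 1`. -/
def Carries (g : ℕ) (α β : ℕ → ℝ → ℂ) : Prop :=
  ∃ G : ℝ → Equiv.Perm ℂ, SmoothFamily g G ∧
    (∀ s, ∀ k ∈ Finset.Icc 1 (2 * g + 2), AffineNear G s (α k s)) ∧
    (∀ s, ∀ k ∈ Finset.Icc 1 (2 * g + 2), G s (α k s) = β k s) ∧ G 0 = 1 ∧ G 1 = 1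

theorem Carries.refl (g : ℕ) (α : ℕ → ℝ → ℂ) : Carries g α α :=
  ⟨fun _ => 1, SmoothFamily.one g, fun _ _ _ => AffineNear.one _ _, fun _ _ _ => rfl, rfl, rfl⟩

theorem Carries.trans {g : ℕ} {α β γ : ℕ → ℝ → ℂ} (h : Carries g α β) (h' : Carries g β γ) :
    Carries g α γ := by
  obtain ⟨G, hG, hGA, hGm, hG0, hG1⟩ := h
  obtain ⟨H, hH, hHA, hHm, hH0, hH1⟩ := h'
  refine ⟨fun s => H s * G s, hH.mul hG, fun s k hk => ?_, fun s k hk => ?_, ?_, ?_⟩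
  · refine AffineNear.mul hG ?_ (hGA s k hk)
    rw [hGm s k hk]
    exact hHA s k hk
  · rw [Equiv.Perm.mul_apply, hGm s k hk, hHm s k hk]
  · simp only [hG0, hH0, mul_one]
  · simp only [hG1, hH1, mul_one]

theorem Carries.congr {g : ℕ} {α β γ : ℕ → ℝ → ℂ} (h : Carries g α β)
    (hβ : ∀ s, ∀ k ∈ Finset.Icc 1 (2 * g + 2), β k s = γ k s) : Carries g α γ := by
  obtain ⟨G, hG, hGA, hGm, hG01⟩ := h
  exact ⟨G, hG, hGA, fun s k hk => (hGm s k hk).trans (hβ s k hk), hG01⟩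

/-- A small motion of one of the points. -/
theorem carries_one {g : ℕ} {α : ℕ → ℝ → ℂ} {b : ℝ → ℂ} {k₀ : ℕ} {ε : ℝ} (hε : 0 < ε)
    (hα : ContDiff ℝ ∞ (α k₀)) (hb : ContDiff ℝ ∞ b)
    (hsep : ∀ s, ∀ j ∈ Finset.Icc 1 (2 * g + 2), j ≠ k₀ → ε ≤ ‖α j s - α k₀ s‖)
    (hclose : ∀ s, ‖b s - α k₀ s‖ ≤ ε / 8) (h0 : b 0 = α k₀ 0) (h1 : b 1 = α k₀ 1)
    (hR : ∀ s, ‖α k₀ s‖ + ε ≤ innerRadius g) :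
    Carries g α (Function.update α k₀ b) := by
  set a := α k₀ with ha
  set u : ℝ := (ε / 4) ^ 2 with hu
  set v : ℝ := (ε / 2) ^ 2 with hv
  have huv : u < v := by rw [hu, hv]; nlinarith
  have hu0 : 0 < u := by positivity
  -- The half turn about the midpoint m of a and b takes a to b, and a half turn back about b leaves
  -- b in place. Where a = b, in particular at s = 0 and s = 1, the two cancel. Both centres are
  -- within ε / 8 of a, so the points a and b which are to be turned lie in the rigid discs of
  -- radius ε / 4, and the other points, at distance at least ε from a, lie outside the discs of
  -- radius ε / 2.
  set m : ℝ → ℂ := fun s => (a s + b s) / 2 with hm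
  have hms : ContDiff ℝ ∞ m := (hα.add hb).div_const 2
  have hma : ∀ s, ‖m s - a s‖ ≤ ε / 16 := by
    intro s
    have : m s - a s = (b s - a s) / 2 := by simp only [hm]; ring
    rw [this, norm_div, Complex.norm_two]
    linarith [hclose s]
  have hout : ∀ (x y : ℂ), ε / 2 < ‖x - y‖ → v < ‖x - y‖ ^ 2 := fun x y h =>
    pow_lt_pow_left₀ h (by positivity) two_ne_zero
  have hinn : ∀ (x y : ℂ), ‖x - y‖ < ε / 4 → ‖x - y‖ ^ 2 < u := fun x y h =>
    pow_lt_pow_left₀ h (norm_nonneg _) two_ne_zero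
  have hsupp : ∀ (w : ℝ → ℂ), (∀ s, ‖w s - a s‖ ≤ ε / 8) → ∀ s x, innerRadius g ≤ ‖x‖ →
      v ≤ ‖x - w s‖ ^ 2 := by
    intro w hw s x hx
    refine (hout x (w s) ?_).le
    have h2 : ‖x‖ ≤ ‖x - w s‖ + ‖w s - a s‖ + ‖a s‖ := by
      calc ‖x‖ = ‖(x - w s) + (w s - a s) + a s‖ := by congr 1; ring
        _ ≤ _ := norm_add₃_le
    linarith [hR s, hw s]
  have hma' : ∀ s, ‖m s - a s‖ ≤ ε / 8 := fun s => (hma s).trans (by linarith)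
  have hfar : ∀ (w : ℝ → ℂ), (∀ s, ‖w s - a s‖ ≤ ε / 8) → ∀ s,
      ∀ j ∈ Finset.Icc 1 (2 * g + 2), j ≠ k₀ → v < ‖α j s - w s‖ ^ 2 := by
    intro w hw s j hj hjk
    refine hout _ _ ?_
    have h2 : ‖α j s - a s‖ ≤ ‖α j s - w s‖ + ‖w s - a s‖ := by
      calc ‖α j s - a s‖ = ‖(α j s - w s) + (w s - a s)‖ := by congr 1; ring
        _ ≤ _ := norm_add_le _ _
    linarith [hsep s j hj hjk, hw s]
  have hnear : ∀ s, ‖a s - m s‖ ^ 2 < u := fun s => hinn _ _ (by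
    rw [norm_sub_rev]; linarith [hma s])
  have hF1 : SmoothFamily g fun s => diskTwist (m s) u v Real.pi :=
    smoothFamily_diskTwist huv hms contDiff_const (hsupp m hma')
  have hF2 : SmoothFamily g fun s => diskTwist (b s) u v (-Real.pi) :=
    smoothFamily_diskTwist huv hb contDiff_const (hsupp b hclose)
  have e1 : ∀ s, diskTwist (m s) u v Real.pi (a s) = b s := by
    intro s
    rw [diskTwist_pi_inner huv (hnear s).le]
    simp only [hm]
    ring
  refine ⟨fun s => diskTwist (b s) u v (-Real.pi) * diskTwist (m s) u v Real.pi, hF2.mul hF1,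
    fun s k hk => ?_, fun s k hk => ?_, ?_, ?_⟩
  · by_cases h : k = k₀
    · subst h
      refine AffineNear.mul hF1 ?_ (affineNear_diskTwist huv hms contDiff_const (Or.inl (hnear s)))
      rw [← ha, e1]
      exact affineNear_diskTwist huv hb contDiff_const (Or.inl (by simpa using hu0))
    · refine AffineNear.mul hF1 ?_ (affineNear_diskTwist huv hms contDiff_const
        (Or.inr (hfar m hma' s k hk h)))
      rw [diskTwist_outer huv _ (hfar m hma' s k hk h).le]
      exact affineNear_diskTwist huv hb contDiff_const (Or.inr (hfar b hclose s k hk h))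
  · rw [Equiv.Perm.mul_apply]
    by_cases h : k = k₀
    · subst h
      rw [Function.update_self, ← ha, e1, diskTwist_inner huv _ (by simpa using hu0.le)]
      simp
    · rw [Function.update_of_ne h, diskTwist_outer huv _ (hfar m hma' s k hk h).le,
        diskTwist_outer huv _ (hfar b hclose s k hk h).le]
  · have : m 0 = b 0 := by simp only [hm, h0]; ring
    simp only [this, diskTwist_mul, neg_add_cancel, diskTwist_zero]
  · have : m 1 = b 1 := by simp only [hm, h1]; ring
    simp only [this, diskTwist_mul, neg_add_cancel, diskTwist_zero]

/-- A small motion of all points. -/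
theorem carries_small {g : ℕ} {α β : ℕ → ℝ → ℂ} {ε : ℝ} (hε : 0 < ε)
    (hα : ∀ k ∈ Finset.Icc 1 (2 * g + 2), ContDiff ℝ ∞ (α k))
    (hβ : ∀ k ∈ Finset.Icc 1 (2 * g + 2), ContDiff ℝ ∞ (β k))
    (hsep : ∀ s, ∀ j ∈ Finset.Icc 1 (2 * g + 2), ∀ k ∈ Finset.Icc 1 (2 * g + 2), j ≠ k →
      ε ≤ ‖α j s - α k s‖)
    (hclose : ∀ s, ∀ k ∈ Finset.Icc 1 (2 * g + 2), ‖β k s - α k s‖ ≤ ε / 16)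
    (h0 : ∀ k ∈ Finset.Icc 1 (2 * g + 2), β k 0 = α k 0)
    (h1 : ∀ k ∈ Finset.Icc 1 (2 * g + 2), β k 1 = α k 1)
    (hR : ∀ s, ∀ k ∈ Finset.Icc 1 (2 * g + 2), ‖α k s‖ + ε ≤ innerRadius g) :
    Carries g α β := by
  classical
  have key : ∀ S ⊆ Finset.Icc 1 (2 * g + 2), Carries g α fun k => if k ∈ S then β k else α k := by
    intro S
    induction S using Finset.induction_on with
    | empty => exact fun _ => by simpa using Carries.refl g α
    | insert k₀ S hk₀ ih =>
      intro hS
      have hk : k₀ ∈ Finset.Icc 1 (2 * g + 2) := hS (Finset.mem_insert_self _ _)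
      refine (ih fun k hk => hS (Finset.mem_insert_of_mem hk)).trans ?_
      -- The points are moved one at a time. After some have moved by at most ε / 16 the next is
      -- still at distance at least ε / 2 from the others, and its own motion ε / 16 is (ε / 2) / 8,
      -- as `carries_one` demands.
      have h := carries_one (g := g) (α := fun k => if k ∈ S then β k else α k) (b := β k₀)
        (k₀ := k₀) (ε := ε / 2) (by linarith) (by simpa [hk₀] using hα k₀ hk) (hβ k₀ hk)
        (fun s j hj hjk => by
          simp only [hk₀, if_false]
          split_ifs with hjS
          · have h2 : ‖α j s - α k₀ s‖ ≤ ‖β j s - α k₀ s‖ + ‖β j s - α j s‖ := by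
              calc ‖α j s - α k₀ s‖ = ‖(β j s - α k₀ s) - (β j s - α j s)‖ := by congr 1; ring
                _ ≤ _ := norm_sub_le _ _
            linarith [hsep s j hj k₀ hk hjk, hclose s j hj]
          · linarith [hsep s j hj k₀ hk hjk])
        (fun s => by
          simp only [hk₀, if_false]
          linarith [hclose s k₀ hk])
        (by simpa [hk₀] using h0 k₀ hk) (by simpa [hk₀] using h1 k₀ hk)
        (fun s => by
          simp only [hk₀, if_false]
          linarith [hR s k₀ hk])
      refine h.congr fun s k _ => ?_
      by_cases hkk : k = k₀
      · subst hkk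
        simp
      · simp [hkk]
  exact (key _ subset_rfl).congr fun s k hk => by simp only [hk, if_true]

theorem exists_uniform_lower_bound {ι X : Type*} [TopologicalSpace X] {K : Set X}
    (hK : IsCompact K) (hne : K.Nonempty) (S : Finset ι) (φ : ι → X → ℝ)
    (hc : ∀ i ∈ S, Continuous (φ i)) (hpos : ∀ i ∈ S, ∀ x ∈ K, 0 < φ i x) :
    ∃ ε > 0, ∀ i ∈ S, ∀ x ∈ K, ε ≤ φ i x := by
  classical
  induction S using Finset.induction_on with
  | empty => exact ⟨1, one_pos, by simp⟩
  | insert i S _ ih =>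
    obtain ⟨ε, hε, h⟩ := ih (fun j hj => hc j (Finset.mem_insert_of_mem hj))
      (fun j hj => hpos j (Finset.mem_insert_of_mem hj))
    obtain ⟨x₀, hx₀, hmin⟩ := hK.exists_isMinOn hne
      (hc i (Finset.mem_insert_self _ _)).continuousOn
    refine ⟨min ε (φ i x₀), lt_min hε (hpos i (Finset.mem_insert_self _ _) x₀ hx₀), ?_⟩
    intro j hj x hx
    rcases Finset.mem_insert.1 hj with rfl | hj
    · exact (min_le_right _ _).trans (hmin hx)
    · exact (min_le_left _ _).trans (h j hj x hx)

/-- A linear homotopy between two motions during which the points stay distinct. -/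
theorem carries_linear {g : ℕ} {α β : ℕ → ℝ → ℂ}
    (hα : ∀ k ∈ Finset.Icc 1 (2 * g + 2), ContDiff ℝ ∞ (α k))
    (hβ : ∀ k ∈ Finset.Icc 1 (2 * g + 2), ContDiff ℝ ∞ (β k))
    (hsep : ∀ r ∈ Set.Icc (0 : ℝ) 1, ∀ s, ∀ j ∈ Finset.Icc 1 (2 * g + 2),
      ∀ k ∈ Finset.Icc 1 (2 * g + 2), j ≠ k →
      (1 - r : ℂ) * (α j s - α k s) + r * (β j s - β k s) ≠ 0)
    (hclamp : ∀ s, ∃ t ∈ Set.Icc (0 : ℝ) 1, ∀ k ∈ Finset.Icc 1 (2 * g + 2),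
      α k s = α k t ∧ β k s = β k t)
    (h0 : ∀ k ∈ Finset.Icc 1 (2 * g + 2), β k 0 = α k 0)
    (h1 : ∀ k ∈ Finset.Icc 1 (2 * g + 2), β k 1 = α k 1)
    (hRα : ∀ s, ∀ k ∈ Finset.Icc 1 (2 * g + 2), ‖α k s‖ < innerRadius g)
    (hRβ : ∀ s, ∀ k ∈ Finset.Icc 1 (2 * g + 2), ‖β k s‖ < innerRadius g) :
    Carries g α β := by
  set T := Finset.Icc 1 (2 * g + 2) with hT
  set D : ℕ → ℝ × ℝ → ℂ := fun k p => (1 - p.1 : ℂ) * α k p.2 + p.1 * β k p.2 with hD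
  have hDc : ∀ k ∈ T, Continuous (D k) := by
    intro k hk
    have h2 := (hα k hk).continuous
    have h3 := (hβ k hk).continuous
    fun_prop
  have hcpt : IsCompact (Set.Icc (0 : ℝ) 1 ×ˢ Set.Icc (0 : ℝ) 1) := isCompact_Icc.prod isCompact_Icc
  have hne : (Set.Icc (0 : ℝ) 1 ×ˢ Set.Icc (0 : ℝ) 1).Nonempty :=
    ⟨(0, 0), by simp, by simp⟩
  -- Compactness of the square of parameters (r, s) gives a uniform separation of the points during
  -- the homotopy; `hclamp` extends it to all real s.
  obtain ⟨ε₁, hε₁, H1⟩ := exists_uniform_lower_bound hcpt hne (T ×ˢ T)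
    (fun i p => if i.1 = i.2 then 1 else ‖D i.1 p - D i.2 p‖)
    (fun i hi => by
      have h2 := hDc i.1 (Finset.mem_product.1 hi).1
      have h3 := hDc i.2 (Finset.mem_product.1 hi).2
      split_ifs <;> fun_prop)
    (fun i hi p hp => by
      split_ifs with h
      · exact one_pos
      · refine norm_pos_iff.2 ?_
        have h2 := hsep p.1 hp.1 p.2 i.1 (Finset.mem_product.1 hi).1 i.2
          (Finset.mem_product.1 hi).2 h
        intro h3
        apply h2
        rw [← h3]
        simp only [hD]
        ring)
  obtain ⟨ε₂, hε₂, H2⟩ := exists_uniform_lower_bound hcpt hne T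
    (fun k p => innerRadius g - ‖D k p‖)
    (fun k hk => by
      have := hDc k hk
      fun_prop)
    (fun k hk p hp => by
      refine sub_pos.2 ?_
      have hmem : D k p ∈ Metric.ball (0 : ℂ) (innerRadius g) := by
        have hcv := convex_ball (0 : ℂ) (innerRadius g)
        have h2 := hcv (mem_ball_zero_iff.2 (hRα p.2 k hk)) (mem_ball_zero_iff.2 (hRβ p.2 k hk))
          (sub_nonneg.2 hp.1.2) hp.1.1 (by ring)
        simpa [hD] using h2
      exact mem_ball_zero_iff.1 hmem)
  set ε := min ε₁ ε₂ with hεdef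
  have hε : 0 < ε := lt_min hε₁ hε₂
  have hsep' : ∀ r ∈ Set.Icc (0 : ℝ) 1, ∀ s, ∀ j ∈ T, ∀ k ∈ T, j ≠ k →
      ε ≤ ‖D j (r, s) - D k (r, s)‖ := by
    intro r hr s j hj k hk hjk
    obtain ⟨t, ht, hst⟩ := hclamp s
    have h2 := H1 (j, k) (Finset.mk_mem_product hj hk) (r, t) ⟨hr, ht⟩
    simp only [hjk, if_false] at h2
    simp only [hD] at h2 ⊢
    rw [(hst j hj).1, (hst j hj).2, (hst k hk).1, (hst k hk).2]
    exact (min_le_left _ _).trans h2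
  have hR' : ∀ r ∈ Set.Icc (0 : ℝ) 1, ∀ s, ∀ k ∈ T, ‖D k (r, s)‖ + ε ≤ innerRadius g := by
    intro r hr s k hk
    obtain ⟨t, ht, hst⟩ := hclamp s
    have h2 := H2 k hk (r, t) ⟨hr, ht⟩
    simp only [hD] at h2 ⊢
    rw [(hst k hk).1, (hst k hk).2]
    linarith [min_le_right ε₁ ε₂]
  -- The homotopy is cut into N steps. All points stay within R = `innerRadius g` of 0, so one step
  -- moves a point by at most 2R / N ≤ ε / 16.
  obtain ⟨N, hN⟩ := exists_nat_gt (2 * innerRadius g * 16 / ε)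
  have hN0 : (0 : ℝ) < N := lt_of_le_of_lt
    (div_nonneg (by linarith [innerRadius_pos g]) hε.le) hN
  have hstep : ∀ m : ℕ, m ≤ N → Carries g α fun k s => D k ((m : ℝ) / N, s) := by
    intro m
    induction m with
    | zero =>
      intro _
      refine (Carries.refl g α).congr fun s k _ => ?_
      simp [hD]
    | succ m ih =>
      intro hm
      refine (ih (by omega)).trans ?_
      have hm' : (m : ℝ) + 1 ≤ N := by exact_mod_cast hm
      have hr : (m : ℝ) / N ∈ Set.Icc (0 : ℝ) 1 := by
        constructor
        · positivity
        · rw [div_le_one hN0]; linarith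
      have hDs : ∀ r : ℝ, ∀ k ∈ T, ContDiff ℝ ∞ fun s => D k (r, s) := by
        intro r k hk
        have h2 : ContDiff ℝ ∞ fun s => (1 - r : ℂ) * α k s := contDiff_const.mul (hα k hk)
        have h3 : ContDiff ℝ ∞ fun s => (r : ℂ) * β k s := contDiff_const.mul (hβ k hk)
        exact h2.add h3
      have hdiff : ∀ k s, D k (((m + 1 : ℕ) : ℝ) / N, s) - D k ((m : ℝ) / N, s) =
          (β k s - α k s) / N := by
        intro k s
        have : (N : ℂ) ≠ 0 := by exact_mod_cast hN0.ne'
        simp only [hD]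
        push_cast
        field_simp
        ring
      refine carries_small hε (hDs _) (hDs _) (hsep' _ hr) (fun s k hk => ?_) (fun k hk => ?_)
        (fun k hk => ?_) (hR' _ hr)
      · rw [hdiff, norm_div, Complex.norm_natCast, div_le_iff₀ hN0]
        have h2 := norm_sub_le (β k s) (α k s)
        have h3 := hRα s k hk
        have h4 := hRβ s k hk
        rw [div_lt_iff₀ hε] at hN
        linarith
      · rw [← sub_eq_zero, hdiff, h0 k hk, sub_self, zero_div]
      · rw [← sub_eq_zero, hdiff, h1 k hk, sub_self, zero_div]
  refine (hstep N le_rfl).congr fun s k _ => ?_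
  simp [hD, div_self hN0.ne']

/-- Two isotopies which start at the identity end at the same mapping class if the motions of the
branch points are related by a linear homotopy. -/
theorem cl_eq_of_linear_homotopy {g : ℕ} {K L : ℝ → Equiv.Perm ℂ} (hK : SmoothFamily g K)
    (hL : SmoothFamily g L) (hK0 : K 0 = 1) (hL0 : L 0 = 1)
    (hKA : ∀ s, ∀ k ∈ Finset.Icc 1 (2 * g + 2), AffineNear K s (branchPoint g k))
    (hLA : ∀ s, ∀ k ∈ Finset.Icc 1 (2 * g + 2), AffineNear L s (branchPoint g k))
    (hKL : ∀ k ∈ Finset.Icc 1 (2 * g + 2), L 1 (branchPoint g k) = K 1 (branchPoint g k))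
    (hsep : ∀ r ∈ Set.Icc (0 : ℝ) 1, ∀ s, ∀ j ∈ Finset.Icc 1 (2 * g + 2),
      ∀ k ∈ Finset.Icc 1 (2 * g + 2), j ≠ k →
      (1 - r : ℂ) * (K s (branchPoint g j) - K s (branchPoint g k)) +
        r * (L s (branchPoint g j) - L s (branchPoint g k)) ≠ 0)
    (hclamp : ∀ s, ∃ t ∈ Set.Icc (0 : ℝ) 1, K s = K t ∧ L s = L t)
    (f h : BaseDiffeo g) (hf : (f : Equiv.Perm ℂ) = K 1) (hh : (h : Equiv.Perm ℂ) = L 1) :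
    BaseDiffeo.cl f = BaseDiffeo.cl h := by
  have hsm : ∀ {M : ℝ → Equiv.Perm ℂ}, SmoothFamily g M → ∀ k : ℕ,
      ContDiff ℝ ∞ fun s => M s (branchPoint g k) := fun hM k =>
    hM.smooth.comp (contDiff_id.prodMk contDiff_const)
  have hbd : ∀ {M : ℝ → Equiv.Perm ℂ}, SmoothFamily g M → ∀ s, ∀ k ∈ Finset.Icc 1 (2 * g + 2),
      ‖M s (branchPoint g k)‖ < innerRadius g := fun hM s k hk =>
    norm_perm_lt (hM.support s) (by
      by_contra hcon
      push Not at hcon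
      exact poly_ne_zero_of_large hcon (poly_eq_zero_iff.2 ⟨k, hk, rfl⟩))
  obtain ⟨G, hG, hGA, hGm, hG0, hG1⟩ := carries_linear (g := g)
    (α := fun k s => K s (branchPoint g k)) (β := fun k s => L s (branchPoint g k))
    (fun k _ => hsm hK k) (fun k _ => hsm hL k) hsep
    (fun s => by
      obtain ⟨t, ht, h1, h2⟩ := hclamp s
      exact ⟨t, ht, fun k _ => ⟨by rw [h1], by rw [h2]⟩⟩)
    (fun k _ => by rw [hK0, hL0]) hKL (hbd hK) (hbd hL)
  -- G carries the motion of K to that of L, so L⁻¹ G K fixes every branch point at all times. It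
  -- begins at 1 and, as G ends at 1, finishes at h⁻¹ f; hence h⁻¹ f is trivial.
  have hfix : ∀ s, ∀ k ∈ Finset.Icc 1 (2 * g + 2),
      ((L s)⁻¹ * (G s * K s)) (branchPoint g k) = branchPoint g k := by
    intro s k hk
    rw [Equiv.Perm.mul_apply, Equiv.Perm.mul_apply, hGm s k hk]
    exact (L s).symm_apply_apply _
  have h1 := (hL.inv.mul (hG.mul hK)).cl_eq
    (fun s k hk => by
      have h2 : AffineNear (fun s => G s * K s) s (branchPoint g k) :=
        AffineNear.mul hK (hGA s k hk) (hKA s k hk)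
      refine AffineNear.mul (hG.mul hK) ?_ h2
      rw [Equiv.Perm.mul_apply, hGm s k hk]
      exact AffineNear.inv hL (hLA s k hk))
    (fun s k hk => ⟨k, hk, hfix s k hk⟩) 1 (h⁻¹ * f)
    (by simp [hK0, hL0, hG0]) (by simp [hf, hh, hG1])
  rw [map_one, map_mul, map_inv] at h1
  exact (inv_mul_eq_one.1 h1.symm).symm

/-! ### Half twists of blocks of consecutive branch points -/

/-- The midpoint of the branch points `p_i` and `p_j`. -/
def blockCenter (g i j : ℕ) : ℝ := i + j - (2 * g + 3)

/-- The disc twist with parameters `u`, `v` around the midpoint of `p_i` and `p_j` moves the block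
`p_i, …, p_j` rigidly and leaves the other branch points fixed. -/
structure IsBlock (g i j : ℕ) (u v : ℝ) : Prop where
  one_le : 1 ≤ i
  le : i ≤ j
  le_max : j ≤ 2 * g + 2
  lt : u < v
  inner : ((j : ℝ) - i) ^ 2 < u
  outer : ∀ k ∈ Finset.Icc 1 (2 * g + 2), k < i ∨ j < k → v < (2 * k - i - j : ℝ) ^ 2
  support : ∀ x : ℂ, innerRadius g ≤ ‖x‖ → v ≤ ‖x - blockCenter g i j‖ ^ 2

/-- The twist of a block by the angle `θ`. -/
def blockTwist (g i j : ℕ) (u v θ : ℝ) : Equiv.Perm ℂ := diskTwist (blockCenter g i j) u v θ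

theorem blockTwist_zero (g i j : ℕ) (u v : ℝ) : blockTwist g i j u v 0 = 1 := diskTwist_zero _ _ _

theorem norm_branchPoint_sub (g i j k : ℕ) :
    ‖(branchPoint g k : ℂ) - blockCenter g i j‖ ^ 2 = (2 * k - i - j : ℝ) ^ 2 := by
  rw [← Complex.ofReal_sub, Complex.norm_real, Real.norm_eq_abs, sq_abs, branchPoint, blockCenter]
  ring

namespace IsBlock

variable {g i j : ℕ} {u v : ℝ}

theorem lt_of_norm_le (h : IsBlock g i j u v) {x : ℂ} (hx : ‖x - blockCenter g i j‖ ≤ (j : ℝ) - i) :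
    ‖x - blockCenter g i j‖ ^ 2 < u :=
  (pow_le_pow_left₀ (norm_nonneg _) hx 2).trans_lt h.inner

theorem inner_branchPoint (h : IsBlock g i j u v) {k : ℕ} (hik : i ≤ k) (hkj : k ≤ j) :
    ‖(branchPoint g k : ℂ) - blockCenter g i j‖ ^ 2 < u := by
  rw [norm_branchPoint_sub]
  refine lt_of_le_of_lt ?_ h.inner
  have h1 : (i : ℝ) ≤ k := by exact_mod_cast hik
  have h2 : (k : ℝ) ≤ j := by exact_mod_cast hkj
  exact sq_le_sq' (by linarith) (by linarith)

theorem outer_branchPoint (h : IsBlock g i j u v) {k : ℕ} (hk : k ∈ Finset.Icc 1 (2 * g + 2))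
    (hkij : k < i ∨ j < k) : v < ‖(branchPoint g k : ℂ) - blockCenter g i j‖ ^ 2 := by
  rw [norm_branchPoint_sub]
  exact h.outer k hk hkij

theorem dichotomy (h : IsBlock g i j u v) {k : ℕ} (hk : k ∈ Finset.Icc 1 (2 * g + 2)) :
    ‖(branchPoint g k : ℂ) - blockCenter g i j‖ ^ 2 < u ∨
      v < ‖(branchPoint g k : ℂ) - blockCenter g i j‖ ^ 2 := by
  by_cases hkij : k < i ∨ j < k
  · exact Or.inr (h.outer_branchPoint hk hkij)
  · exact Or.inl (h.inner_branchPoint (by omega) (by omega))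

theorem apply_inner (h : IsBlock g i j u v) (θ : ℝ) {x : ℂ}
    (hx : ‖x - blockCenter g i j‖ ^ 2 < u) :
    blockTwist g i j u v θ x =
      blockCenter g i j + (x - blockCenter g i j) * Complex.exp ((θ : ℂ) * Complex.I) :=
  diskTwist_inner h.lt θ hx.le

theorem apply_outer (h : IsBlock g i j u v) (θ : ℝ) {k : ℕ} (hk : k ∈ Finset.Icc 1 (2 * g + 2))
    (hkij : k < i ∨ j < k) : blockTwist g i j u v θ (branchPoint g k) = branchPoint g k :=
  diskTwist_outer h.lt θ (h.outer_branchPoint hk hkij).le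

theorem smoothFamily (h : IsBlock g i j u v) {θ : ℝ → ℝ} (hθ : ContDiff ℝ ∞ θ) :
    SmoothFamily g fun s => blockTwist g i j u v (θ s) :=
  smoothFamily_diskTwist h.lt contDiff_const hθ fun _ => h.support

theorem affineNear (h : IsBlock g i j u v) {θ : ℝ → ℝ} (hθ : ContDiff ℝ ∞ θ) {s : ℝ} {x : ℂ}
    (hx : ‖x - blockCenter g i j‖ ^ 2 < u ∨ v < ‖x - blockCenter g i j‖ ^ 2) :
    AffineNear (fun s => blockTwist g i j u v (θ s)) s x :=
  affineNear_diskTwist h.lt contDiff_const hθ hx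

theorem apply_pi (h : IsBlock g i j u v) {k : ℕ} (hik : i ≤ k) (hkj : k ≤ j) :
    blockTwist g i j u v Real.pi (branchPoint g k) = branchPoint g (i + j - k) := by
  refine (diskTwist_pi_inner h.lt (h.inner_branchPoint hik hkj).le).trans ?_
  have : ((i + j - k : ℕ) : ℝ) = i + j - k := by
    rw [Nat.cast_sub (by omega)]; push_cast; ring
  rw [branchPoint, branchPoint, this, blockCenter]
  push_cast
  ring

theorem permutes (h : IsBlock g i j u v) :
    PermutesBranchPoints g (blockTwist g i j u v Real.pi) := by
  intro k hk
  by_cases hkij : k < i ∨ j < k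
  · exact ⟨k, hk, h.apply_outer _ hk hkij⟩
  · refine ⟨i + j - k, ?_, h.apply_pi (by omega) (by omega)⟩
    have := h.one_le
    have := h.le_max
    rw [Finset.mem_Icc] at hk ⊢
    omega

theorem mem_baseDiffeo (h : IsBlock g i j u v) :
    blockTwist g i j u v Real.pi ∈ BaseDiffeo g :=
  (h.smoothFamily contDiff_const).mem_baseDiffeo
    (fun _ _ hk => h.affineNear contDiff_const (h.dichotomy hk)) (fun _ => h.permutes) 0

/-- The half twist of a block as a base diffeomorphism. -/
def diffeo (h : IsBlock g i j u v) : BaseDiffeo g := ⟨_, h.mem_baseDiffeo⟩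

/-- The mapping class of the half twist of a block. -/
def cls (h : IsBlock g i j u v) : Gamma g := BaseDiffeo.cl h.diffeo

end IsBlock

/-- A monotone smooth parameter from `0` to `π`. -/
def ramp (s : ℝ) : ℝ := Real.pi * Real.smoothTransition s

theorem contDiff_ramp : ContDiff ℝ ∞ ramp := contDiff_const.mul Real.smoothTransition.contDiff

theorem ramp_of_nonpos {s : ℝ} (hs : s ≤ 0) : ramp s = 0 := by
  rw [ramp, Real.smoothTransition.zero_of_nonpos hs, mul_zero]

theorem ramp_of_one_le {s : ℝ} (hs : 1 ≤ s) : ramp s = Real.pi := by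
  rw [ramp, Real.smoothTransition.one_of_one_le hs, mul_one]

theorem ramp_nonneg (s : ℝ) : 0 ≤ ramp s :=
  mul_nonneg Real.pi_pos.le (Real.smoothTransition.nonneg s)

theorem ramp_le (s : ℝ) : ramp s ≤ Real.pi :=
  mul_le_of_le_one_right Real.pi_pos.le (Real.smoothTransition.le_one s)

theorem ramp_pos {s : ℝ} (hs : 0 < s) : 0 < ramp s :=
  mul_pos Real.pi_pos (Real.smoothTransition.pos_of_pos hs)

theorem ramp_lt {s : ℝ} (hs : s < 1) : ramp s < Real.pi :=
  mul_lt_of_lt_one_right Real.pi_pos (Real.smoothTransition.lt_one_of_lt_one hs)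

/-- The class of a block twist does not depend on the parameters. -/
theorem IsBlock.cls_eq {g i j : ℕ} {u v u' v' : ℝ} (h : IsBlock g i j u v)
    (h' : IsBlock g i j u' v') : h.cls = h'.cls := by
  -- The radii do not affect the paths of the branch points, so the linear homotopy between the two
  -- motions is constant.
  have hpt : ∀ s, ∀ k ∈ Finset.Icc 1 (2 * g + 2), blockTwist g i j u' v' (ramp s) (branchPoint g k)
      = blockTwist g i j u v (ramp s) (branchPoint g k) := by
    intro s k hk
    by_cases hkij : k < i ∨ j < k
    · rw [h.apply_outer _ hk hkij, h'.apply_outer _ hk hkij]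
    · rw [h.apply_inner _ (h.inner_branchPoint (by omega) (by omega)),
        h'.apply_inner _ (h'.inner_branchPoint (by omega) (by omega))]
  refine cl_eq_of_linear_homotopy (h.smoothFamily contDiff_ramp) (h'.smoothFamily contDiff_ramp)
    (by rw [ramp_of_nonpos le_rfl, blockTwist_zero]) (by rw [ramp_of_nonpos le_rfl, blockTwist_zero])
    (fun s k hk => h.affineNear contDiff_ramp (h.dichotomy hk))
    (fun s k hk => h'.affineNear contDiff_ramp (h'.dichotomy hk)) (hpt 1) ?_ ?_ _ _
    (by rw [ramp_of_one_le le_rfl]; rfl) (by rw [ramp_of_one_le le_rfl]; rfl)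
  · intro r _ s a ha b hb hab
    rw [hpt s a ha, hpt s b hb, ← add_mul, sub_add_cancel, one_mul, sub_ne_zero]
    intro hcon
    exact hab (branchPoint_injective g (by exact_mod_cast (blockTwist g i j u v _).injective hcon))
  · intro s
    rcases le_total s 0 with hs | hs
    · exact ⟨0, by simp, by rw [ramp_of_nonpos hs, ramp_of_nonpos le_rfl]; exact ⟨rfl, rfl⟩⟩
    · rcases le_total s 1 with hs' | hs'
      · exact ⟨s, ⟨hs, hs'⟩, rfl, rfl⟩
      · exact ⟨1, by simp, by rw [ramp_of_one_le hs', ramp_of_one_le le_rfl]; exact ⟨rfl, rfl⟩⟩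

/-- The half twist of a single point is trivial. -/
theorem IsBlock.cls_single {g i : ℕ} {u v : ℝ} (h : IsBlock g i i u v) : h.cls = 1 := by
  -- The rotation is centred at p_i itself, so no branch point moves while the angle grows from 0 to
  -- π: the family is an isotopy from the identity.
  have hfix : ∀ s, ∀ k ∈ Finset.Icc 1 (2 * g + 2),
      blockTwist g i i u v (ramp s) (branchPoint g k) = branchPoint g k := by
    intro s k hk
    by_cases hki : k = i
    · subst hki
      rw [h.apply_inner _ (h.inner_branchPoint le_rfl le_rfl)]
      have : (branchPoint g k : ℂ) - blockCenter g k k = 0 := by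
        rw [branchPoint, blockCenter]; push_cast; ring
      rw [this, zero_mul, add_zero]
      exact (sub_eq_zero.1 this).symm
    · exact h.apply_outer _ hk (by omega)
  have h1 := (h.smoothFamily contDiff_ramp).cl_eq
    (fun s k hk => h.affineNear contDiff_ramp (h.dichotomy hk))
    (fun s k hk => ⟨k, hk, hfix s k hk⟩) 1 h.diffeo
    (by rw [ramp_of_nonpos le_rfl, blockTwist_zero]; rfl) (by rw [ramp_of_one_le le_rfl]; rfl)
  rw [map_one] at h1
  exact h1.symm

/-! ### Adjoining a point to a block -/

section BlockStep

variable {g i j : ℕ} {u₁ v₁ u₂ v₂ u₃ v₃ : ℝ}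

/-- Rotating the block `p_i, …, p_j` while rotating back the block `p_{i+1}, …, p_j` translates the
points of the latter. -/
theorem pair_apply_mid (h₁ : IsBlock g i j u₁ v₁) (h₂ : IsBlock g (i + 1) j u₂ v₂) (θ : ℝ)
    {k : ℕ} (hik : i < k) (hkj : k ≤ j) :
    (‖blockTwist g (i + 1) j u₂ v₂ (-θ) (branchPoint g k) - blockCenter g i j‖ ^ 2 < u₁) ∧
    blockTwist g i j u₁ v₁ θ (blockTwist g (i + 1) j u₂ v₂ (-θ) (branchPoint g k)) =
      branchPoint g k + Complex.exp ((θ : ℂ) * Complex.I) - 1 := by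
  have e2 := h₂.apply_inner (-θ) (h₂.inner_branchPoint hik hkj)
  have hc : (blockCenter g (i + 1) j : ℂ) = blockCenter g i j + 1 := by
    simp only [blockCenter]; push_cast; ring
  have hlt : ‖blockTwist g (i + 1) j u₂ v₂ (-θ) (branchPoint g k) - blockCenter g i j‖ ^ 2 < u₁ := by
    refine h₁.lt_of_norm_le ?_
    rw [e2, hc]
    have e3 : (blockCenter g i j + 1 + ((branchPoint g k : ℂ) - (blockCenter g i j + 1)) *
        Complex.exp (((-θ : ℝ) : ℂ) * Complex.I) - blockCenter g i j : ℂ) =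
        1 + ((branchPoint g k : ℂ) - (blockCenter g i j + 1)) *
          Complex.exp (((-θ : ℝ) : ℂ) * Complex.I) := by ring
    rw [e3]
    refine (norm_add_le _ _).trans ?_
    rw [norm_mul, Complex.norm_exp_ofReal_mul_I, mul_one, norm_one]
    have e4 : (branchPoint g k : ℂ) - (blockCenter g i j + 1) =
        ((2 * k - i - j - 1 : ℝ) : ℂ) := by
      rw [branchPoint, blockCenter]; push_cast; ring
    rw [e4, Complex.norm_real, Real.norm_eq_abs]
    have h1 : (i : ℝ) + 1 ≤ k := by exact_mod_cast hik
    have h2 : (k : ℝ) ≤ j := by exact_mod_cast hkj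
    -- The point circles the centre of the smaller block, which is 1 to the right of the larger
    -- centre, at distance at most j − i − 1; hence it never leaves the rigid part of the larger
    -- disc.
    have : |(2 * k - i - j - 1 : ℝ)| ≤ j - i - 1 := abs_le.2 ⟨by linarith, by linarith⟩
    linarith
  refine ⟨hlt, ?_⟩
  rw [h₁.apply_inner θ hlt, e2, hc]
  have : Complex.exp (((-θ : ℝ) : ℂ) * Complex.I) * Complex.exp ((θ : ℂ) * Complex.I) = 1 := by
    rw [← Complex.exp_add]; push_cast; simp
  linear_combination ((branchPoint g k : ℂ) - (blockCenter g i j + 1)) * this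

theorem pair_apply_first (h₁ : IsBlock g i j u₁ v₁) (h₂ : IsBlock g (i + 1) j u₂ v₂) (θ : ℝ) :
    blockTwist g (i + 1) j u₂ v₂ (-θ) (branchPoint g i) = branchPoint g i ∧
    blockTwist g i j u₁ v₁ θ (blockTwist g (i + 1) j u₂ v₂ (-θ) (branchPoint g i)) =
      blockCenter g i j - ((j : ℂ) - i) * Complex.exp ((θ : ℂ) * Complex.I) := by
  have hi : i ∈ Finset.Icc 1 (2 * g + 2) :=
    Finset.mem_Icc.2 ⟨h₁.one_le, h₁.le.trans h₁.le_max⟩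
  have e1 := h₂.apply_outer (-θ) hi (Or.inl (Nat.lt_succ_self i))
  refine ⟨e1, ?_⟩
  rw [e1, h₁.apply_inner θ (h₁.inner_branchPoint le_rfl h₁.le)]
  rw [branchPoint, blockCenter]
  push_cast
  ring

theorem pair_apply_outer (h₁ : IsBlock g i j u₁ v₁) (h₂ : IsBlock g (i + 1) j u₂ v₂) (θ : ℝ)
    {k : ℕ} (hk : k ∈ Finset.Icc 1 (2 * g + 2)) (hkij : k < i ∨ j < k) :
    blockTwist g (i + 1) j u₂ v₂ (-θ) (branchPoint g k) = branchPoint g k ∧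
    blockTwist g i j u₁ v₁ θ (blockTwist g (i + 1) j u₂ v₂ (-θ) (branchPoint g k)) =
      branchPoint g k := by
  have e1 := h₂.apply_outer (-θ) hk (by omega)
  exact ⟨e1, by rw [e1, h₁.apply_outer θ hk hkij]⟩

/-- The family which rotates the block `p_i, …, p_j` and rotates back `p_{i+1}, …, p_j`. -/
def pairFamily (g i j : ℕ) (u₁ v₁ u₂ v₂ : ℝ) (θ : ℝ) : Equiv.Perm ℂ :=
  blockTwist g i j u₁ v₁ θ * blockTwist g (i + 1) j u₂ v₂ (-θ)

theorem pairFamily_smooth (h₁ : IsBlock g i j u₁ v₁) (h₂ : IsBlock g (i + 1) j u₂ v₂)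
    {θ : ℝ → ℝ} (hθ : ContDiff ℝ ∞ θ) :
    SmoothFamily g fun s => pairFamily g i j u₁ v₁ u₂ v₂ (θ s) :=
  (h₁.smoothFamily hθ).mul (h₂.smoothFamily hθ.neg)

theorem pairFamily_affineNear (h₁ : IsBlock g i j u₁ v₁) (h₂ : IsBlock g (i + 1) j u₂ v₂)
    {θ : ℝ → ℝ} (hθ : ContDiff ℝ ∞ θ) (s : ℝ) {k : ℕ} (hk : k ∈ Finset.Icc 1 (2 * g + 2)) :
    AffineNear (fun s => pairFamily g i j u₁ v₁ u₂ v₂ (θ s)) s (branchPoint g k) := by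
  refine AffineNear.mul (h₂.smoothFamily hθ.neg) (h₁.affineNear hθ ?_)
    (h₂.affineNear hθ.neg (h₂.dichotomy hk))
  rcases lt_trichotomy k i with h | h | h
  · rw [(pair_apply_outer h₁ h₂ (θ s) hk (Or.inl h)).1]
    exact h₁.dichotomy hk
  · subst h
    rw [(pair_apply_first h₁ h₂ (θ s)).1]
    exact h₁.dichotomy hk
  · by_cases hkj : k ≤ j
    · exact Or.inl (pair_apply_mid h₁ h₂ (θ s) h hkj).1
    · rw [(pair_apply_outer h₁ h₂ (θ s) hk (Or.inr (by omega))).1]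
      exact h₁.dichotomy hk

theorem pairFamily_pi_permutes (h₁ : IsBlock g i j u₁ v₁) (h₂ : IsBlock g (i + 1) j u₂ v₂) :
    PermutesBranchPoints g (pairFamily g i j u₁ v₁ u₂ v₂ Real.pi) := by
  intro k hk
  have hle := h₁.le
  have hmax := h₁.le_max
  have hone := h₁.one_le
  rcases lt_trichotomy k i with h | h | h
  · exact ⟨k, hk, (pair_apply_outer h₁ h₂ _ hk (Or.inl h)).2⟩
  · subst h
    refine ⟨j, Finset.mem_Icc.2 ⟨by omega, hmax⟩, (pair_apply_first h₁ h₂ _).2.trans ?_⟩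
    rw [Complex.exp_pi_mul_I, branchPoint, blockCenter]
    push_cast
    ring
  · by_cases hkj : k ≤ j
    · refine ⟨k - 1, Finset.mem_Icc.2 ⟨by omega, by omega⟩,
        (pair_apply_mid h₁ h₂ _ h hkj).2.trans ?_⟩
      rw [Complex.exp_pi_mul_I, branchPoint, branchPoint, Nat.cast_sub (by omega)]
      push_cast
      ring
    · exact ⟨k, hk, (pair_apply_outer h₁ h₂ _ hk (Or.inr (by omega))).2⟩

end BlockStep

section BlockStep

variable {g i j : ℕ} {u₁ v₁ u₂ v₂ u₃ v₃ u₄ v₄ u₅ v₅ : ℝ}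

/-- First rotate the block `p_i, …, p_j` and rotate back `p_{i+1}, …, p_j`, then exchange `p_j` and
`p_{j+1}`. -/
def stepFamily (g i j : ℕ) (u₁ v₁ u₂ v₂ u₃ v₃ s : ℝ) : Equiv.Perm ℂ :=
  blockTwist g j (j + 1) u₃ v₃ (ramp (3 * s - 2)) * pairFamily g i j u₁ v₁ u₂ v₂ (ramp (3 * s))

theorem contDiff_ramp_first : ContDiff ℝ ∞ fun s => ramp (3 * s) :=
  contDiff_ramp.comp (contDiff_const.mul contDiff_id)

theorem contDiff_ramp_second : ContDiff ℝ ∞ fun s => ramp (3 * s - 2) :=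
  contDiff_ramp.comp ((contDiff_const.mul contDiff_id).sub contDiff_const)

/-- The first phase ends at s = 1/3 and the second starts at s = 2/3; in between, the moving points
rest at branch points. -/
theorem ramp_staggered (s : ℝ) : ramp (3 * s - 2) = 0 ∨ ramp (3 * s) = Real.pi := by
  rcases le_total s (2 / 3) with h | h
  · exact Or.inl (ramp_of_nonpos (by linarith))
  · exact Or.inr (ramp_of_one_le (by linarith))

theorem stepFamily_smooth (h₁ : IsBlock g i j u₁ v₁) (h₂ : IsBlock g (i + 1) j u₂ v₂)
    (h₃ : IsBlock g j (j + 1) u₃ v₃) : SmoothFamily g (stepFamily g i j u₁ v₁ u₂ v₂ u₃ v₃) :=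
  (h₃.smoothFamily contDiff_ramp_second).mul (pairFamily_smooth h₁ h₂ contDiff_ramp_first)

theorem stepFamily_affineNear (h₁ : IsBlock g i j u₁ v₁) (h₂ : IsBlock g (i + 1) j u₂ v₂)
    (h₃ : IsBlock g j (j + 1) u₃ v₃) (s : ℝ) {k : ℕ} (hk : k ∈ Finset.Icc 1 (2 * g + 2)) :
    AffineNear (stepFamily g i j u₁ v₁ u₂ v₂ u₃ v₃) s (branchPoint g k) := by
  refine AffineNear.mul (pairFamily_smooth h₁ h₂ contDiff_ramp_first) ?_
    (pairFamily_affineNear h₁ h₂ contDiff_ramp_first s hk)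
  -- Before 2/3 the second factor is locally the identity. From 2/3 on the first phase is over and
  -- has brought the points to branch points, near which the twist of the pair is affine.
  rcases lt_or_ge s (2 / 3) with hs | hs
  · refine (AffineNear.one s _).congr ?_
    filter_upwards [gt_mem_nhds hs] with t ht
    rw [ramp_of_nonpos (by linarith), blockTwist_zero]
  · rw [ramp_of_one_le (by linarith)]
    obtain ⟨l, hl, e⟩ := pairFamily_pi_permutes h₁ h₂ k hk
    rw [e]
    exact h₃.affineNear contDiff_ramp_second (h₃.dichotomy hl)

theorem stepFamily_first (h₁ : IsBlock g i j u₁ v₁) (h₂ : IsBlock g (i + 1) j u₂ v₂)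
    (h₃ : IsBlock g j (j + 1) u₃ v₃) (s : ℝ) :
    stepFamily g i j u₁ v₁ u₂ v₂ u₃ v₃ s (branchPoint g i) =
      blockCenter g i j - ((j : ℂ) - i) * Complex.exp ((ramp (3 * s) : ℂ) * Complex.I) + 1 -
        Complex.exp ((ramp (3 * s - 2) : ℂ) * Complex.I) := by
  change blockTwist g j (j + 1) u₃ v₃ _ (blockTwist g i j u₁ v₁ _ _) = _
  rw [(pair_apply_first h₁ h₂ _).2]
  rcases ramp_staggered s with h | h
  · rw [h, blockTwist_zero, Equiv.Perm.one_apply]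
    simp
  · have e : (blockCenter g i j - ((j : ℂ) - i) * Complex.exp ((ramp (3 * s) : ℂ) * Complex.I) : ℂ)
        = branchPoint g j := by
      rw [h, Complex.exp_pi_mul_I, branchPoint, blockCenter]
      push_cast
      ring
    rw [e, h₃.apply_inner _ (h₃.inner_branchPoint le_rfl h₃.le), branchPoint, blockCenter]
    push_cast
    ring

theorem stepFamily_mid (h₁ : IsBlock g i j u₁ v₁) (h₂ : IsBlock g (i + 1) j u₂ v₂)
    (h₃ : IsBlock g j (j + 1) u₃ v₃) (s : ℝ) {k : ℕ} (hik : i < k) (hkj : k ≤ j) :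
    stepFamily g i j u₁ v₁ u₂ v₂ u₃ v₃ s (branchPoint g k) =
      branchPoint g k + Complex.exp ((ramp (3 * s) : ℂ) * Complex.I) - 1 := by
  change blockTwist g j (j + 1) u₃ v₃ _ (blockTwist g i j u₁ v₁ _ _) = _
  rw [(pair_apply_mid h₁ h₂ _ hik hkj).2]
  rcases ramp_staggered s with h | h
  · rw [h, blockTwist_zero, Equiv.Perm.one_apply]
  · have e : (branchPoint g k + Complex.exp ((ramp (3 * s) : ℂ) * Complex.I) - 1 : ℂ) =
        branchPoint g (k - 1) := by
      rw [h, Complex.exp_pi_mul_I, branchPoint, branchPoint, Nat.cast_sub (by omega)]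
      push_cast
      ring
    have hmax := h₁.le_max
    rw [e, h₃.apply_outer _ (Finset.mem_Icc.2 ⟨by have := h₁.one_le; omega, by omega⟩)
      (Or.inl (by omega))]

theorem stepFamily_last (h₁ : IsBlock g i j u₁ v₁) (h₂ : IsBlock g (i + 1) j u₂ v₂)
    (h₃ : IsBlock g j (j + 1) u₃ v₃) (s : ℝ) :
    stepFamily g i j u₁ v₁ u₂ v₂ u₃ v₃ s (branchPoint g (j + 1)) =
      branchPoint g (j + 1) + Complex.exp ((ramp (3 * s - 2) : ℂ) * Complex.I) - 1 := by
  change blockTwist g j (j + 1) u₃ v₃ _ (blockTwist g i j u₁ v₁ _ _) = _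
  rw [(pair_apply_outer h₁ h₂ _ (Finset.mem_Icc.2 ⟨Nat.le_add_left _ _, h₃.le_max⟩)
    (Or.inr (Nat.lt_succ_self j))).2, h₃.apply_inner _ (h₃.inner_branchPoint h₃.le le_rfl),
    branchPoint, blockCenter]
  push_cast
  ring

theorem stepFamily_outer (h₁ : IsBlock g i j u₁ v₁) (h₂ : IsBlock g (i + 1) j u₂ v₂)
    (h₃ : IsBlock g j (j + 1) u₃ v₃) (s : ℝ) {k : ℕ} (hk : k ∈ Finset.Icc 1 (2 * g + 2))
    (hkij : k < i ∨ j + 1 < k) :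
    stepFamily g i j u₁ v₁ u₂ v₂ u₃ v₃ s (branchPoint g k) = branchPoint g k := by
  change blockTwist g j (j + 1) u₃ v₃ _ (blockTwist g i j u₁ v₁ _ _) = _
  have := h₁.le
  rw [(pair_apply_outer h₁ h₂ _ hk (by omega)).2, h₃.apply_outer _ hk (by omega)]

theorem exp_mul_I_re_im (θ : ℝ) : (Complex.exp ((θ : ℂ) * Complex.I)).re = Real.cos θ ∧
    (Complex.exp ((θ : ℂ) * Complex.I)).im = Real.sin θ :=
  ⟨Complex.exp_ofReal_mul_I_re θ, Complex.exp_ofReal_mul_I_im θ⟩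

/-- During the two motions each pair of points is either never vertically aligned, or stays in the
closed upper half-plane. -/
theorem step_directions (h₁ : IsBlock g i j u₁ v₁) (h₂ : IsBlock g (i + 1) j u₂ v₂)
    (h₃ : IsBlock g j (j + 1) u₃ v₃) (h₄ : IsBlock g i (j + 1) u₄ v₄)
    (h₅ : IsBlock g (i + 1) (j + 1) u₅ v₅) {s : ℝ} (hs0 : 0 < s) (hs1 : s < 1) {a b : ℕ}
    (ha : a ∈ Finset.Icc 1 (2 * g + 2)) (hb : b ∈ Finset.Icc 1 (2 * g + 2)) (hab : a < b) :
    (0 < (stepFamily g i j u₁ v₁ u₂ v₂ u₃ v₃ s (branchPoint g b) -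
        stepFamily g i j u₁ v₁ u₂ v₂ u₃ v₃ s (branchPoint g a)).re ∧
      0 < (pairFamily g i (j + 1) u₄ v₄ u₅ v₅ (ramp s) (branchPoint g b) -
        pairFamily g i (j + 1) u₄ v₄ u₅ v₅ (ramp s) (branchPoint g a)).re) ∨
    (0 ≤ (stepFamily g i j u₁ v₁ u₂ v₂ u₃ v₃ s (branchPoint g b) -
        stepFamily g i j u₁ v₁ u₂ v₂ u₃ v₃ s (branchPoint g a)).im ∧
      0 < (pairFamily g i (j + 1) u₄ v₄ u₅ v₅ (ramp s) (branchPoint g b) -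
        pairFamily g i (j + 1) u₄ v₄ u₅ v₅ (ramp s) (branchPoint g a)).im) := by
  have hij : i < j := h₂.le
  have hL : (1 : ℝ) ≤ (j : ℝ) - i := by
    have : (i : ℝ) + 1 ≤ j := by exact_mod_cast hij
    linarith
  have hab' : (a : ℝ) + 1 ≤ b := by exact_mod_cast hab
  obtain ⟨r1, i1⟩ := exp_mul_I_re_im (ramp (3 * s))
  obtain ⟨r2, i2⟩ := exp_mul_I_re_im (ramp (3 * s - 2))
  obtain ⟨r0, i0⟩ := exp_mul_I_re_im (ramp s)
  have hS : 0 < Real.sin (ramp s) := Real.sin_pos_of_pos_of_lt_pi (ramp_pos hs0) (ramp_lt hs1)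
  have hS1 : 0 ≤ Real.sin (ramp (3 * s)) := Real.sin_nonneg_of_nonneg_of_le_pi (ramp_nonneg _)
    (ramp_le _)
  have hS2 : 0 ≤ Real.sin (ramp (3 * s - 2)) := Real.sin_nonneg_of_nonneg_of_le_pi (ramp_nonneg _)
    (ramp_le _)
  have hC := Real.cos_le_one (ramp s)
  have hC' := Real.neg_one_le_cos (ramp s)
  have hC1 := Real.cos_le_one (ramp (3 * s))
  have hC1' := Real.neg_one_le_cos (ramp (3 * s))
  have hC2 := Real.cos_le_one (ramp (3 * s - 2))
  have hC2' := Real.neg_one_le_cos (ramp (3 * s - 2))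
  have hst : Real.cos (ramp (3 * s - 2)) = 1 ∨ Real.cos (ramp (3 * s)) = -1 := by
    rcases ramp_staggered s with h | h
    · exact Or.inl (by rw [h, Real.cos_zero])
    · exact Or.inr (by rw [h, Real.cos_pi])
  have hLS1 := mul_nonneg (by linarith : (0 : ℝ) ≤ (j : ℝ) - i) hS1
  have hLS := mul_pos (by linarith : (0 : ℝ) < (j : ℝ) + 1 - i) hS
  have hLC1 := mul_le_mul_of_nonneg_left hC1 (by linarith : (0 : ℝ) ≤ (j : ℝ) - i)
  have hLC1' := mul_le_mul_of_nonneg_left hC1' (by linarith : (0 : ℝ) ≤ (j : ℝ) - i)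
  have hLC := mul_le_mul_of_nonneg_left hC (by linarith : (0 : ℝ) ≤ (j : ℝ) + 1 - i)
  have hLC' := mul_le_mul_of_nonneg_left hC' (by linarith : (0 : ℝ) ≤ (j : ℝ) + 1 - i)
  have case_split : ∀ k, k < i ∨ k = i ∨ (i < k ∧ k ≤ j) ∨ k = j + 1 ∨ j + 1 < k := by
    intro k; omega
  set K : ℕ → ℂ := fun k => stepFamily g i j u₁ v₁ u₂ v₂ u₃ v₃ s (branchPoint g k) with hK
  set L : ℕ → ℂ := fun k => pairFamily g i (j + 1) u₄ v₄ u₅ v₅ (ramp s) (branchPoint g k) with hL'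
  have pO : ∀ k ∈ Finset.Icc 1 (2 * g + 2), k < i ∨ j + 1 < k →
      ((K k).re = 2 * k - (2 * g + 3) ∧ (K k).im = 0) ∧
      (L k).re = 2 * k - (2 * g + 3) ∧ (L k).im = 0 := by
    intro k hk hkij
    have e1 : K k = branchPoint g k := stepFamily_outer h₁ h₂ h₃ s hk hkij
    have e2 : L k = branchPoint g k := (pair_apply_outer h₄ h₅ (ramp s) hk hkij).2
    rw [e1, e2]
    exact ⟨⟨rfl, rfl⟩, rfl, rfl⟩
  have pI : ((K i).re = i + j - (2 * g + 3) - (j - i) * Real.cos (ramp (3 * s)) + 1 -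
        Real.cos (ramp (3 * s - 2)) ∧
      (K i).im = -((j - i) * Real.sin (ramp (3 * s))) - Real.sin (ramp (3 * s - 2))) ∧
      (L i).re = i + j + 1 - (2 * g + 3) - (j + 1 - i) * Real.cos (ramp s) ∧
      (L i).im = -((j + 1 - i) * Real.sin (ramp s)) := by
    have e1 : K i = _ := stepFamily_first h₁ h₂ h₃ s
    have e2 : L i = _ := (pair_apply_first h₄ h₅ (ramp s)).2
    rw [e1, e2]
    simp only [Complex.add_re, Complex.sub_re, Complex.mul_re, Complex.add_im, Complex.sub_im,
      Complex.mul_im, r1, i1, r2, i2, r0, i0, Complex.ofReal_re, Complex.ofReal_im,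
      Complex.natCast_re, Complex.natCast_im, Complex.one_re, Complex.one_im, blockCenter,
      Nat.cast_add, Nat.cast_one]
    refine ⟨⟨?_, ?_⟩, ?_, ?_⟩ <;> ring
  have pM : ∀ k, i < k → k ≤ j →
      ((K k).re = 2 * k - (2 * g + 3) + Real.cos (ramp (3 * s)) - 1 ∧
        (K k).im = Real.sin (ramp (3 * s))) ∧
      (L k).re = 2 * k - (2 * g + 3) + Real.cos (ramp s) - 1 ∧ (L k).im = Real.sin (ramp s) := by
    intro k hik hkj
    have e1 : K k = _ := stepFamily_mid h₁ h₂ h₃ s hik hkj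
    have e2 : L k = _ := (pair_apply_mid h₄ h₅ (ramp s) hik (hkj.trans (Nat.le_succ j))).2
    rw [e1, e2]
    simp only [Complex.add_re, Complex.sub_re, Complex.add_im, Complex.sub_im, r1, i1, r0, i0,
      Complex.ofReal_re, Complex.ofReal_im, Complex.one_re, Complex.one_im, branchPoint]
    refine ⟨⟨?_, ?_⟩, ?_, ?_⟩ <;> first | trivial | ring
  have pE : ((K (j + 1)).re = 2 * (j + 1) - (2 * g + 3) + Real.cos (ramp (3 * s - 2)) - 1 ∧
        (K (j + 1)).im = Real.sin (ramp (3 * s - 2))) ∧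
      (L (j + 1)).re = 2 * (j + 1) - (2 * g + 3) + Real.cos (ramp s) - 1 ∧
        (L (j + 1)).im = Real.sin (ramp s) := by
    have e1 : K (j + 1) = _ := stepFamily_last h₁ h₂ h₃ s
    have e2 : L (j + 1) = _ :=
      (pair_apply_mid h₄ h₅ (ramp s) (k := j + 1) (hij.trans (Nat.lt_succ_self j)) le_rfl).2
    rw [e1, e2]
    simp only [Complex.add_re, Complex.sub_re, Complex.add_im, Complex.sub_im, r2, i2, r0, i0,
      Complex.ofReal_re, Complex.ofReal_im, Complex.one_re, Complex.one_im, branchPoint,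
      Nat.cast_add, Nat.cast_one]
    refine ⟨⟨?_, ?_⟩, ?_, ?_⟩ <;> first | trivial | ring
  change (0 < (K b - K a).re ∧ 0 < (L b - L a).re) ∨ (0 ≤ (K b - K a).im ∧ 0 < (L b - L a).im)
  simp only [Complex.sub_re, Complex.sub_im]
  clear_value K L
  have hcj : ((j + 1 : ℕ) : ℝ) = j + 1 := Nat.cast_succ j
  have hR : ∀ m n : ℕ, m < n → (m : ℝ) + 1 ≤ n := fun m n h => by exact_mod_cast h
  rcases case_split a with h | h | h | h | h
  · obtain ⟨⟨a1, -⟩, a2, -⟩ := pO a ha (Or.inl h)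
    left
    rw [a1, a2]
    have := hR a i h
    rcases case_split b with h' | h' | h' | h' | h'
    · obtain ⟨⟨b1, -⟩, b2, -⟩ := pO b hb (Or.inl h')
      constructor <;> linarith
    · subst h'
      obtain ⟨⟨b1, -⟩, b2, -⟩ := pI
      constructor <;> linarith
    · obtain ⟨⟨b1, -⟩, b2, -⟩ := pM b h'.1 h'.2
      have := hR i b h'.1
      constructor <;> linarith
    · subst h'
      obtain ⟨⟨b1, -⟩, b2, -⟩ := pE
      constructor <;> linarith
    · obtain ⟨⟨b1, -⟩, b2, -⟩ := pO b hb (Or.inr h')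
      constructor <;> linarith
  -- Only p_i can become vertically aligned with another point: it travels to the right in the
  -- closed lower half-plane, while p_{i+1}, …, p_{j+1} stay in the closed upper one. For these
  -- pairs imaginary parts are compared; all other pairs keep their order from left to right.
  · subst h
    rcases case_split b with h' | h' | h' | h' | h'
    · omega
    · omega
    · obtain ⟨⟨-, b1⟩, -, b2⟩ := pM b h'.1 h'.2
      obtain ⟨⟨-, a1⟩, -, a2⟩ := pI
      right
      constructor <;> linarith
    · subst h'
      obtain ⟨⟨-, b1⟩, -, b2⟩ := pE
      obtain ⟨⟨-, a1⟩, -, a2⟩ := pI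
      right
      constructor <;> linarith
    · obtain ⟨⟨b1, -⟩, b2, -⟩ := pO b hb (Or.inr h')
      obtain ⟨⟨a1, -⟩, a2, -⟩ := pI
      have := hR (j + 1) b h'
      push_cast at this
      left
      constructor <;> linarith
  · obtain ⟨⟨a1, -⟩, a2, -⟩ := pM a h.1 h.2
    left
    rw [a1, a2]
    rcases case_split b with h' | h' | h' | h' | h'
    · omega
    · omega
    · obtain ⟨⟨b1, -⟩, b2, -⟩ := pM b h'.1 h'.2
      constructor <;> linarith
    · subst h'
      obtain ⟨⟨b1, -⟩, b2, -⟩ := pE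
      rw [hcj] at hab'
      constructor
      -- For a = j the real parts differ by 2 plus the cosine of the second angle minus that of the
      -- first. This could vanish only if the second phase were complete before the first began,
      -- which the staggering excludes.
      · rcases hst with h0 | h0 <;> linarith
      · linarith
    · obtain ⟨⟨b1, -⟩, b2, -⟩ := pO b hb (Or.inr h')
      constructor <;> linarith
  · subst h
    obtain ⟨⟨a1, -⟩, a2, -⟩ := pE
    left
    rw [a1, a2]
    rcases case_split b with h' | h' | h' | h' | h'
    · omega
    · omega
    · omega
    · omega
    · obtain ⟨⟨b1, -⟩, b2, -⟩ := pO b hb (Or.inr h')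
      rw [hcj] at hab'
      constructor <;> linarith
  · obtain ⟨⟨a1, -⟩, a2, -⟩ := pO a ha (Or.inr h)
    obtain ⟨⟨b1, -⟩, b2, -⟩ := pO b hb (Or.inr (by omega))
    left
    constructor <;> linarith

/-- The half twist of `p_j` and `p_{j+1}` enlarges the block. -/
theorem block_step (h₁ : IsBlock g i j u₁ v₁) (h₂ : IsBlock g (i + 1) j u₂ v₂)
    (h₃ : IsBlock g j (j + 1) u₃ v₃) (h₄ : IsBlock g i (j + 1) u₄ v₄)
    (h₅ : IsBlock g (i + 1) (j + 1) u₅ v₅) :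
    h₃.cls * (h₁.cls * h₂.cls⁻¹) = h₄.cls * h₅.cls⁻¹ := by
  have hij : i < j := h₂.le
  -- Both motions take p_i below the other points to the place of p_{j+1} and shift p_{i+1}, …,
  -- p_{j+1} by one place to the left: K in two stages, L at once.
  set K := stepFamily g i j u₁ v₁ u₂ v₂ u₃ v₃ with hK
  set L : ℝ → Equiv.Perm ℂ := fun s => pairFamily g i (j + 1) u₄ v₄ u₅ v₅ (ramp s) with hL
  have hpair0 : ∀ (i j : ℕ) (u v u' v' : ℝ), pairFamily g i j u v u' v' 0 = 1 := by
    intro i j u v u' v'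
    rw [pairFamily, neg_zero, blockTwist_zero, blockTwist_zero, one_mul]
  have hKneg : ∀ s ≤ 0, K s = 1 := by
    intro s hs
    simp only [hK, stepFamily]
    rw [ramp_of_nonpos (by linarith), ramp_of_nonpos (by linarith), hpair0, blockTwist_zero,
      one_mul]
  have hLneg : ∀ s ≤ 0, L s = 1 := by
    intro s hs
    simp only [hL]
    rw [ramp_of_nonpos hs, hpair0]
  have hKone : ∀ s, 1 ≤ s → K s = blockTwist g j (j + 1) u₃ v₃ Real.pi *
      pairFamily g i j u₁ v₁ u₂ v₂ Real.pi := by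
    intro s hs
    simp only [hK, stepFamily]
    rw [ramp_of_one_le (by linarith), ramp_of_one_le (by linarith)]
  have hLone : ∀ s, 1 ≤ s → L s = pairFamily g i (j + 1) u₄ v₄ u₅ v₅ Real.pi := by
    intro s hs
    simp only [hL]
    rw [ramp_of_one_le hs]
  have hend : ∀ s, 1 ≤ s → ∀ k ∈ Finset.Icc 1 (2 * g + 2),
      L s (branchPoint g k) = K s (branchPoint g k) := by
    intro s hs k hk
    have hexp : Complex.exp ((Real.pi : ℂ) * Complex.I) = -1 := Complex.exp_pi_mul_I
    have case_split : k < i ∨ j + 1 < k ∨ k = i ∨ (i < k ∧ k ≤ j) ∨ k = j + 1 := by omega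
    have hr1 : ramp (3 * s) = Real.pi := ramp_of_one_le (by linarith)
    have hr2 : ramp (3 * s - 2) = Real.pi := ramp_of_one_le (by linarith)
    have hr0 : ramp s = Real.pi := ramp_of_one_le hs
    change pairFamily g i (j + 1) u₄ v₄ u₅ v₅ (ramp s) (branchPoint g k) = _
    simp only [pairFamily, Equiv.Perm.mul_apply]
    rcases case_split with h | h | h | h | h
    · rw [(pair_apply_outer h₄ h₅ _ hk (Or.inl h)).2, hK,
        stepFamily_outer h₁ h₂ h₃ s hk (Or.inl h)]
    · rw [(pair_apply_outer h₄ h₅ _ hk (Or.inr h)).2, hK,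
        stepFamily_outer h₁ h₂ h₃ s hk (Or.inr h)]
    · subst h
      rw [(pair_apply_first h₄ h₅ _).2, hK, stepFamily_first h₁ h₂ h₃ s, hr1, hr2, hr0, hexp,
        blockCenter, blockCenter]
      push_cast
      ring
    · rw [(pair_apply_mid h₄ h₅ _ h.1 (by omega)).2, hK, stepFamily_mid h₁ h₂ h₃ s h.1 h.2, hr1,
        hr0]
    · subst h
      rw [(pair_apply_mid h₄ h₅ _ (by omega) le_rfl).2, hK, stepFamily_last h₁ h₂ h₃ s, hr2, hr0]
  have hinj : ∀ s, ∀ a b : ℕ, a ≠ b → K s (branchPoint g a) - K s (branchPoint g b) ≠ 0 := by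
    intro s a b hab
    refine sub_ne_zero.2 fun hcon => hab (branchPoint_injective g ?_)
    exact_mod_cast (K s).injective hcon
  -- Convex combinations of two differences in a half-plane stay in it. The imaginary parts for K
  -- are only weakly positive, as all points of K are real between the phases; so r = 0 is settled
  -- by injectivity of K s, and r > 0 by the strict inequality for L.
  have hsep : ∀ r ∈ Set.Icc (0 : ℝ) 1, ∀ s, ∀ a ∈ Finset.Icc 1 (2 * g + 2),
      ∀ b ∈ Finset.Icc 1 (2 * g + 2), a < b →
      (1 - r : ℂ) * (K s (branchPoint g b) - K s (branchPoint g a)) +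
        r * (L s (branchPoint g b) - L s (branchPoint g a)) ≠ 0 := by
    intro r hr s a ha b hb hab
    have hEq : (∀ k ∈ Finset.Icc 1 (2 * g + 2), L s (branchPoint g k) = K s (branchPoint g k)) →
        (1 - r : ℂ) * (K s (branchPoint g b) - K s (branchPoint g a)) +
        r * (L s (branchPoint g b) - L s (branchPoint g a)) ≠ 0 := by
      intro h
      rw [h a ha, h b hb, ← add_mul, sub_add_cancel, one_mul]
      exact hinj s b a hab.ne'
    rcases le_or_gt s 0 with hs | hs
    · exact hEq fun k _ => by rw [hKneg s hs, hLneg s hs]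
    rcases le_or_gt 1 s with hs' | hs'
    · exact hEq (hend s hs')
    have hcast : (1 - r : ℂ) = ((1 - r : ℝ) : ℂ) := by push_cast; ring
    rcases step_directions h₁ h₂ h₃ h₄ h₅ hs hs' ha hb hab with ⟨hx, hy⟩ | ⟨hx, hy⟩
    · intro hcon
      have h1 := congrArg Complex.re hcon
      rw [hcast, Complex.add_re, Complex.re_ofReal_mul, Complex.re_ofReal_mul, Complex.zero_re] at h1
      have h2 := mul_nonneg (sub_nonneg.2 hr.2) hx.le
      have h3 := mul_nonneg hr.1 hy.le
      rcases hr.1.eq_or_lt with h0 | h0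
      · have h4 := mul_pos (by linarith : (0 : ℝ) < 1 - r) hx
        linarith
      · have h4 := mul_pos h0 hy
        linarith
    · rcases hr.1.eq_or_lt with h0 | h0
      · rw [← h0]
        simpa using hinj s b a hab.ne'
      · intro hcon
        have h1 := congrArg Complex.im hcon
        rw [hcast, Complex.add_im, Complex.im_ofReal_mul, Complex.im_ofReal_mul,
          Complex.zero_im] at h1
        have h2 := mul_nonneg (sub_nonneg.2 hr.2) hx
        have h3 := mul_pos h0 hy
        linarith
  have key := cl_eq_of_linear_homotopy (stepFamily_smooth h₁ h₂ h₃)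
    (pairFamily_smooth h₄ h₅ contDiff_ramp) (hKneg 0 le_rfl) (hLneg 0 le_rfl)
    (fun s k hk => stepFamily_affineNear h₁ h₂ h₃ s hk)
    (fun s k hk => pairFamily_affineNear h₄ h₅ contDiff_ramp s hk) (hend 1 le_rfl)
    (fun r hr s a ha b hb hab => by
      rcases lt_or_gt_of_ne hab with h | h
      · have h1 := hsep r hr s a ha b hb h
        intro hcon
        apply h1
        rw [← neg_eq_zero, ← hcon]
        ring
      · exact hsep r hr s b hb a ha h)
    (fun s => by
      rcases le_total s 0 with hs | hs
      · exact ⟨0, by simp, by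
          change K s = K 0 ∧ L s = L 0
          rw [hKneg s hs, hKneg 0 le_rfl, hLneg s hs, hLneg 0 le_rfl]; exact ⟨rfl, rfl⟩⟩
      rcases le_total s 1 with hs' | hs'
      · exact ⟨s, ⟨hs, hs'⟩, rfl, rfl⟩
      · exact ⟨1, by simp, by
          change K s = K 1 ∧ L s = L 1
          rw [hKone s hs', hKone 1 le_rfl, hLone s hs', hLone 1 le_rfl]; exact ⟨rfl, rfl⟩⟩)
    (h₃.diffeo * (h₁.diffeo * h₂.diffeo⁻¹)) (h₄.diffeo * h₅.diffeo⁻¹)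
    ((congrArg (fun f => blockTwist g j (j + 1) u₃ v₃ Real.pi * (blockTwist g i j u₁ v₁ Real.pi * f))
      (diskTwist_inv ..)).trans (hKone 1 le_rfl).symm)
    ((congrArg (fun f => blockTwist g i (j + 1) u₄ v₄ Real.pi * f)
      (diskTwist_inv ..)).trans (hLone 1 le_rfl).symm)
  rw [map_mul, map_mul, map_inv, map_mul, map_inv] at key
  exact key

end BlockStep

/-! ### Relations between half twists -/

/-- The smaller disc lies where the larger twist is the rigid half turn x ↦ 2c − x. This turn
commutes with multiplication by a rotation factor and takes discs about c' to discs about 2c − c'.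
The equality holds for the maps themselves, not only up to isotopy. -/
theorem diskTwist_conj {c c' : ℂ} {u v u' v' : ℝ} (huv : u < v) (huv' : u' < v')
    (h : ∀ x, ‖x - c'‖ ^ 2 < v' → ‖x - c‖ ^ 2 ≤ u) (θ : ℝ) :
    diskTwist c u v Real.pi * diskTwist c' u' v' θ =
      diskTwist (2 * c - c') u' v' θ * diskTwist c u v Real.pi := by
  refine Equiv.ext fun x => ?_
  change diskTwist c u v Real.pi (diskTwist c' u' v' θ x) =
    diskTwist (2 * c - c') u' v' θ (diskTwist c u v Real.pi x)
  by_cases hx : ‖x - c'‖ ^ 2 < v'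
  · have hx' : ‖diskTwist c' u' v' θ x - c'‖ ^ 2 < v' := by
      rwa [show diskTwist c' u' v' θ x = diskTwistFun c' u' v' θ x from rfl, norm_diskTwistFun]
    rw [diskTwist_pi_inner huv (h _ hx'), diskTwist_pi_inner huv (h _ hx)]
    change 2 * c - diskTwistFun c' u' v' θ x = diskTwistFun _ u' v' θ _
    rw [diskTwistFun, diskTwistFun, show 2 * c - x - (2 * c - c') = -(x - c') by ring, norm_neg]
    ring
  · rw [diskTwist_outer huv' θ (not_lt.1 hx), diskTwist_outer huv' θ]
    by_contra hcon
    apply hx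
    have h1 : ‖2 * c - diskTwist c u v Real.pi x - c'‖ ^ 2 < v' := by
      rw [← norm_neg]
      rw [show -(2 * c - diskTwist c u v Real.pi x - c') =
        diskTwist c u v Real.pi x - (2 * c - c') by ring]
      exact not_le.1 hcon
    have h2 := h _ h1
    rw [show 2 * c - diskTwist c u v Real.pi x - c = -(diskTwistFun c u v Real.pi x - c) by
      change _ = -(diskTwist c u v Real.pi x - c)
      ring, norm_neg, norm_diskTwistFun] at h2
    rw [diskTwist_pi_inner huv h2] at h1
    rwa [sub_sub_cancel] at h1

theorem diskTwist_comm {c c' : ℂ} {u v u' v' θ θ' : ℝ} (huv : u < v) (huv' : u' < v')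
    (h : ∀ x, v ≤ ‖x - c‖ ^ 2 ∨ v' ≤ ‖x - c'‖ ^ 2) :
    diskTwist c u v θ * diskTwist c' u' v' θ' = diskTwist c' u' v' θ' * diskTwist c u v θ := by
  refine Equiv.Perm.Disjoint.commute fun x => ?_
  rcases h x with hx | hx
  · exact Or.inl (diskTwist_outer huv _ hx)
  · exact Or.inr (diskTwist_outer huv' _ hx)

namespace IsBlock

variable {g i j k l : ℕ} {u v u' v' : ℝ}

/-- The half turn of p_i, …, p_j reverses the order of its points, so it takes a subblock to the
mirror subblock. Here r bounds the radius of the support of the smaller twist, and `hu` places that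
disc in the rigid part of the larger one. -/
theorem conj_cls (h : IsBlock g i j u v) (h' : IsBlock g k l u' v')
    (h'' : IsBlock g (i + j - l) (i + j - k) u' v') (hl : l ≤ i + j) {r : ℝ}
    (hr : 0 ≤ r) (hv : v' ≤ r ^ 2) (hu : (r + |(k : ℝ) + l - i - j|) ^ 2 ≤ u) :
    h.cls * h'.cls = h''.cls * h.cls := by
  have hk : k ≤ i + j := h'.le.trans hl
  have e : ((blockCenter g (i + j - l) (i + j - k) : ℝ) : ℂ) =
      2 * blockCenter g i j - blockCenter g k l := by
    have e1 : ((i + j - k : ℕ) : ℝ) = i + j - k := by rw [Nat.cast_sub hk]; push_cast; ring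
    have e2 : ((i + j - l : ℕ) : ℝ) = i + j - l := by rw [Nat.cast_sub hl]; push_cast; ring
    rw [blockCenter, e1, e2, blockCenter, blockCenter]
    push_cast
    ring
  have key : h.diffeo * h'.diffeo = h''.diffeo * h.diffeo := by
    refine Subtype.ext ?_
    change blockTwist g i j u v Real.pi * blockTwist g k l u' v' Real.pi =
      blockTwist g _ _ u' v' Real.pi * blockTwist g i j u v Real.pi
    rw [blockTwist, blockTwist, blockTwist, e]
    refine diskTwist_conj h.lt h'.lt (fun x hx => ?_) _
    have h1 : ‖x - blockCenter g k l‖ ≤ r := (lt_of_pow_lt_pow_left₀ 2 hr (by linarith)).le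
    have h2 : ‖(blockCenter g k l : ℂ) - blockCenter g i j‖ = |(k : ℝ) + l - i - j| := by
      rw [← Complex.ofReal_sub, Complex.norm_real, Real.norm_eq_abs, blockCenter, blockCenter]
      congr 1
      ring
    have h3 := norm_add_le (x - blockCenter g k l) ((blockCenter g k l : ℂ) - blockCenter g i j)
    rw [sub_add_sub_cancel] at h3
    exact (pow_le_pow_left₀ (norm_nonneg _) (by linarith) 2).trans hu
  have h1 := congrArg BaseDiffeo.cl key
  rwa [map_mul, map_mul] at h1

theorem commute_cls (h : IsBlock g i j u v) (h' : IsBlock g k l u' v') {r r' : ℝ}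
    (hr : 0 ≤ r) (hr' : 0 ≤ r') (hv : v ≤ r ^ 2) (hv' : v' ≤ r' ^ 2)
    (hd : r + r' ≤ |(k : ℝ) + l - i - j|) : h.cls * h'.cls = h'.cls * h.cls := by
  have key : h.diffeo * h'.diffeo = h'.diffeo * h.diffeo := by
    refine Subtype.ext (diskTwist_comm h.lt h'.lt fun x => ?_)
    by_contra! hcon
    have h1 : ‖x - blockCenter g k l‖ < r' := lt_of_pow_lt_pow_left₀ 2 hr' (by linarith)
    have h0 : ‖x - blockCenter g i j‖ < r := lt_of_pow_lt_pow_left₀ 2 hr (by linarith)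
    have h2 : ‖(blockCenter g k l : ℂ) - blockCenter g i j‖ = |(k : ℝ) + l - i - j| := by
      rw [← Complex.ofReal_sub, Complex.norm_real, Real.norm_eq_abs, blockCenter, blockCenter]
      congr 1
      ring
    have h3 := norm_sub_le (x - blockCenter g i j) (x - blockCenter g k l)
    rw [sub_sub_sub_cancel_left] at h3
    linarith
  have h1 := congrArg BaseDiffeo.cl key
  rwa [map_mul, map_mul] at h1

end IsBlock

/-- The points of the block are at distance at most j − i from its centre, the others at least j − i
+ 2. The freedom in a and b allows nested blocks to be given nested discs, and `IsBlock.cls_eq`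
shows that the class does not depend on the choice. -/
theorem isBlock_standard {g i j : ℕ} (hi : 1 ≤ i) (hij : i ≤ j) (hj : j ≤ 2 * g + 2) {a b : ℝ}
    (ha : 0 < a) (hab : a < b) (hb : b ≤ 1) :
    IsBlock g i j ((j - i + a) ^ 2) ((j - i + b) ^ 2) := by
  have h1 : (1 : ℝ) ≤ i := by exact_mod_cast hi
  have h2 : (i : ℝ) ≤ j := by exact_mod_cast hij
  have h3 : (j : ℝ) ≤ 2 * g + 2 := by exact_mod_cast hj
  refine ⟨hi, hij, hj, ?_, ?_, fun k _ hk => ?_, fun x hx => ?_⟩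
  · exact pow_lt_pow_left₀ (by linarith) (by linarith) two_ne_zero
  · exact pow_lt_pow_left₀ (by linarith) (by linarith) two_ne_zero
  · rw [← sq_abs (2 * k - i - j : ℝ)]
    refine pow_lt_pow_left₀ ?_ (by linarith) two_ne_zero
    rcases hk with hk | hk
    · have : (k : ℝ) + 1 ≤ i := by exact_mod_cast hk
      rw [lt_abs]
      right
      linarith
    · have : (j : ℝ) + 1 ≤ k := by exact_mod_cast hk
      rw [lt_abs]
      left
      linarith
  · refine pow_le_pow_left₀ (by linarith) ?_ 2
    have h4 : ‖(blockCenter g i j : ℂ)‖ ≤ 2 * g + 1 := by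
      rw [Complex.norm_real, Real.norm_eq_abs, blockCenter, abs_le]
      constructor <;> linarith
    have h5 := norm_sub_norm_le x (blockCenter g i j)
    have h6 : (0 : ℝ) ≤ g := Nat.cast_nonneg g
    rw [innerRadius] at hx
    linarith

/-- The constants 5/4 and 3/2 are those of the cutoff in `ellAngle`, so that the elliptic half twist
degenerates exactly to this disc twist when its foci coincide. -/
theorem isBlock_pair {g k : ℕ} (hk : 1 ≤ k) (hk' : k + 1 ≤ 2 * g + 2) :
    IsBlock g k (k + 1) (5 / 4) (3 / 2) := by
  have h := isBlock_standard hk (Nat.le_succ k) hk' (a := 1 / 4) (b := 1 / 2) (by norm_num)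
    (by norm_num) (by norm_num)
  have e : (((k.succ : ℕ) : ℝ) - k) = 1 := by push_cast; ring
  refine ⟨hk, Nat.le_succ k, hk', by norm_num, by push_cast; norm_num, fun l hl hlk => ?_,
    fun x hx => ?_⟩
  · refine lt_trans ?_ (h.outer l hl hlk)
    rw [e]
    norm_num
  · refine le_trans ?_ (h.support x hx)
    rw [e]
    norm_num

/-- The half twist exchanging `p_k` and `p_{k+1}`. -/
def halfTwist (g k : ℕ) : Gamma g :=
  if h : 1 ≤ k ∧ k + 1 ≤ 2 * g + 2 then (isBlock_pair h.1 h.2).cls else 1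

theorem halfTwist_eq {g k : ℕ} {u v : ℝ} (h : IsBlock g k (k + 1) u v) :
    halfTwist g k = h.cls := by
  rw [halfTwist, dif_pos ⟨h.one_le, h.le_max⟩]
  exact IsBlock.cls_eq _ _

/-- The half twist reversing the order of `p_i, …, p_j`. -/
def blockClass (g i j : ℕ) : Gamma g :=
  if h : 1 ≤ i ∧ i ≤ j ∧ j ≤ 2 * g + 2 then
    (isBlock_standard h.1 h.2.1 h.2.2 one_half_pos one_half_lt_one le_rfl).cls else 1

theorem blockClass_eq {g i j : ℕ} {u v : ℝ} (h : IsBlock g i j u v) :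
    blockClass g i j = h.cls := by
  rw [blockClass, dif_pos ⟨h.one_le, h.le, h.le_max⟩]
  exact IsBlock.cls_eq _ _

theorem halfTwist_comm {g k l : ℕ} (hk : 1 ≤ k) (hkl : k + 2 ≤ l) (hl : l + 1 ≤ 2 * g + 2) :
    halfTwist g k * halfTwist g l = halfTwist g l * halfTwist g k := by
  have h := isBlock_pair (g := g) hk (by omega)
  have h' := isBlock_pair (g := g) (k := l) (by omega) hl
  rw [halfTwist_eq h, halfTwist_eq h']
  have h1 : (k : ℝ) + 2 ≤ l := by exact_mod_cast hkl
  refine h.commute_cls h' (r := 3 / 2) (r' := 3 / 2) (by norm_num) (by norm_num) (by norm_num)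
    (by norm_num) (le_abs.2 (Or.inl ?_))
  push_cast
  linarith

theorem blockClass_single {g i : ℕ} (hi : 1 ≤ i) (hi' : i ≤ 2 * g + 2) : blockClass g i i = 1 := by
  have h := isBlock_standard hi le_rfl hi' one_half_pos one_half_lt_one le_rfl
  rw [blockClass_eq h, h.cls_single]

theorem blockClass_pair {g k : ℕ} (hk : 1 ≤ k) (hk' : k + 1 ≤ 2 * g + 2) :
    blockClass g k (k + 1) = halfTwist g k := by
  rw [blockClass_eq (isBlock_pair hk hk'), halfTwist_eq (isBlock_pair hk hk')]

theorem blockClass_step {g i j : ℕ} (hi : 1 ≤ i) (hij : i < j) (hj : j + 1 ≤ 2 * g + 2) :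
    halfTwist g j * (blockClass g i j * (blockClass g (i + 1) j)⁻¹) =
      blockClass g i (j + 1) * (blockClass g (i + 1) (j + 1))⁻¹ := by
  have hs : ∀ {i j : ℕ}, 1 ≤ i → i ≤ j → j ≤ 2 * g + 2 →
      IsBlock g i j ((j - i + 1 / 2) ^ 2) ((j - i + 1) ^ 2) := fun h1 h2 h3 =>
    isBlock_standard h1 h2 h3 one_half_pos one_half_lt_one le_rfl
  have h₁ := hs hi hij.le (by omega)
  have h₂ := hs (i := i + 1) (j := j) (by omega) hij (by omega)
  have h₄ := hs (i := i) (j := j + 1) hi (by omega) hj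
  have h₅ := hs (i := i + 1) (j := j + 1) (by omega) (by omega) hj
  have h₃ := isBlock_pair (g := g) (k := j) (by omega) hj
  rw [blockClass_eq h₁, blockClass_eq h₂, blockClass_eq h₄, blockClass_eq h₅, halfTwist_eq h₃]
  exact block_step h₁ h₂ h₃ h₄ h₅

theorem blockClass_conj_halfTwist {g i j k : ℕ} (hi : 1 ≤ i) (hj : j ≤ 2 * g + 2) (hik : i ≤ k)
    (hkj : k + 1 ≤ j) :
    blockClass g i j * halfTwist g k = halfTwist g (i + j - (k + 1)) * blockClass g i j := by
  have h := isBlock_standard hi (by omega : i ≤ j) hj one_half_pos one_half_lt_one le_rfl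
  have h' := isBlock_pair (g := g) (k := k) (by omega) (by omega)
  have h'' := isBlock_pair (g := g) (k := i + j - (k + 1)) (by omega) (by omega)
  have e : i + j - (k + 1) + 1 = i + j - k := by omega
  rw [blockClass_eq h, halfTwist_eq h', halfTwist_eq h'']
  have h1 : (i : ℝ) ≤ k := by exact_mod_cast hik
  have h2 : (k : ℝ) + 1 ≤ j := by exact_mod_cast hkj
  have key : ∀ (m : ℕ) (hm : IsBlock g (i + j - (k + 1)) m (5 / 4) (3 / 2)), m = i + j - k →
      h.cls * h'.cls = hm.cls * h.cls := by
    intro m hm e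
    subst e
    -- 49/40 is slightly above √(3/2), the outer radius for a pair. The centre of the pair is at
    -- most j − i − 1 from that of the block, and 49/40 ≤ 3/2 keeps the disc within the rigid radius
    -- j − i + 1/2.
    refine h.conj_cls h' hm (by omega) (r := 49 / 40) (by norm_num) (by norm_num) ?_
    refine pow_le_pow_left₀ (by positivity) ?_ 2
    have : |(k : ℝ) + (k + 1 : ℕ) - i - j| ≤ j - i - 1 := by
      push_cast
      rw [abs_le]
      constructor <;> linarith
    linarith
  exact key _ h'' e

theorem blockClass_conj_tail {g j : ℕ} (hj : 2 ≤ j) (hj' : j ≤ 2 * g + 2) :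
    blockClass g 1 j * blockClass g 2 j = blockClass g 1 (j - 1) * blockClass g 1 j := by
  -- The disc of p_2, …, p_j has outer radius j − 2 + 3/5 and its centre is shifted by 1, so it fits
  -- into the rigid disc of radius j − 1 + 4/5 of p_1, …, p_j.
  have h := isBlock_standard le_rfl (by omega : 1 ≤ j) hj' (a := 4 / 5) (b := 1) (by norm_num)
    (by norm_num) le_rfl
  have h' := isBlock_standard (i := 2) (by omega) hj hj' (a := 1 / 2) (b := 3 / 5) (by norm_num)
    (by norm_num) (by norm_num)
  have h'' := isBlock_standard (g := g) (i := 1) (j := j - 1) le_rfl (by omega) (by omega)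
    (a := 1 / 2) (b := 3 / 5) (by norm_num) (by norm_num) (by norm_num)
  rw [blockClass_eq h, blockClass_eq h', blockClass_eq h'']
  have h2 : (2 : ℝ) ≤ j := by exact_mod_cast hj
  have e : ((j - 1 : ℕ) : ℝ) = j - 1 := by rw [Nat.cast_sub (by omega)]; push_cast; ring
  have key : ∀ (i m : ℕ) (w w' : ℝ) (hm : IsBlock g i m w w'), i = 1 + j - j → m = 1 + j - 2 →
      w = ((j : ℝ) - (2 : ℕ) + 1 / 2) ^ 2 → w' = ((j : ℝ) - (2 : ℕ) + 3 / 5) ^ 2 →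
      h.cls * h'.cls = hm.cls * h.cls := by
    intro i m w w' hm e1 e2 e3 e4
    subst e1 e2 e3 e4
    refine h.conj_cls h' hm (by omega) (r := j - 2 + 3 / 5) (by linarith) (by push_cast; exact le_rfl)
      ?_
    have : |((2 : ℕ) : ℝ) + j - (1 : ℕ) - j| = 1 := by
      push_cast
      rw [abs_of_nonneg] <;> linarith
    rw [this]
    refine pow_le_pow_left₀ (by linarith) ?_ 2
    push_cast
    linarith
  exact key _ _ _ _ h'' (by omega) (by omega) (by rw [e]; push_cast; ring)
    (by rw [e]; push_cast; ring)

/-- Let Δ be the half turn of the three points. The step relation reads Δ = σ_{k+1} σ_k σ_{k+1}, and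
mirror symmetry gives Δ σ_k = σ_{k+1} Δ. Cancelling σ_{k+1} on the left leaves the braid relation.
-/
theorem halfTwist_braid {g k : ℕ} (hk : 1 ≤ k) (hk' : k + 2 ≤ 2 * g + 2) :
    halfTwist g k * halfTwist g (k + 1) * halfTwist g k =
      halfTwist g (k + 1) * halfTwist g k * halfTwist g (k + 1) := by
  have h1 := blockClass_step (j := k + 1) hk (Nat.lt_succ_self k) hk'
  rw [blockClass_single (by omega) (by omega), inv_one, mul_one, blockClass_pair hk (by omega),
    blockClass_pair (by omega) hk', eq_mul_inv_iff_mul_eq] at h1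
  have h2 := blockClass_conj_halfTwist (j := k + 2) hk hk' le_rfl (Nat.le_succ _)
  rw [show k + (k + 2) - (k + 1) = k + 1 by omega] at h2
  change _ = blockClass g k (k + 2) at h1
  rw [← h1] at h2
  simp only [mul_assoc] at h2 ⊢
  exact mul_left_cancel h2

/-! ### Positive braid words -/

section BraidWords

variable {M : Type*} [Monoid M]

/-- The first `N` braid relations between `σ 1, …, σ N`. -/
structure IsBraid (σ : ℕ → M) (N : ℕ) : Prop where
  comm : ∀ i j, 1 ≤ i → i + 2 ≤ j → j ≤ N → σ i * σ j = σ j * σ i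
  braid : ∀ i, 1 ≤ i → i + 1 ≤ N → σ i * σ (i + 1) * σ i = σ (i + 1) * σ i * σ (i + 1)

/-- The product `σ_a σ_{a+1} ⋯ σ_b`. -/
def ascProd (σ : ℕ → M) (a b : ℕ) : M := ((List.Ico a (b + 1)).map σ).prod

/-- The product `σ_b ⋯ σ_{a+1} σ_a`. -/
def descProd (σ : ℕ → M) (a b : ℕ) : M := ((List.Ico a (b + 1)).map σ).reverse.prod

variable (σ : ℕ → M)

theorem ascProd_of_lt {a b : ℕ} (h : b < a) : ascProd σ a b = 1 := by
  rw [ascProd, List.Ico.eq_nil_of_le (by omega)]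
  rfl

theorem descProd_of_lt {a b : ℕ} (h : b < a) : descProd σ a b = 1 := by
  rw [descProd, List.Ico.eq_nil_of_le (by omega)]
  rfl

theorem ascProd_succ {a b : ℕ} (h : a ≤ b + 1) :
    ascProd σ a (b + 1) = ascProd σ a b * σ (b + 1) := by
  rw [ascProd, List.Ico.succ_top h, List.map_append, List.prod_append, ascProd]
  simp

theorem descProd_succ {a b : ℕ} (h : a ≤ b + 1) :
    descProd σ a (b + 1) = σ (b + 1) * descProd σ a b := by
  rw [descProd, List.Ico.succ_top h, List.map_append, List.reverse_append, List.prod_append,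
    descProd]
  simp

theorem ascProd_self (a : ℕ) : ascProd σ a a = σ a := by
  rw [ascProd, List.Ico.succ_singleton]
  simp

theorem descProd_self (a : ℕ) : descProd σ a a = σ a := by
  rw [descProd, List.Ico.succ_singleton]
  simp

theorem ascProd_mul {a b c : ℕ} (hab : a ≤ b + 1) (hbc : b ≤ c) :
    ascProd σ a b * ascProd σ (b + 1) c = ascProd σ a c := by
  rw [ascProd, ascProd, ascProd, ← List.prod_append, ← List.map_append,
    List.Ico.append_consecutive hab (by omega)]

theorem descProd_mul {a b c : ℕ} (hab : a ≤ b + 1) (hbc : b ≤ c) :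
    descProd σ (b + 1) c * descProd σ a b = descProd σ a c := by
  rw [descProd, descProd, descProd, ← List.prod_append, ← List.reverse_append, ← List.map_append,
    List.Ico.append_consecutive hab (by omega)]

theorem ascProd_cons {a c : ℕ} (h : a ≤ c) : ascProd σ a c = σ a * ascProd σ (a + 1) c := by
  rw [← ascProd_mul σ (Nat.le_succ a) h, ascProd_self]

theorem descProd_concat {a c : ℕ} (h : a ≤ c) : descProd σ a c = descProd σ (a + 1) c * σ a := by
  rw [← descProd_mul σ (Nat.le_succ a) h, descProd_self]

variable {σ}

theorem commute_ascProd {a b : ℕ} {x : M} (h : ∀ k, a ≤ k → k ≤ b → Commute x (σ k)) :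
    Commute x (ascProd σ a b) := by
  refine Commute.list_prod_right _ _ fun y hy => ?_
  obtain ⟨k, hk, rfl⟩ := List.mem_map.1 hy
  rw [List.Ico.mem] at hk
  exact h k hk.1 (by omega)

theorem commute_descProd {a b : ℕ} {x : M} (h : ∀ k, a ≤ k → k ≤ b → Commute x (σ k)) :
    Commute x (descProd σ a b) := by
  refine Commute.list_prod_right _ _ fun y hy => ?_
  obtain ⟨k, hk, rfl⟩ := List.mem_map.1 (List.mem_reverse.1 hy)
  rw [List.Ico.mem] at hk
  exact h k hk.1 (by omega)

namespace IsBraid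

variable {N : ℕ}

theorem commute (h : IsBraid σ N) {i j : ℕ} (hi : 1 ≤ i) (hj : 1 ≤ j) (hi' : i ≤ N) (hj' : j ≤ N)
    (hij : i + 2 ≤ j ∨ j + 2 ≤ i) : Commute (σ i) (σ j) := by
  rcases hij with hij | hij
  · exact h.comm i j hi hij hj'
  · exact (h.comm j i hj hij hi').symm

/-- `σ_a ⋯ σ_b` carries `σ_i` to `σ_{i+1}`. -/
theorem ascProd_mul_gen (h : IsBraid σ N) {a b i : ℕ} (ha : 1 ≤ a) (hb : b ≤ N) (hai : a ≤ i)
    (hib : i < b) : ascProd σ a b * σ i = σ (i + 1) * ascProd σ a b := by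
  obtain ⟨i, rfl⟩ : ∃ j, i = j + 1 := ⟨i - 1, by omega⟩
  have h1 : Commute (σ (i + 1)) (ascProd σ (i + 2 + 1) b) := commute_ascProd fun k hk hk' =>
    h.commute (by omega) (by omega) (by omega) (by omega) (Or.inl (by omega))
  have h2 : Commute (σ (i + 2)) (ascProd σ a i) := commute_ascProd fun k hk hk' =>
    h.commute (by omega) (by omega) (by omega) (by omega) (Or.inr (by omega))
  have h3 := h.braid (i + 1) (by omega) (by omega)
  rw [← ascProd_mul σ (by omega : a ≤ i + 2 + 1) (by omega : i + 2 ≤ b), mul_assoc, ← h1.eq,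
    ← mul_assoc, ← mul_assoc, ascProd_succ σ (by omega : a ≤ i + 1 + 1),
    ascProd_succ σ (by omega : a ≤ i + 1)]
  congr 1
  calc ascProd σ a i * σ (i + 1) * σ (i + 1 + 1) * σ (i + 1)
      = ascProd σ a i * (σ (i + 1) * σ (i + 1 + 1) * σ (i + 1)) := by simp only [mul_assoc]
    _ = (ascProd σ a i * σ (i + 2)) * (σ (i + 1) * σ (i + 1 + 1)) := by
      rw [h3]; simp only [mul_assoc]
    _ = _ := by rw [← h2.eq]; simp only [mul_assoc]

/-- `σ_b ⋯ σ_a` carries `σ_{i+1}` to `σ_i`. -/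
theorem descProd_mul_gen (h : IsBraid σ N) {a b i : ℕ} (ha : 1 ≤ a) (hb : b ≤ N) (hai : a ≤ i)
    (hib : i < b) : descProd σ a b * σ (i + 1) = σ i * descProd σ a b := by
  obtain ⟨i, rfl⟩ : ∃ j, i = j + 1 := ⟨i - 1, by omega⟩
  have h1 : Commute (σ (i + 1)) (descProd σ (i + 2 + 1) b) := commute_descProd fun k hk hk' =>
    h.commute (by omega) (by omega) (by omega) (by omega) (Or.inl (by omega))
  have h2 : Commute (σ (i + 2)) (descProd σ a i) := commute_descProd fun k hk hk' =>
    h.commute (by omega) (by omega) (by omega) (by omega) (Or.inr (by omega))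
  have h3 := h.braid (i + 1) (by omega) (by omega)
  rw [← descProd_mul σ (by omega : a ≤ i + 2 + 1) (by omega : i + 2 ≤ b), ← mul_assoc, h1.eq,
    mul_assoc, mul_assoc, descProd_succ σ (by omega : a ≤ i + 1 + 1),
    descProd_succ σ (by omega : a ≤ i + 1)]
  congr 1
  calc σ (i + 1 + 1) * (σ (i + 1) * descProd σ a i) * σ (i + 1 + 1)
      = σ (i + 1 + 1) * σ (i + 1) * (descProd σ a i * σ (i + 2)) := by simp only [mul_assoc]
    _ = σ (i + 1 + 1) * σ (i + 1) * σ (i + 1 + 1) * descProd σ a i := by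
      rw [← h2.eq]; simp only [mul_assoc]
    _ = _ := by rw [← h3]; simp only [mul_assoc]

theorem ascProd_mul_ascProd (h : IsBraid σ N) {a b c d : ℕ} (ha : 1 ≤ a) (hb : b ≤ N) (hac : a ≤ c)
    (hdb : d < b) : ascProd σ a b * ascProd σ c d = ascProd σ (c + 1) (d + 1) * ascProd σ a b := by
  rcases Nat.lt_or_ge d c with hdc | hdc
  · rw [ascProd_of_lt σ hdc, ascProd_of_lt σ (by omega : d + 1 < c + 1), mul_one, one_mul]
  induction d, hdc using Nat.le_induction with
  | base => rw [ascProd_self, ascProd_self, h.ascProd_mul_gen ha hb hac hdb]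
  | succ d hd ih =>
    rw [ascProd_succ σ (by omega), ascProd_succ σ (by omega : c + 1 ≤ d + 1 + 1), ← mul_assoc,
      ih (by omega), mul_assoc, h.ascProd_mul_gen ha hb (by omega) hdb, mul_assoc]

theorem descProd_mul_ascProd (h : IsBraid σ N) {a b c d : ℕ} (ha : 1 ≤ a) (hb : b ≤ N)
    (hac : a ≤ c) (hdb : d < b) :
    descProd σ a b * ascProd σ (c + 1) (d + 1) = ascProd σ c d * descProd σ a b := by
  rcases Nat.lt_or_ge d c with hdc | hdc
  · rw [ascProd_of_lt σ hdc, ascProd_of_lt σ (by omega : d + 1 < c + 1), mul_one, one_mul]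
  induction d, hdc using Nat.le_induction with
  | base => rw [ascProd_self, ascProd_self, h.descProd_mul_gen ha hb hac hdb]
  | succ d hd ih =>
    rw [ascProd_succ σ (by omega : c ≤ d + 1), ascProd_succ σ (by omega : c + 1 ≤ d + 1 + 1),
      ← mul_assoc, ih (by omega), mul_assoc, h.descProd_mul_gen ha hb (by omega) hdb, mul_assoc]

/-- `σ_j ⋯ σ_1 σ_1 ⋯ σ_j` commutes with `σ_i` for `i < j`. -/
theorem commute_desc_asc (h : IsBraid σ N) {i j : ℕ} (hj : j ≤ N) (hi : 1 ≤ i) (hij : i < j) :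
    Commute (σ i) (descProd σ 1 j * ascProd σ 1 j) := by
  have h1 := h.ascProd_mul_gen le_rfl hj hi hij
  have h2 := h.descProd_mul_gen le_rfl hj hi hij
  rw [Commute, SemiconjBy, mul_assoc, h1, ← mul_assoc, ← mul_assoc, h2]

/-- Multiplication by one more σ_1 ⋯ σ_{j+1} on the right: the descending product passes through it
with all indices lowered by one, and the last letter σ_{j+1} = σ_1 ⋯ σ_j \ σ_1 ⋯ σ_{j+1} that is
split off goes to the head of the descending product, making it longer by one. -/
theorem ascProd_pow_split (h : IsBraid σ N) {j : ℕ} (hj : j + 1 ≤ N) {k : ℕ} (hk : k ≤ j + 1) :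
    ascProd σ 1 (j + 1) ^ k = ascProd σ 1 j ^ k * descProd σ (j + 2 - k) (j + 1) := by
  induction k with
  | zero => rw [pow_zero, pow_zero, descProd_of_lt σ (by omega), one_mul]
  | succ k ih =>
    have key : ∀ l, 2 ≤ l → l ≤ j + 2 →
        descProd σ l (j + 1) * ascProd σ 1 (j + 1) = ascProd σ 1 (j + 1) * descProd σ (l - 1) j := by
      intro l hl hl'
      obtain ⟨d, rfl⟩ : ∃ d, l = j + 2 - d := ⟨j + 2 - l, by omega⟩
      clear hl'
      induction d with
      | zero => rw [descProd_of_lt σ (by omega), descProd_of_lt σ (by omega), one_mul, mul_one]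
      | succ d ihd =>
        rw [descProd_concat σ (by omega), descProd_concat σ (by omega : j + 2 - (d + 1) - 1 ≤ j)]
        have h1 := h.ascProd_mul_gen (a := 1) (b := j + 1) (i := j + 2 - (d + 1) - 1) le_rfl hj
          (by omega) (by omega)
        rw [show j + 2 - (d + 1) - 1 + 1 = j + 2 - (d + 1) by omega] at h1 ⊢
        rw [mul_assoc, ← h1, ← mul_assoc, show j + 2 - (d + 1) + 1 = j + 2 - d by omega,
          ihd (by omega), mul_assoc, show j + 2 - d - 1 = j + 2 - (d + 1) by omega]
    rw [pow_succ, ih (by omega), mul_assoc, key _ (by omega) (by omega), ascProd_succ σ (by omega),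
      mul_assoc, ← descProd_succ σ (by omega), ← mul_assoc, ← pow_succ,
      show j + 2 - k - 1 = j + 2 - (k + 1) by omega]

theorem ascProd_pow_self (h : IsBraid σ N) {j : ℕ} (hj : j + 1 ≤ N) :
    ascProd σ 1 (j + 1) ^ (j + 1) = ascProd σ 1 j ^ (j + 1) * descProd σ 1 (j + 1) := by
  rw [h.ascProd_pow_split hj le_rfl, show j + 2 - (j + 1) = 1 by omega]

/-- The chain word on `j + 1` letters in terms of the one on `j` letters. -/
theorem ascProd_pow_succ (h : IsBraid σ N) {j : ℕ} (hj : j + 1 ≤ N) :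
    ascProd σ 1 (j + 1) ^ (j + 2) =
      ascProd σ 1 j ^ (j + 1) * descProd σ 1 (j + 1) * ascProd σ 1 (j + 1) := by
  rw [pow_succ, h.ascProd_pow_self hj]

/-- `(σ_1 ⋯ σ_j)^{j+1}` is central. -/
theorem commute_ascProd_pow (h : IsBraid σ N) {i j : ℕ} (hj : j ≤ N) (hi : 1 ≤ i) (hij : i ≤ j) :
    Commute (σ i) (ascProd σ 1 j ^ (j + 1)) := by
  set x := ascProd σ 1 j with hx
  -- Passing through x = σ_1 ⋯ σ_j raises an index by one, and passing through x² takes σ_j to σ_1.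
  -- Starting from σ_i, the j − i raises, the wrap through x² and the i − 1 raises use up x^{j+1}
  -- and end at σ_i again.
  have hstep : ∀ d i, 1 ≤ i → i + d ≤ j → x ^ d * σ i = σ (i + d) * x ^ d := by
    intro d
    induction d with
    | zero => intro i _ _; simp
    | succ d ih =>
      intro i h1 h2
      rw [pow_succ, mul_assoc, h.ascProd_mul_gen le_rfl hj h1 (by omega), ← mul_assoc,
        ih (i + 1) (by omega) (by omega), mul_assoc, add_right_comm, add_assoc]
  have hwrap : x ^ 2 * σ j = σ 1 * x ^ 2 := by
    obtain ⟨j, rfl⟩ : ∃ k, j = k + 1 := ⟨j - 1, by omega⟩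
    have h1 := h.ascProd_mul_ascProd (a := 1) (b := j + 1) (c := 1) (d := j) le_rfl hj le_rfl
      (Nat.lt_succ_self j)
    have h2 : x ^ 2 = ascProd σ 2 (j + 1) * x * σ (j + 1) := by
      rw [← h1, sq, mul_assoc, ← ascProd_succ σ (by omega)]
    calc x ^ 2 * σ (j + 1) = x * (x * σ (j + 1)) := by rw [sq, mul_assoc]
      _ = σ 1 * ascProd σ 2 (j + 1) * (x * σ (j + 1)) := by rw [← ascProd_cons σ (by omega)]
      _ = _ := by rw [h2]; simp only [mul_assoc]
  have e1 := hstep (j - i) i hi (by omega)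
  have e2 := hstep (i - 1) 1 le_rfl (by omega)
  rw [show i + (j - i) = j by omega] at e1
  rw [show 1 + (i - 1) = i by omega] at e2
  have e3 : x ^ (j + 1) = x ^ (i - 1) * (x ^ 2 * x ^ (j - i)) := by
    rw [← pow_add, ← pow_add]
    congr 1
    omega
  rw [Commute, SemiconjBy, e3]
  calc σ i * (x ^ (i - 1) * (x ^ 2 * x ^ (j - i)))
      = (σ i * x ^ (i - 1)) * (x ^ 2 * x ^ (j - i)) := by simp only [mul_assoc]
    _ = x ^ (i - 1) * (σ 1 * x ^ 2) * x ^ (j - i) := by rw [← e2]; simp only [mul_assoc]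
    _ = x ^ (i - 1) * x ^ 2 * (σ j * x ^ (j - i)) := by rw [← hwrap]; simp only [mul_assoc]
    _ = _ := by rw [← e1]; simp only [mul_assoc]

end IsBraid

/-! ### Passing four strands across m strands -/

/-- The product `(σ_{s+m} ⋯ σ_{s+m+3}) ⋯ (σ_{s+1} ⋯ σ_{s+4})`. -/
def ascBlocks (σ : ℕ → M) (s : ℕ) : ℕ → M
  | 0 => 1
  | m + 1 => ascProd σ (s + m + 1) (s + m + 4) * ascBlocks σ s m

/-- The product `(σ_4 ⋯ σ_1) ⋯ (σ_{m+3} ⋯ σ_m)`. -/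
def descBlocks (σ : ℕ → M) : ℕ → M
  | 0 => 1
  | m + 1 => descBlocks σ m * descProd σ (m + 1) (m + 4)

theorem ascBlocks_succ' (s m : ℕ) :
    ascBlocks σ s (m + 1) = ascBlocks σ (s + 1) m * ascProd σ (s + 1) (s + 4) := by
  induction m with
  | zero => simp [ascBlocks]
  | succ m ih =>
    rw [ascBlocks, ih, ← mul_assoc, ascBlocks, show s + (m + 1) + 1 = s + 1 + m + 1 by omega,
      show s + (m + 1) + 4 = s + 1 + m + 4 by omega]

namespace IsBraid

variable {N : ℕ}

theorem descProd_mul_ascBlocks (h : IsBraid σ N) {b m : ℕ} (hb : b ≤ N) (hm : m + 4 ≤ b) :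
    descProd σ 1 b * ascBlocks σ 1 m = ascBlocks σ 0 m * descProd σ 1 b := by
  induction m with
  | zero => simp [ascBlocks]
  | succ m ih =>
    have h1 := h.descProd_mul_ascProd (a := 1) (b := b) (c := m + 1) (d := m + 4) le_rfl hb
      (by omega) (by omega)
    rw [ascBlocks, ascBlocks, ← mul_assoc, show 1 + m + 1 = m + 1 + 1 by omega,
      show 1 + m + 4 = m + 4 + 1 by omega, h1, mul_assoc, ih (by omega), zero_add, mul_assoc]

theorem commute_ascBlocks (h : IsBraid σ N) {i m : ℕ} (hm : m + 5 ≤ i) (hi : i ≤ N) :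
    Commute (σ i) (ascBlocks σ 0 m) := by
  induction m with
  | zero => exact Commute.one_right _
  | succ m ih =>
    exact (commute_ascProd fun k hk hk' => h.commute (by omega) (by omega) (by omega) (by omega)
      (Or.inr (by omega))).mul_right (ih (by omega))

/-- As a braid, `ascBlocks σ 0 m` interchanges a group of four adjacent strands with a group of m.
The generators within the group of m are renumbered by 4; `gen_mul_ascBlocks` is the counterpart for
the group of four. -/
theorem ascBlocks_mul_gen (h : IsBraid σ N) {j m : ℕ} (hm : m + 3 ≤ N) (hj : 1 ≤ j)
    (hjm : j + 1 ≤ m) : ascBlocks σ 0 m * σ (j + 4) = σ j * ascBlocks σ 0 m := by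
  induction m with
  | zero => omega
  | succ m ih =>
    rw [ascBlocks, zero_add]
    rcases Nat.lt_or_ge j m with hlt | hge
    · have h1 : Commute (σ j) (ascProd σ (m + 1) (m + 4)) := commute_ascProd fun k hk hk' =>
        h.commute (by omega) (by omega) (by omega) (by omega) (Or.inl (by omega))
      rw [mul_assoc, ih (by omega) hlt, ← mul_assoc, ← h1.eq, mul_assoc]
    · obtain rfl : m = j := by omega
      obtain ⟨m, rfl⟩ : ∃ k, m = k + 1 := ⟨m - 1, by omega⟩
      have h1 := h.commute_ascBlocks (i := m + 1 + 4) (m := m) (by omega) (by omega)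
      have h2 := h.ascProd_mul_ascProd (a := m + 1) (b := m + 5) (c := m + 1) (d := m + 4)
        (by omega) (by omega) le_rfl (by omega)
      rw [ascBlocks, zero_add, mul_assoc, mul_assoc, ← h1.eq, ← mul_assoc (ascProd σ (m + 1) _),
        ← ascProd_succ σ (by omega), ← mul_assoc, ← mul_assoc, ← mul_assoc,
        ← ascProd_cons σ (by omega)]
      exact congrArg (· * ascBlocks σ 0 m) h2.symm

theorem ascBlocks_mul_asc_pow (h : IsBraid σ N) {b m : ℕ} (hm : m + 3 ≤ N)
    (hb : b + 1 ≤ m) (k : ℕ) :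
    ascBlocks σ 0 m * ascProd σ 5 (b + 4) ^ k = ascProd σ 1 b ^ k * ascBlocks σ 0 m := by
  have h1 : ascBlocks σ 0 m * ascProd σ 5 (b + 4) = ascProd σ 1 b * ascBlocks σ 0 m := by
    induction b with
    | zero => rw [ascProd_of_lt σ (by omega), ascProd_of_lt σ (by omega), mul_one, one_mul]
    | succ b ih =>
      rw [show b + 1 + 4 = b + 4 + 1 by omega, ascProd_succ σ (by omega : 5 ≤ b + 4 + 1),
        ascProd_succ σ (by omega : 1 ≤ b + 1), ← mul_assoc, ih (by omega), mul_assoc,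
        show b + 4 + 1 = b + 1 + 4 by omega, h.ascBlocks_mul_gen hm (by omega) (by omega),
        mul_assoc]
  exact (show SemiconjBy (ascBlocks σ 0 m) (ascProd σ 5 (b + 4)) (ascProd σ 1 b) from h1).pow_right k

/-- The chain word on `m + 3` letters in terms of the chain word on three letters, and of the
chain word on the letters `5, …, m + 3`. -/
theorem chain_eq (h : IsBraid σ N) {m : ℕ} (hm : m + 3 ≤ N) :
    ascProd σ 1 (m + 3) ^ (m + 4) =
      ascProd σ 1 3 ^ 4 * descBlocks σ m * ascBlocks σ 0 m * ascProd σ 5 (m + 3) ^ m := by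
  induction m with
  | zero => simp [descBlocks, ascBlocks]
  | succ m ih =>
    have hcomm : Commute (descProd σ 1 (m + 4) * ascProd σ 1 (m + 4)) (ascProd σ 5 (m + 3)) :=
      commute_ascProd fun k hk hk' => (h.commute_desc_asc (by omega) (by omega) (by omega)).symm
    have hA := h.ascBlocks_mul_asc_pow (b := m - 1) (m := m) (k := m) (by omega)
    have hB := h.ascBlocks_mul_asc_pow (b := m) (m := m + 1) (k := m) (by omega) le_rfl
    have hB1 := h.ascBlocks_mul_asc_pow (b := m) (m := m + 1) (k := m + 1) (by omega) le_rfl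
    have hdesc := h.descProd_mul_ascBlocks (b := m + 4) (m := m) (by omega) le_rfl
    have hcomm2 : Commute (descProd σ (m + 1) (m + 4)) (ascProd σ 1 (m - 1) ^ m) := by
      refine Commute.pow_right (commute_ascProd fun k hk hk' => ?_) m
      exact (commute_descProd fun l hl hl' =>
        h.commute (by omega) (by omega) (by omega) (by omega) (Or.inl (by omega))).symm
    have hQ : ascBlocks σ 0 m * ascProd σ 5 (m + 3) ^ m =
        ascProd σ 1 (m - 1) ^ m * ascBlocks σ 0 m := by
      rcases Nat.eq_zero_or_pos m with rfl | hpos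
      · simp
      · rw [← hA (by omega), show m - 1 + 4 = m + 3 by omega]
    have hpow : ascProd σ 1 m ^ (m + 1) =
        ascProd σ 1 (m - 1) ^ m * descProd σ 1 m * ascProd σ 1 m := by
      rcases Nat.eq_zero_or_pos m with rfl | hpos
      · simp [ascProd_of_lt, descProd_of_lt]
      · obtain ⟨m, rfl⟩ : ∃ k, m = k + 1 := ⟨m - 1, by omega⟩
        exact h.ascProd_pow_succ (by omega)
    -- Here σ_{m+4} ⋯ σ_1 σ_1 ⋯ σ_{m+4} is the factor by which the full twist grows. The power of
    -- σ_5 ⋯ σ_{m+3} is first carried to the letters 1, …, m − 1. The descending product is then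
    -- split at m: its left part σ_{m+4} ⋯ σ_{m+1} is the new block of `descBlocks`, while σ_m ⋯ σ_1
    -- and the σ_1 ⋯ σ_m coming from the ascending product complete the power to (σ_1 ⋯ σ_m)^{m+1},
    -- which is carried back to the letters 5, …, m + 4.
    have key : ascBlocks σ 0 m * ascProd σ 5 (m + 3) ^ m *
        (descProd σ 1 (m + 4) * ascProd σ 1 (m + 4)) =
        descProd σ (m + 1) (m + 4) * ascBlocks σ 0 (m + 1) * ascProd σ 5 (m + 4) ^ (m + 1) := by
      calc _ = ascProd σ 1 (m - 1) ^ m * (ascBlocks σ 0 m * descProd σ 1 (m + 4)) *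
            ascProd σ 1 (m + 4) := by rw [hQ]; simp only [mul_assoc]
        _ = ascProd σ 1 (m - 1) ^ m * descProd σ 1 (m + 4) *
            (ascBlocks σ 1 m * ascProd σ 1 4 * ascProd σ 5 (m + 4)) := by
          rw [← hdesc, ← ascProd_mul σ (by omega : 1 ≤ 4 + 1) (by omega : 4 ≤ m + 4)]
          simp only [mul_assoc]
        _ = ascProd σ 1 (m - 1) ^ m * descProd σ 1 (m + 4) *
            (ascProd σ 1 m * ascBlocks σ 0 (m + 1)) := by
          have h1 := h.ascBlocks_mul_asc_pow (b := m) (m := m + 1) (k := 1) (by omega) le_rfl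
          rw [pow_one, pow_one] at h1
          rw [← h1, ascBlocks_succ' 0 m]
        _ = (ascProd σ 1 (m - 1) ^ m * descProd σ (m + 1) (m + 4)) * (descProd σ 1 m *
            ascProd σ 1 m * ascBlocks σ 0 (m + 1)) := by
          rw [← descProd_mul σ (by omega : 1 ≤ m + 1) (by omega : m ≤ m + 4)]
          simp only [mul_assoc]
        _ = _ := by
          rw [← hcomm2.eq, mul_assoc (descProd σ (m + 1) _) (ascBlocks σ 0 (m + 1)), hB1, hpow]
          simp only [mul_assoc]
    have e := h.ascProd_pow_succ (j := m + 3) (by omega)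
    rw [show m + 1 + 3 = m + 3 + 1 by omega, show m + 1 + 4 = m + 3 + 2 by omega, e,
      ih (by omega), descBlocks]
    calc _ = ascProd σ 1 3 ^ 4 * descBlocks σ m * (ascBlocks σ 0 m * ascProd σ 5 (m + 3) ^ m *
          (descProd σ 1 (m + 4) * ascProd σ 1 (m + 4))) := by simp only [mul_assoc]
      _ = _ := by rw [key]; simp only [mul_assoc]

/-- `(σ_4 ⋯ σ_1) ⋯ (σ_{m+3} ⋯ σ_m)` carries `σ_{m+j}` to `σ_j`, `1 ≤ j ≤ 3`. -/
theorem descBlocks_mul_gen (h : IsBraid σ N) {j m : ℕ} (hm : m + 3 ≤ N) (hj : 1 ≤ j)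
    (hj' : j ≤ 3) : descBlocks σ m * σ (j + m) = σ j * descBlocks σ m := by
  induction m with
  | zero => simp [descBlocks]
  | succ m ih =>
    rw [descBlocks, mul_assoc, ← add_assoc, h.descProd_mul_gen (by omega) (by omega) (by omega)
      (by omega), ← mul_assoc, ih (by omega), mul_assoc]

theorem gen_mul_ascBlocks (h : IsBraid σ N) {j m : ℕ} (hm : m + 3 ≤ N) (hj : 1 ≤ j)
    (hj' : j ≤ 3) : σ (j + m) * ascBlocks σ 0 m = ascBlocks σ 0 m * σ j := by
  induction m with
  | zero => simp [ascBlocks]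
  | succ m ih =>
    rw [ascBlocks, zero_add, ← add_assoc, ← mul_assoc, ← h.ascProd_mul_gen (by omega) (by omega)
      (by omega) (by omega), mul_assoc, ih (by omega), mul_assoc]

theorem descBlocks_mul_desc (h : IsBraid σ N) {m : ℕ} (hm : m + 3 ≤ N) :
    descBlocks σ m * descProd σ (m + 1) (m + 3) = descProd σ 1 3 * descBlocks σ m := by
  have e : ∀ a, descProd σ (a + 1) (a + 3) = σ (3 + a) * σ (2 + a) * σ (1 + a) := by
    intro a
    rw [descProd_succ σ (by omega), descProd_succ σ (by omega), descProd_self, mul_assoc,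
      add_comm 1, add_comm 2, add_comm 3]
  rw [e, show descProd σ 1 3 = descProd σ (0 + 1) (0 + 3) from rfl, e]
  simp only [add_zero]
  rw [← mul_assoc, ← mul_assoc, h.descBlocks_mul_gen hm (by omega) le_rfl, mul_assoc,
    mul_assoc, ← mul_assoc (descBlocks σ m), h.descBlocks_mul_gen hm (by omega) (by omega), mul_assoc,
    h.descBlocks_mul_gen hm le_rfl (by omega)]
  simp only [mul_assoc]

theorem asc_mul_ascBlocks (h : IsBraid σ N) {m : ℕ} (hm : m + 3 ≤ N) :
    ascProd σ (m + 1) (m + 3) * ascBlocks σ 0 m = ascBlocks σ 0 m * ascProd σ 1 3 := by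
  have e : ∀ a, ascProd σ (a + 1) (a + 3) = σ (1 + a) * σ (2 + a) * σ (3 + a) := by
    intro a
    rw [ascProd_succ σ (by omega), ascProd_succ σ (by omega), ascProd_self,
      add_comm 1, add_comm 2, add_comm 3]
  rw [e, show ascProd σ 1 3 = ascProd σ (0 + 1) (0 + 3) from rfl, e]
  simp only [add_zero]
  rw [mul_assoc, h.gen_mul_ascBlocks hm (by omega) le_rfl, ← mul_assoc, mul_assoc (σ (1 + m)),
    h.gen_mul_ascBlocks hm (by omega) (by omega), ← mul_assoc,
    h.gen_mul_ascBlocks hm le_rfl (by omega)]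
  simp only [mul_assoc]

theorem op (h : IsBraid σ N) : IsBraid (fun k => MulOpposite.op (σ k)) N := by
  refine ⟨fun i j h1 h2 h3 => ?_, fun i h1 h2 => ?_⟩
  · rw [← MulOpposite.op_mul, ← MulOpposite.op_mul, h.comm i j h1 h2 h3]
  · simp only [← MulOpposite.op_mul, ← mul_assoc]
    rw [h.braid i h1 h2]

/-- The chain word and its reverse have the same full twist. -/
theorem descProd_pow (h : IsBraid σ N) {j : ℕ} (hj : j ≤ N) :
    descProd σ 1 j ^ (j + 1) = ascProd σ 1 j ^ (j + 1) := by
  induction j with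
  | zero => rw [ascProd_of_lt σ zero_lt_one, descProd_of_lt σ zero_lt_one]
  | succ j ih =>
    -- Read in the opposite monoid, the recursion for the full twist says that the reversed chain
    -- word grows by the same factor σ_{j+1} ⋯ σ_1 σ_1 ⋯ σ_{j+1}, placed on the left. That factor
    -- commutes with the earlier letters, so the two recursions coincide.
    have h1 := congrArg MulOpposite.unop (h.op.ascProd_pow_succ hj)
    have e1 : ∀ a b, MulOpposite.unop (ascProd (fun k => MulOpposite.op (σ k)) a b) =
        descProd σ a b := by
      intro a b
      rw [ascProd, descProd, MulOpposite.unop_list_prod, List.map_map]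
      rfl
    have e2 : ∀ a b, MulOpposite.unop (descProd (fun k => MulOpposite.op (σ k)) a b) =
        ascProd σ a b := by
      intro a b
      rw [ascProd, descProd, MulOpposite.unop_list_prod, List.map_reverse, List.reverse_reverse,
        List.map_map]
      rfl
    simp only [MulOpposite.unop_mul, MulOpposite.unop_pow, e1, e2] at h1
    have hcomm : Commute (descProd σ 1 (j + 1) * ascProd σ 1 (j + 1)) (ascProd σ 1 j ^ (j + 1)) :=
      Commute.pow_right (commute_ascProd fun k hk hk' =>
        (h.commute_desc_asc hj hk (by omega)).symm) _
    rw [h1, ih (by omega), ← mul_assoc, hcomm.eq, h.ascProd_pow_succ hj, mul_assoc]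

end IsBraid

end BraidWords

/-! ### The Hurwitz monoid -/

section Hurwitz

variable {G : Type*} [Group G]

theorem HurwitzEquiv.append {l₁ l₂ r₁ r₂ : List G} (hl : HurwitzEquiv l₁ l₂)
    (hr : HurwitzEquiv r₁ r₂) : HurwitzEquiv (l₁ ++ r₁) (l₂ ++ r₂) := by
  have left : ∀ r, HurwitzEquiv (l₁ ++ r) (l₂ ++ r) := by
    intro r₁
    induction hl with
    | rel x y h =>
      obtain ⟨l, r, a, b⟩ := h
      have := HurwitzMove.move l (r ++ r₁) a b
      simp only [List.append_assoc, List.cons_append]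
      exact Relation.EqvGen.rel _ _ this
    | refl x => exact Relation.EqvGen.refl _
    | symm x y _ ih => exact Relation.EqvGen.symm _ _ ih
    | trans x y z _ _ ih ih' => exact Relation.EqvGen.trans _ _ _ ih ih'
  have right : ∀ l, HurwitzEquiv (l ++ r₁) (l ++ r₂) := by
    intro l₂
    induction hr with
    | rel x y h =>
      obtain ⟨l, r, a, b⟩ := h
      have := HurwitzMove.move (l₂ ++ l) r a b
      simp only [List.append_assoc] at this
      exact Relation.EqvGen.rel _ _ this
    | refl x => exact Relation.EqvGen.refl _
    | symm x y _ ih => exact Relation.EqvGen.symm _ _ ih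
    | trans x y z _ _ ih ih' => exact Relation.EqvGen.trans _ _ _ ih ih'
  exact Relation.EqvGen.trans _ _ _ (left r₁) (right l₂)

theorem HurwitzEquiv.prod_eq {l l' : List G} (h : HurwitzEquiv l l') : l.prod = l'.prod := by
  induction h with
  | rel x y h =>
    obtain ⟨l, r, a, b⟩ := h
    simp only [List.prod_append, List.prod_cons]
    group
  | refl x => rfl
  | symm x y _ ih => exact ih.symm
  | trans x y z _ _ ih ih' => exact ih.trans ih'

variable (G)

/-- Hurwitz equivalence as a congruence of the free monoid. -/
def hurwitzCon : Con (FreeMonoid G) where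
  r u v := HurwitzEquiv u.toList v.toList
  iseqv := ⟨fun _ => Relation.EqvGen.refl _, Relation.EqvGen.symm _ _,
    Relation.EqvGen.trans _ _ _⟩
  mul' := HurwitzEquiv.append

/-- The monoid of words in the elements of `G` up to Hurwitz equivalence. -/
abbrev HurwitzMonoid : Type _ := (hurwitzCon G).Quotient

variable {G}

/-- The class of a word. -/
def hurwitzClass (w : List G) : HurwitzMonoid G :=
  ((FreeMonoid.ofList w : FreeMonoid G) : (hurwitzCon G).Quotient)

/-- The class of a word of length one. -/
def letter (a : G) : HurwitzMonoid G := hurwitzClass [a]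

theorem hurwitzClass_eq {w w' : List G} :
    hurwitzClass w = hurwitzClass w' ↔ HurwitzEquiv w w' :=
  Con.eq (hurwitzCon G)

theorem hurwitzClass_append (w w' : List G) :
    hurwitzClass (w ++ w') = hurwitzClass w * hurwitzClass w' := rfl

theorem hurwitzClass_nil : hurwitzClass ([] : List G) = 1 := rfl

theorem hurwitzClass_cons (a : G) (w : List G) :
    hurwitzClass (a :: w) = letter a * hurwitzClass w := rfl

theorem hurwitzClass_eq_prod (w : List G) : hurwitzClass w = (w.map letter).prod := by
  induction w with
  | nil => rfl
  | cons a w ih => rw [hurwitzClass_cons, ih, List.map_cons, List.prod_cons]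

theorem hurwitzClass_wordPow (w : List G) (n : ℕ) :
    hurwitzClass (wordPow w n) = hurwitzClass w ^ n := by
  induction n with
  | zero => rfl
  | succ n ih =>
    rw [pow_succ', ← ih, ← hurwitzClass_append]
    rfl

theorem prod_wordPow (w : List G) (n : ℕ) : (wordPow w n).prod = w.prod ^ n := by
  rw [wordPow, List.prod_flatten, List.map_replicate, List.prod_replicate]

theorem letter_mul_letter (a b : G) : letter a * letter b = letter b * letter (b⁻¹ * a * b) :=
  hurwitzClass_eq.2 (Relation.EqvGen.rel _ _ (HurwitzMove.move [] [] a b))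

theorem letter_mul_letter' (a b : G) : letter a * letter b = letter (a * b * a⁻¹) * letter a := by
  rw [letter_mul_letter (a * b * a⁻¹) a]
  congr 2
  group

theorem letter_commute {a b : G} (h : a * b = b * a) : letter a * letter b = letter b * letter a := by
  rw [letter_mul_letter, mul_assoc, h, inv_mul_cancel_left]

/-- The braid relation says a b a⁻¹ = b⁻¹ a b: moving b to the left over a creates the same letter
as moving a to the right over b. Thus braid relations pass from the group to words modulo Hurwitz
moves, where nothing may be cancelled. -/
theorem letter_braid {a b : G} (h : a * b * a = b * a * b) :
    letter a * letter b * letter a = letter b * letter a * letter b := by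
  have h1 : a * b * a⁻¹ = b⁻¹ * a * b := by
    rw [mul_inv_eq_iff_eq_mul, mul_assoc, mul_assoc, eq_inv_mul_iff_mul_eq, ← mul_assoc, ← h,
      mul_assoc]
  calc letter a * letter b * letter a = letter b * letter (b⁻¹ * a * b) * letter a := by
        rw [← letter_mul_letter]
    _ = letter b * (letter a * letter b) := by rw [letter_mul_letter' a b, h1, mul_assoc]
    _ = _ := by rw [mul_assoc]

theorem letter_mul_hurwitzClass (a : G) (w : List G) :
    letter a * hurwitzClass w = hurwitzClass w * letter (w.prod⁻¹ * a * w.prod) := by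
  induction w generalizing a with
  | nil => simp [hurwitzClass_nil]
  | cons b w ih =>
    rw [hurwitzClass_cons, ← mul_assoc, letter_mul_letter, mul_assoc, ih, ← mul_assoc,
      List.prod_cons, show w.prod⁻¹ * (b⁻¹ * a * b) * w.prod = (b * w.prod)⁻¹ * a * (b * w.prod) by
        group]

theorem hurwitzClass_mul_letter (w : List G) (a : G) :
    hurwitzClass w * letter a = letter (w.prod * a * w.prod⁻¹) * hurwitzClass w := by
  rw [letter_mul_hurwitzClass]
  congr 2
  group

/-- A word may be rotated when its product commutes with the letters which are moved. -/
theorem hurwitzClass_rotate (u v : List G) (h : ∀ a ∈ u, Commute a (u ++ v).prod) :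
    hurwitzClass u * hurwitzClass v = hurwitzClass v * hurwitzClass u := by
  induction u generalizing v with
  | nil => rw [hurwitzClass_nil, one_mul, mul_one]
  | cons a u ih =>
    have ha := h a (List.mem_cons_self ..)
    have e : (u ++ (v ++ [a])).prod = (a :: u ++ v).prod := by
      rw [List.cons_append, List.prod_cons] at ha ⊢
      rw [← List.append_assoc, List.prod_append, List.prod_singleton]
      have h1 := ha.eq
      rw [mul_assoc] at h1
      exact (mul_left_cancel h1).symm
    -- Moving a to the end conjugates it by the product of the rest. Since a commutes with the whole
    -- product it commutes with that of the rest, so it arrives unchanged.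
    have hconj : letter a * hurwitzClass (u ++ v) = hurwitzClass (u ++ v) * letter a := by
      rw [letter_mul_hurwitzClass]
      congr 2
      rw [List.cons_append, List.prod_cons] at ha
      have h1 := ha.eq
      rw [mul_assoc] at h1
      rw [mul_assoc, mul_left_cancel h1, inv_mul_cancel_left]
    have h2 := ih (v ++ [a]) fun b hb => by
      rw [e]
      exact h b (List.mem_cons_of_mem _ hb)
    rw [hurwitzClass_append v] at h2
    rw [hurwitzClass_append] at hconj
    change hurwitzClass u * (hurwitzClass v * letter a) =
      hurwitzClass v * letter a * hurwitzClass u at h2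
    rw [hurwitzClass_cons, mul_assoc, hconj, mul_assoc, h2, mul_assoc]

theorem IsBraid.letter {σ : ℕ → G} {N : ℕ} (h : IsBraid σ N) :
    IsBraid (fun k => letter (σ k)) N :=
  ⟨fun i j h1 h2 h3 => letter_commute (h.comm i j h1 h2 h3),
    fun i h1 h2 => letter_braid (h.braid i h1 h2)⟩

theorem ascProd_letter (σ : ℕ → G) (a b : ℕ) :
    ascProd (fun k => letter (σ k)) a b = hurwitzClass ((List.Ico a (b + 1)).map σ) := by
  rw [hurwitzClass_eq_prod, List.map_map]
  rfl

theorem descProd_letter (σ : ℕ → G) (a b : ℕ) :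
    descProd (fun k => letter (σ k)) a b = hurwitzClass ((List.Ico a (b + 1)).map σ).reverse := by
  rw [hurwitzClass_eq_prod, List.map_reverse, List.map_map]
  rfl

/-! ### The blocks as words in the twists about d_j and e_j -/

/-- The conjugate of `σ_j` by `σ_{j-3}⁻¹ σ_{j-2}⁻¹ σ_{j-1}⁻¹`. -/
def leftConj (σ : ℕ → G) (j : ℕ) : G :=
  (σ (j - 3))⁻¹ * (σ (j - 2))⁻¹ * (σ (j - 1))⁻¹ * σ j *
    ((σ (j - 3))⁻¹ * (σ (j - 2))⁻¹ * (σ (j - 1))⁻¹)⁻¹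

/-- The conjugate of `σ_j` by `σ_{j-3} σ_{j-2} σ_{j-1}`. -/
def rightConj (σ : ℕ → G) (j : ℕ) : G :=
  σ (j - 3) * σ (j - 2) * σ (j - 1) * σ j * (σ (j - 3) * σ (j - 2) * σ (j - 1))⁻¹

variable {σ : ℕ → G} {N : ℕ}

/-- In the block σ_{m+4} ⋯ σ_{m+1} the first letter is moved to the end and becomes its conjugate,
the twist about d_{m+4}. The remaining triple σ_{m+3} σ_{m+2} σ_{m+1} slides to the left through the
earlier blocks and becomes σ_3 σ_2 σ_1. -/
theorem IsBraid.descBlocks_letter (h : IsBraid σ N) {m : ℕ} (hm : m + 3 ≤ N) :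
    descBlocks (fun k => SurfaceMCG.letter (σ k)) m = descProd (fun k => SurfaceMCG.letter (σ k)) 1 3 ^ m *
      hurwitzClass ((List.Ico 4 (m + 4)).map (leftConj σ)) := by
  induction m with
  | zero => simp [descBlocks, hurwitzClass_nil]
  | succ m ih =>
    have e1 : descProd (fun k => SurfaceMCG.letter (σ k)) (m + 1) (m + 4) =
        descProd (fun k => SurfaceMCG.letter (σ k)) (m + 1) (m + 3) *
          SurfaceMCG.letter (leftConj σ (m + 4)) := by
      rw [descProd_succ _ (by omega), descProd_letter, letter_mul_hurwitzClass]
      congr 2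
      rw [← List.map_reverse]
      have : (List.Ico (m + 1) (m + 3 + 1)) = [m + 1, m + 2, m + 3] := by
        rw [List.Ico.succ_top (by omega), List.Ico.succ_top (by omega), List.Ico.succ_singleton]
        rfl
      rw [this, leftConj, show m + 4 - 3 = m + 1 by omega, show m + 4 - 2 = m + 2 by omega,
        show m + 4 - 1 = m + 3 by omega]
      simp [mul_assoc]
    rw [descBlocks, e1, ← mul_assoc, h.letter.descBlocks_mul_desc (by omega), ih (by omega),
      show m + 1 + 4 = m + 4 + 1 by omega, List.Ico.succ_top (by omega : 4 ≤ m + 4), List.map_append,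
      hurwitzClass_append, pow_succ']
    simp only [mul_assoc]
    rfl

/-- Mirror image of the descending case: the last letter of each block is moved to its front and
becomes the twist about e_{m+4}, and the triples slide to the right and become σ_1 σ_2 σ_3. -/
theorem IsBraid.ascBlocks_letter (h : IsBraid σ N) {m : ℕ} (hm : m + 3 ≤ N) :
    ascBlocks (fun k => SurfaceMCG.letter (σ k)) 0 m =
      hurwitzClass ((List.Ico 4 (m + 4)).map (rightConj σ)).reverse *
        ascProd (fun k => SurfaceMCG.letter (σ k)) 1 3 ^ m := by
  induction m with
  | zero => simp [ascBlocks, hurwitzClass_nil]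
  | succ m ih =>
    have e1 : ascProd (fun k => SurfaceMCG.letter (σ k)) (m + 1) (m + 4) =
        SurfaceMCG.letter (rightConj σ (m + 4)) *
          ascProd (fun k => SurfaceMCG.letter (σ k)) (m + 1) (m + 3) := by
      rw [ascProd_succ _ (by omega), ascProd_letter, hurwitzClass_mul_letter]
      congr 2
      have : (List.Ico (m + 1) (m + 3 + 1)) = [m + 1, m + 2, m + 3] := by
        rw [List.Ico.succ_top (by omega), List.Ico.succ_top (by omega), List.Ico.succ_singleton]
        rfl
      rw [this, rightConj, show m + 4 - 3 = m + 1 by omega, show m + 4 - 2 = m + 2 by omega,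
        show m + 4 - 1 = m + 3 by omega]
      simp [mul_assoc]
    rw [ascBlocks, zero_add, e1, mul_assoc, h.letter.asc_mul_ascBlocks (by omega), ih (by omega),
      show m + 1 + 4 = m + 4 + 1 by omega, List.Ico.succ_top (by omega : 4 ≤ m + 4), List.map_append,
      List.reverse_append, hurwitzClass_append, pow_succ]
    simp only [mul_assoc]
    rfl

/-- The chain word is Hurwitz equivalent to a word which begins with powers of chain words of
length three. -/
theorem IsBraid.hurwitz_chain (h : IsBraid σ N) {m : ℕ} (hm : m + 3 ≤ N) :
    hurwitzClass (wordPow ((List.Ico 1 (m + 3 + 1)).map σ) (m + 4)) =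
      hurwitzClass [σ 1, σ 2, σ 3] ^ m * hurwitzClass [σ 1, σ 2, σ 3] ^ 4 *
        hurwitzClass [σ 3, σ 2, σ 1] ^ m * hurwitzClass ((List.Ico 4 (m + 4)).map (leftConj σ)) *
        hurwitzClass ((List.Ico 4 (m + 4)).map (rightConj σ)).reverse *
        hurwitzClass ((List.Ico 5 (m + 3 + 1)).map σ) ^ m := by
  have hA : ascProd (fun k => SurfaceMCG.letter (σ k)) 1 3 = hurwitzClass [σ 1, σ 2, σ 3] :=
    ascProd_letter σ 1 3
  have hD : descProd (fun k => SurfaceMCG.letter (σ k)) 1 3 = hurwitzClass [σ 3, σ 2, σ 1] :=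
    descProd_letter σ 1 3
  have hB := ascProd_letter σ 5 (m + 3)
  have hX := ascProd_letter σ 1 (m + 3)
  have hcommB : Commute (ascProd (fun k => SurfaceMCG.letter (σ k)) 1 3 ^ m)
      (ascProd (fun k => SurfaceMCG.letter (σ k)) 5 (m + 3) ^ m) := by
    refine Commute.pow_pow (commute_ascProd fun k hk hk' => ?_) m m
    exact (commute_ascProd fun l hl hl' => h.letter.commute (by omega) (by omega) (by omega)
      (by omega) (Or.inr (by omega))).symm
  have key := h.letter.chain_eq hm
  rw [h.descBlocks_letter hm, h.ascBlocks_letter hm] at key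
  rw [hurwitzClass_wordPow, ← hX, key, ← hA, ← hD, ← hB]
  set A := ascProd (fun k => SurfaceMCG.letter (σ k)) 1 3
  set B := ascProd (fun k => SurfaceMCG.letter (σ k)) 5 (m + 3)
  set C := descProd (fun k => SurfaceMCG.letter (σ k)) 1 3
  set z : List G := wordPow [σ 1, σ 2, σ 3] 4 ++ wordPow [σ 3, σ 2, σ 1] m ++
    (List.Ico 4 (m + 4)).map (leftConj σ) ++ ((List.Ico 4 (m + 4)).map (rightConj σ)).reverse ++
    wordPow ((List.Ico 5 (m + 3 + 1)).map σ) m with hz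
  have hzc : hurwitzClass z = A ^ 4 * C ^ m *
      hurwitzClass ((List.Ico 4 (m + 4)).map (leftConj σ)) *
      hurwitzClass ((List.Ico 4 (m + 4)).map (rightConj σ)).reverse * B ^ m := by
    simp only [hz, hurwitzClass_append, hurwitzClass_wordPow, ← hA, ← hD, ← hB]
  have hu : hurwitzClass (wordPow [σ 1, σ 2, σ 3] m) = A ^ m := by
    rw [hurwitzClass_wordPow, ← hA]
  -- The A^m produced by the ascending blocks commutes with B^m, as their indices differ by at least
  -- 2, so it can be put at the very end.
  have hzA : hurwitzClass z * A ^ m = ascProd (fun k => SurfaceMCG.letter (σ k)) 1 (m + 3) ^ (m + 4) := by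
    rw [key, hzc]
    have := hcommB.eq
    simp only [mul_assoc]
    rw [this]
  have hprod : z.prod * (wordPow [σ 1, σ 2, σ 3] m).prod = ascProd σ 1 (m + 3) ^ (m + 4) := by
    rw [← hu, ← hurwitzClass_append, hX, ← hurwitzClass_wordPow, hurwitzClass_eq] at hzA
    have := hzA.prod_eq
    rw [prod_wordPow] at this
    rw [← List.prod_append, this]
    rfl
  have hmem : ∀ a ∈ wordPow [σ 1, σ 2, σ 3] m, Commute a (ascProd σ 1 (m + 3) ^ (m + 4)) := by
    intro a ha
    have hk : ∃ k, 1 ≤ k ∧ k ≤ 3 ∧ a = σ k := by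
      obtain ⟨l, hl, hal⟩ := List.mem_flatten.1 ha
      rw [List.eq_of_mem_replicate hl] at hal
      simp only [List.mem_cons, List.not_mem_nil, or_false] at hal
      rcases hal with rfl | rfl | rfl
      · exact ⟨1, le_rfl, by omega, rfl⟩
      · exact ⟨2, by omega, by omega, rfl⟩
      · exact ⟨3, by omega, le_rfl, rfl⟩
    obtain ⟨k, hk1, hk3, rfl⟩ := hk
    exact h.commute_ascProd_pow hm hk1 (by omega)
  have hcommU : Commute (wordPow [σ 1, σ 2, σ 3] m).prod (ascProd σ 1 (m + 3) ^ (m + 4)) :=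
    Commute.list_prod_left _ _ hmem
  have hprod' : (wordPow [σ 1, σ 2, σ 3] m ++ z).prod = ascProd σ 1 (m + 3) ^ (m + 4) := by
    rw [List.prod_append]
    have h1 := hcommU.eq
    rw [← hprod, ← mul_assoc] at h1
    exact (mul_right_cancel h1).trans hprod
  -- The total product is the full twist, which commutes with σ_1, σ_2 and σ_3; so A^m may be
  -- rotated from the end of the word to its front.
  have hrot := hurwitzClass_rotate (wordPow [σ 1, σ 2, σ 3] m) z fun a ha => by
    rw [hprod']
    exact hmem a ha
  rw [← key, ← hzA, ← hu, ← hrot, hu, hzc]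
  simp only [mul_assoc]

end Hurwitz

/-! ### Twists about images of curves -/

section TwistMap

variable {S B : Set (ℂ × ℂ)}

/-- The image annulus is parametrized by the parametrization of A followed by f, so the conjugation
formula holds for the diffeomorphisms themselves. -/
theorem EmbeddedAnnulus.dehnTwist_map (f : DiffPlus S B) (A : EmbeddedAnnulus S B) :
    (A.map f).dehnTwist = f * A.dehnTwist * f⁻¹ := by
  refine Subtype.ext (Equiv.ext fun p => ?_)
  change (A.map f).twistFun 1 p = (f : Equiv.Perm S) (A.twistFun 1 ((f : Equiv.Perm S).symm p))
  by_cases hp : (f : Equiv.Perm S).symm p ∈ A.target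
  · have hp' : p ∈ (A.map f).target := hp
    rw [EmbeddedAnnulus.twistFun, if_pos hp', EmbeddedAnnulus.twistFun, if_pos hp]
    rfl
  · have hp' : p ∉ (A.map f).target := hp
    rw [EmbeddedAnnulus.twistFun, if_neg hp', EmbeddedAnnulus.twistFun, if_neg hp,
      Equiv.apply_symm_apply]

theorem EmbeddedAnnulus.twistClass_map (f : DiffPlus S B) (A : EmbeddedAnnulus S B) :
    (A.map f).twistClass = (f : MappingClassGroup S B) * A.twistClass *
      (f : MappingClassGroup S B)⁻¹ :=
  congrArg (QuotientGroup.mk (s := IsotopicToId S B)) (A.dehnTwist_map f)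

theorem twistClass_d (g j : ℕ) : (d g j).twistClass = leftConj (tc g) j :=
  EmbeddedAnnulus.twistClass_map _ _

theorem twistClass_e (g j : ℕ) : (e g j).twistClass = rightConj (tc g) j :=
  EmbeddedAnnulus.twistClass_map _ _

end TwistMap

/-! ### The full twist as a power of the chain word -/

theorem isBraid_halfTwist (g : ℕ) : IsBraid (halfTwist g) (2 * g + 1) :=
  ⟨fun _ _ h1 h2 h3 => halfTwist_comm h1 h2 (by omega),
    fun _ h1 h2 => halfTwist_braid h1 (by omega)⟩

/-- A block twist as a product of half twists. -/
theorem blockClass_eq_desc {g j : ℕ} (hj : 1 ≤ j) (hj' : j + 1 ≤ 2 * g + 2) :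
    blockClass g 1 (j + 1) = descProd (halfTwist g) 1 j * blockClass g 2 (j + 1) := by
  rw [← mul_inv_eq_iff_eq_mul]
  induction j, hj using Nat.le_induction with
  | base =>
    rw [blockClass_pair le_rfl hj', blockClass_single (by omega) (by omega), descProd_self, inv_one,
      mul_one]
  | succ j hj ih =>
    rw [descProd_succ _ (by omega), ← ih (by omega), ← blockClass_step le_rfl (by omega) hj']

/-- Let w be the half turn of p_1, …, p_{j+1}, let D and A be the descending and ascending products,
and let Δ_1, Δ_2 be the half turns of p_1, …, p_j and of p_2, …, p_{j+1}. Mirror symmetry gives w D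
= A w and w Δ_2 = Δ_1 w. As w = D Δ_2, it follows that w w = A w Δ_2 = A Δ_1 w, and w cancels. -/
theorem blockClass_succ {g j : ℕ} (hj : 1 ≤ j) (hj' : j + 1 ≤ 2 * g + 2) :
    blockClass g 1 (j + 1) = ascProd (halfTwist g) 1 j * blockClass g 1 j := by
  set w := blockClass g 1 (j + 1) with hw
  have h1 : w * descProd (halfTwist g) 1 j = ascProd (halfTwist g) 1 j * w := by
    have key : ∀ k, k ≤ j → w * descProd (halfTwist g) 1 k =
        ascProd (halfTwist g) (j + 1 - k) j * w := by
      intro k hk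
      induction k with
      | zero => rw [descProd_of_lt _ zero_lt_one, ascProd_of_lt _ (by omega), mul_one, one_mul]
      | succ k ih =>
        have h2 := blockClass_conj_halfTwist (i := 1) (j := j + 1) (k := k + 1) le_rfl hj'
          (by omega) (by omega)
        rw [descProd_succ _ (by omega), ← mul_assoc, h2, mul_assoc, ih (by omega), ← mul_assoc,
          ascProd_cons _ (by omega : j + 1 - (k + 1) ≤ j),
          show j + 1 - (k + 1) + 1 = j + 1 - k by omega,
          show 1 + (j + 1) - (k + 1 + 1) = j + 1 - (k + 1) by omega]
    have := key j le_rfl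
    rwa [show j + 1 - j = 1 by omega] at this
  have h2 := blockClass_conj_tail (g := g) (j := j + 1) (by omega) hj'
  have h3 := blockClass_eq_desc hj hj'
  rw [← hw] at h2 h3
  refine mul_right_cancel (b := w) ?_
  calc w * w = w * descProd (halfTwist g) 1 j * blockClass g 2 (j + 1) := by
        rw [mul_assoc, ← h3]
    _ = ascProd (halfTwist g) 1 j * (w * blockClass g 2 (j + 1)) := by rw [h1, mul_assoc]
    _ = _ := by rw [h2, mul_assoc, Nat.add_sub_cancel]

theorem commute_blockClass {g j l : ℕ} (hj : 1 ≤ j) (hjl : j < l) (hl : l + 1 ≤ 2 * g + 2) :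
    Commute (halfTwist g l) (blockClass g 1 j) := by
  induction j, hj using Nat.le_induction with
  | base =>
    rw [blockClass_single le_rfl (by omega)]
    exact Commute.one_right _
  | succ j hj ih =>
    rw [blockClass_succ hj (by omega)]
    exact (commute_ascProd fun k hk hk' => (isBraid_halfTwist g).commute (by omega) (by omega)
      (by omega) (by omega) (Or.inr (by omega))).mul_right (ih (by omega))

theorem blockClass_succ' {g j : ℕ} (hj : 1 ≤ j) (hj' : j + 1 ≤ 2 * g + 2) :
    blockClass g 1 (j + 1) = blockClass g 1 j * descProd (halfTwist g) 1 j := by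
  induction j, hj using Nat.le_induction with
  | base =>
    rw [blockClass_pair le_rfl hj', blockClass_single (by omega) (by omega), descProd_self, one_mul]
  | succ j hj ih =>
    rw [blockClass_succ (by omega) hj', ih (by omega), ascProd_succ _ (by omega),
      descProd_succ _ (by omega), mul_assoc, ← mul_assoc (halfTwist g (j + 1)),
      (commute_blockClass hj (Nat.lt_succ_self j) hj').eq, mul_assoc, ← mul_assoc,
      ← blockClass_succ hj (by omega), ← ih (by omega)]

/-- The full twist as the chain word. -/
theorem blockClass_sq {g j : ℕ} (hj' : j + 1 ≤ 2 * g + 2) :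
    blockClass g 1 (j + 1) ^ 2 = ascProd (halfTwist g) 1 j ^ (j + 1) := by
  induction j with
  | zero =>
    rw [ascProd_of_lt _ zero_lt_one, one_pow, zero_add,
      blockClass_single le_rfl (by omega : 1 ≤ 2 * g + 2), one_pow]
  | succ j ih =>
    have hB := isBraid_halfTwist g
    rw [hB.ascProd_pow_succ (by omega), ← ih (by omega)]
    -- Writing one factor of the square as Δ D and the other as A Δ encloses D A between two copies
    -- of the smaller half turn Δ. Since D A commutes with Δ, the recursion is the one of
    -- `IsBraid.ascProd_pow_succ`.
    have hcomm : ∀ k, k ≤ j → Commute (descProd (halfTwist g) 1 (j + 1) *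
        ascProd (halfTwist g) 1 (j + 1)) (blockClass g 1 (k + 1)) := by
      intro k hk
      induction k with
      | zero =>
        rw [blockClass_single le_rfl (by omega)]
        exact Commute.one_right _
      | succ k ihk =>
        rw [blockClass_succ (by omega) (by omega)]
        exact (commute_ascProd fun l hl hl' => (hB.commute_desc_asc (by omega) hl
          (by omega)).symm).mul_right (ihk (by omega))
    calc blockClass g 1 (j + 1 + 1) ^ 2
        = blockClass g 1 (j + 1) * (descProd (halfTwist g) 1 (j + 1) *
          ascProd (halfTwist g) 1 (j + 1) * blockClass g 1 (j + 1)) := by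
          rw [sq]
          nth_rw 1 [blockClass_succ' (by omega) hj']
          rw [blockClass_succ (j := j + 1) (by omega) hj']
          simp only [mul_assoc]
      _ = _ := by
          rw [(hcomm j le_rfl).eq, sq]
          simp only [mul_assoc]

/-! ### The twists about the boundary -/

section Boundary

variable {g : ℕ}

theorem mem_collar_target {s : ℤˣ} {p : surface g} : p ∈ (collarAnnulus g s).target ↔
    (p.1.1 ∈ outerRegion g ∧ 0 < (((s : ℤ) : ℂ) * (p.1.2 / outerRoot g p.1.1)).re) ∧
      p.1.1 / (4 * (g + 1 : ℂ)) ∈ planarAnnulus := Iff.rfl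

open Classical in
theorem collar_twist {s : ℤˣ} {p : surface g} (hp : p ∈ (collarAnnulus g s).target) :
    ((collarAnnulus g s).twistFun 1 p : ℂ × ℂ) =
      (4 * (g + 1 : ℂ) * planarTwist 1 (p.1.1 / (4 * (g + 1 : ℂ))), ((s : ℤ) : ℂ) *
        outerRoot g (4 * (g + 1 : ℂ) * planarTwist 1 (p.1.1 / (4 * (g + 1 : ℂ))))) := by
  rw [EmbeddedAnnulus.twistFun, if_pos hp]
  have h2 : planarTwist 1 (p.1.1 / (4 * (g + 1 : ℂ))) ∈ planarAnnulus := planarTwist_mem hp.2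
  change (((if h : planarTwist 1 (p.1.1 / (4 * (g + 1 : ℂ))) ∈ planarAnnulus then _ else _ :
    surface g)) : ℂ × ℂ) = _
  rw [dif_pos h2]
  rfl

theorem collar_mem {s : ℤˣ} {p : surface g} (hx : p.1.1 / (4 * (g + 1 : ℂ)) ∈ planarAnnulus)
    (hp : p.1.2 = ((s : ℤ) : ℂ) * outerRoot g p.1.1) : p ∈ (collarAnnulus g s).target := by
  have hg : (g + 1 : ℂ) ≠ 0 := by exact_mod_cast Nat.succ_ne_zero g
  have h1 := (outer_mem g hx).1
  rw [show 4 * (g + 1 : ℂ) * (p.1.1 / (4 * (g + 1 : ℂ))) = p.1.1 by field_simp] at h1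
  refine mem_collar_target.2 ⟨⟨h1, ?_⟩, hx⟩
  rw [hp, mul_div_assoc, div_self (outerRoot_ne_zero h1)]
  rcases Int.units_eq_one_or s with rfl | rfl <;> simp

theorem collar_not_mem {s : ℤˣ} {p : surface g} (hp : p ∈ (collarAnnulus g s).target) :
    p ∉ (collarAnnulus g (-s)).target := by
  intro h
  have h1 := (mem_collar_target.1 hp).1.2
  have h2 := (mem_collar_target.1 h).1.2
  rw [Units.val_neg, Int.cast_neg, neg_mul, Complex.neg_re] at h2
  linarith

/-- The full twist of all branch points, `|x|² ≤ 8 (g+1)²`. -/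
theorem isBlock_full (g : ℕ) :
    IsBlock g 1 (2 * g + 2) (8 * (g + 1 : ℝ) ^ 2) (24 * (g + 1 : ℝ) ^ 2) := by
  have hg : (0 : ℝ) ≤ g := Nat.cast_nonneg g
  refine ⟨le_rfl, by omega, le_rfl, ?_, ?_, fun k hk hk' => ?_, fun x hx => ?_⟩
  · nlinarith
  · push_cast
    nlinarith
  · rw [Finset.mem_Icc] at hk
    omega
  · have e : (blockCenter g 1 (2 * g + 2) : ℂ) = 0 := by
      rw [blockCenter]
      push_cast
      ring
    rw [e, sub_zero]
    rw [innerRadius] at hx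
    have := pow_le_pow_left₀ (by positivity) hx 2
    nlinarith

/-- The radii of `isBlock_full` are chosen so that its cutoff is 1 − β(|z|² − 1/2) for z = x / (4(g
+ 1)), where β is the transition function of `planarTwist`. The angles 2π(1 − β) and −2πβ differ by
a full turn, so the maps are equal. -/
theorem full_twist_apply (x : ℂ) :
    (((isBlock_full g).diffeo * (isBlock_full g).diffeo : BaseDiffeo g) : Equiv.Perm ℂ) x =
      4 * (g + 1 : ℂ) * planarTwist 1 (x / (4 * (g + 1 : ℂ))) := by
  have e : (blockCenter g 1 (2 * g + 2) : ℂ) = 0 := by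
    rw [blockCenter]
    push_cast
    ring
  have hg : (g + 1 : ℝ) ≠ 0 := by positivity
  have hg' : (g + 1 : ℂ) ≠ 0 := by exact_mod_cast Nat.succ_ne_zero g
  change diskTwistFun _ _ _ _ (diskTwistFun _ _ _ _ x) = _
  have hn : ‖x / (4 * (g + 1 : ℂ))‖ ^ 2 = ‖x‖ ^ 2 / (16 * (g + 1 : ℝ) ^ 2) := by
    rw [norm_div, div_pow, show (4 * (g + 1 : ℂ)) = ((4 * (g + 1) : ℝ) : ℂ) by push_cast; ring,
      Complex.norm_real, Real.norm_eq_abs, sq_abs]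
    ring
  rw [diskTwistFun_add, e, diskTwistFun, sub_zero, zero_add, planarTwist, hn, ← mul_assoc,
    show 4 * (g + 1 : ℂ) * (x / (4 * (g + 1 : ℂ))) = x by field_simp]
  congr 1
  rw [cutoff, show (‖x‖ ^ 2 - 8 * (g + 1 : ℝ) ^ 2) / (24 * (g + 1 : ℝ) ^ 2 - 8 * (g + 1 : ℝ) ^ 2) =
    ‖x‖ ^ 2 / (16 * (g + 1 : ℝ) ^ 2) - 1 / 2 by field_simp; ring]
  rw [show (((Real.pi + Real.pi) * (1 - Real.smoothTransition
      (‖x‖ ^ 2 / (16 * (g + 1 : ℝ) ^ 2) - 1 / 2)) : ℝ) : ℂ) * Complex.I =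
      ((-(2 * Real.pi * (1 : ℤ) * Real.smoothTransition
        (‖x‖ ^ 2 / (16 * (g + 1 : ℝ) ^ 2) - 1 / 2)) : ℝ) : ℂ) * Complex.I +
        2 * Real.pi * Complex.I by push_cast; ring, Complex.exp_add, Complex.exp_two_pi_mul_I,
    mul_one]

theorem norm_full_twist (x : ℂ) :
    ‖(((isBlock_full g).diffeo * (isBlock_full g).diffeo : BaseDiffeo g) : Equiv.Perm ℂ) x‖ =
      ‖x‖ := by
  have hg' : (g + 1 : ℂ) ≠ 0 := by exact_mod_cast Nat.succ_ne_zero g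
  rw [full_twist_apply, norm_mul, norm_planarTwist, ← norm_mul]
  congr 1
  field_simp

theorem full_twist_eq_self {x : ℂ}
    (hx : ‖x‖ ^ 2 ≤ 8 * (g + 1 : ℝ) ^ 2 ∨ 24 * (g + 1 : ℝ) ^ 2 ≤ ‖x‖ ^ 2) :
    (((isBlock_full g).diffeo * (isBlock_full g).diffeo : BaseDiffeo g) : Equiv.Perm ℂ) x = x := by
  have hg : (0 : ℝ) < (g + 1 : ℝ) ^ 2 := by positivity
  have hg' : (g + 1 : ℂ) ≠ 0 := by exact_mod_cast Nat.succ_ne_zero g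
  have hn : ‖x / (4 * (g + 1 : ℂ))‖ ^ 2 = ‖x‖ ^ 2 / (16 * (g + 1 : ℝ) ^ 2) := by
    rw [norm_div, div_pow, show (4 * (g + 1 : ℂ)) = ((4 * (g + 1) : ℝ) : ℂ) by push_cast; ring,
      Complex.norm_real, Real.norm_eq_abs, sq_abs]
    ring
  rw [full_twist_apply, planarTwist_eq_self]
  · field_simp
  · rw [hn, div_le_iff₀ (by positivity), le_div_iff₀ (by positivity)]
    rcases hx with h | h
    · exact Or.inl (by linarith)
    · exact Or.inr (by linarith)

-- Outside |x| = 2(g + 1) the curve splits into the sheets y = ± `outerRoot g x`, which fixes the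
-- root. The full twist is the identity up to |x|² = 8(g + 1)², beyond that circle, so the formula
-- glues smoothly to the constant 1.
open Classical in
theorem full_twist_root :
    BaseDiffeo.root ((isBlock_full g).diffeo * (isBlock_full g).diffeo : BaseDiffeo g) =
      fun x => if x ∈ outerRegion g then outerRoot g
        ((((isBlock_full g).diffeo * (isBlock_full g).diffeo : BaseDiffeo g) : Equiv.Perm ℂ) x) /
          outerRoot g x else 1 := by
  set f := ((isBlock_full g).diffeo * (isBlock_full g).diffeo : BaseDiffeo g) with hf
  have hg : (0 : ℝ) < (g + 1 : ℝ) ^ 2 := by positivity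
  have hg1 : (0 : ℝ) < (g + 1 : ℝ) := by positivity
  have hmem : ∀ x ∈ outerRegion g, (f : Equiv.Perm ℂ) x ∈ outerRegion g := by
    intro x hx
    change _ < ‖_‖
    rw [norm_full_twist]
    exact hx
  have hself : ∀ x, (f : Equiv.Perm ℂ) x = x → (if x ∈ outerRegion g then outerRoot g
      ((f : Equiv.Perm ℂ) x) / outerRoot g x else 1) = 1 := by
    intro x hx
    split_ifs with h
    · rw [hx, div_self (outerRoot_ne_zero h)]
    · rfl
  refine BaseDiffeo.root_eq _ ⟨contDiff_iff_contDiffAt.2 fun x => ?_, fun x => ?_, fun x => ?_,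
    fun x hx => hself x (f.2.2.2.1 x hx)⟩
  · by_cases hx : x ∈ outerRegion g
    · have h1 : ∀ y ∈ outerRegion g, ContDiffAt ℝ ∞ (outerRoot g) y := fun y hy =>
        ((contDiffOn_outerRoot g).contDiffAt ((isOpen_outerRegion g).mem_nhds hy)).restrict_scalars ℝ
      have h2 : ContDiffAt ℝ ∞ (fun y => outerRoot g ((f : Equiv.Perm ℂ) y) * (outerRoot g y)⁻¹) x :=
        ((h1 _ (hmem x hx)).comp x f.2.1.contDiffAt).mul ((h1 x hx).inv (outerRoot_ne_zero hx))
      refine h2.congr_of_eventuallyEq ?_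
      filter_upwards [(isOpen_outerRegion g).mem_nhds hx] with y hy
      rw [if_pos hy, div_eq_mul_inv]
    · refine (contDiffAt_const (c := (1 : ℂ))).congr_of_eventuallyEq ?_
      have hx' : ‖x‖ ^ 2 < 8 * (g + 1 : ℝ) ^ 2 := by
        have h1 : ‖x‖ ≤ 2 * (g + 1 : ℝ) := not_lt.1 hx
        have := pow_le_pow_left₀ (norm_nonneg x) h1 2
        nlinarith
      have hc : Continuous fun y : ℂ => ‖y‖ ^ 2 := by fun_prop
      filter_upwards [hc.continuousAt.eventually_lt continuousAt_const hx'] with y hy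
      exact hself y (full_twist_eq_self (Or.inl hy.le))
  · by_cases hx : x ∈ outerRegion g
    · rw [if_pos hx]
      exact div_ne_zero (outerRoot_ne_zero (hmem x hx)) (outerRoot_ne_zero hx)
    · rw [if_neg hx]
      exact one_ne_zero
  · by_cases hx : x ∈ outerRegion g
    · rw [if_pos hx, div_pow, poly, poly, ← outerRoot_sq hx, ← outerRoot_sq (hmem x hx)]
      exact div_mul_cancel₀ _ (pow_ne_zero 2 (outerRoot_ne_zero hx))
    · have h1 : ‖x‖ ≤ 2 * (g + 1 : ℝ) := not_lt.1 hx
      have h2 := pow_le_pow_left₀ (norm_nonneg x) h1 2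
      rw [if_neg hx, full_twist_eq_self (Or.inl (by nlinarith)), one_pow, one_mul]

/-- The lift preserves each sheet y = ± `outerRoot g x` over the outer region and acts on it as the
twist of the corresponding collar, so the equality holds without any isotopy. -/
theorem lift_full_twist :
    BaseDiffeo.lift ((isBlock_full g).diffeo * (isBlock_full g).diffeo : BaseDiffeo g) =
      (delta g).dehnTwist * (delta' g).dehnTwist := by
  refine Subtype.ext (Equiv.ext fun p => Subtype.ext ?_)
  set f := ((isBlock_full g).diffeo * (isBlock_full g).diffeo : BaseDiffeo g) with hf
  have hg' : (g + 1 : ℂ) ≠ 0 := by exact_mod_cast Nat.succ_ne_zero g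
  have hg1 : (0 : ℝ) < (g + 1 : ℝ) := by positivity
  change ((f : Equiv.Perm ℂ) p.1.1, BaseDiffeo.root f p.1.1 * p.1.2) =
    ((collarAnnulus g 1).twistFun 1 ((collarAnnulus g (-1)).twistFun 1 p) : ℂ × ℂ)
  rw [full_twist_root]
  beta_reduce
  by_cases hx : p.1.1 / (4 * (g + 1 : ℂ)) ∈ planarAnnulus
  · have h1 := (outer_mem g hx).1
    rw [show 4 * (g + 1 : ℂ) * (p.1.1 / (4 * (g + 1 : ℂ))) = p.1.1 by field_simp] at h1
    have hne := outerRoot_ne_zero h1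
    rw [if_pos h1]
    have hF : (f : Equiv.Perm ℂ) p.1.1 =
      4 * (g + 1 : ℂ) * planarTwist 1 (p.1.1 / (4 * (g + 1 : ℂ))) := full_twist_apply _
    have hsq : p.1.2 ^ 2 = outerRoot g p.1.1 ^ 2 := p.2.1.trans (outerRoot_sq h1).symm
    rcases sq_eq_sq_iff_eq_or_eq_neg.1 hsq with h | h
    · have hp : p ∈ (collarAnnulus g 1).target := collar_mem hx (by rw [h]; simp)
      rw [show (collarAnnulus g (-1)).twistFun 1 p = p from if_neg (collar_not_mem hp),
        collar_twist hp, ← hF, h, div_mul_cancel₀ _ hne, Units.val_one, Int.cast_one, one_mul]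
    · have hp : p ∈ (collarAnnulus g (-1)).target := collar_mem hx (by rw [h]; simp)
      have hq := collar_twist hp
      set q := (collarAnnulus g (-1)).twistFun 1 p with hqdef
      have hqx : q.1.1 / (4 * (g + 1 : ℂ)) ∈ planarAnnulus := by
        rw [hq]
        simp only
        rw [mul_div_cancel_left₀ _ (mul_ne_zero (by norm_num : (4 : ℂ) ≠ 0) hg')]
        exact planarTwist_mem hx
      have hqm : q ∈ (collarAnnulus g (-1)).target := collar_mem hqx (by rw [hq])
      have hqn := collar_not_mem hqm
      rw [neg_neg] at hqn
      rw [show (collarAnnulus g 1).twistFun 1 q = q from if_neg hqn, hq, ← hF, h, mul_neg,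
        div_mul_cancel₀ _ hne, Units.val_neg, Units.val_one, Int.cast_neg, Int.cast_one, neg_one_mul]
  · have h1 : ∀ s, (collarAnnulus g s).twistFun 1 p = p := fun s => if_neg fun h => hx h.2
    rw [h1, h1]
    have hF : (f : Equiv.Perm ℂ) p.1.1 = p.1.1 := by
      have h2 : (f : Equiv.Perm ℂ) p.1.1 =
        4 * (g + 1 : ℂ) * planarTwist 1 (p.1.1 / (4 * (g + 1 : ℂ))) := full_twist_apply _
      rw [h2, planarTwist_eq_self]
      · field_simp
      · by_contra! hcon
        have h0 := norm_nonneg (p.1.1 / (4 * (g + 1 : ℂ)))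
        exact hx ⟨by nlinarith, by nlinarith⟩
    rw [hF]
    split_ifs with h
    · rw [div_self (outerRoot_ne_zero h), one_mul]
    · rw [one_mul]

/-- The two boundary twists as a full twist of all branch points. -/
theorem delta_mul_delta' (g : ℕ) :
    (delta g).twistClass * (delta' g).twistClass = blockClass g 1 (2 * g + 2) ^ 2 := by
  rw [blockClass_eq (isBlock_full g), sq]
  change _ = BaseDiffeo.cl _ * BaseDiffeo.cl _
  rw [← map_mul]
  exact congrArg (QuotientGroup.mk (s := IsotopicToId (surface g) (surfaceBoundary g)))
    lift_full_twist.symm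

end Boundary

/-! ### Shears of annuli -/

/-- The map of the plane which rotates the circle `|z|² = t` by the angle `κ t`. -/
def shear (κ : ℝ → ℝ) (z : ℂ) : ℂ := z * Complex.exp (((κ (‖z‖ ^ 2) : ℝ) : ℂ) * Complex.I)

theorem norm_shear (κ : ℝ → ℝ) (z : ℂ) : ‖shear κ z‖ = ‖z‖ := by
  rw [shear, norm_mul, Complex.norm_exp_ofReal_mul_I, mul_one]

theorem shear_shear (κ κ' : ℝ → ℝ) (z : ℂ) :
    shear κ (shear κ' z) = shear (fun t => κ t + κ' t) z := by
  rw [shear, norm_shear, shear, shear, mul_assoc, ← Complex.exp_add]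
  congr 2
  push_cast
  ring

theorem shear_eq_self {κ : ℝ → ℝ} {z : ℂ} (h : κ (‖z‖ ^ 2) = 0) : shear κ z = z := by
  rw [shear, h]
  simp

theorem shear_mem {κ : ℝ → ℝ} {z : ℂ} (hz : z ∈ planarAnnulus) : shear κ z ∈ planarAnnulus := by
  change 1 / 2 < ‖shear κ z‖ ∧ ‖shear κ z‖ < 2
  rwa [norm_shear]

theorem ne_zero_of_mem_planarAnnulus {z : ℂ} (hz : z ∈ planarAnnulus) : z ≠ 0 :=
  norm_pos_iff.1 (by linarith [hz.1])

theorem contDiffAt_shear {κ : ℝ → ℝ} (hκ : ∀ t, 0 < t → ContDiffAt ℝ ∞ κ t) {y : ℝ × ℂ}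
    (hy : y.2 ≠ 0) :
    ContDiffAt ℝ ∞ (fun y : ℝ × ℂ => shear (fun t => y.1 * κ t) y.2) y := by
  have h1 : ContDiffAt ℝ ∞ (fun y : ℝ × ℂ => κ (‖y.2‖ ^ 2)) y :=
    (hκ _ (by positivity)).comp (f := fun y : ℝ × ℂ => ‖y.2‖ ^ 2) y
      ((contDiff_norm_sq ℝ).comp contDiff_snd).contDiffAt
  have h2 : ContDiffAt ℝ ∞ (fun y : ℝ × ℂ => ((y.1 * κ (‖y.2‖ ^ 2) : ℝ) : ℂ)) y :=
    Complex.ofRealCLM.contDiff.contDiffAt.comp y (contDiff_fst.contDiffAt.mul h1)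
  exact contDiff_snd.contDiffAt.mul (h2.mul contDiffAt_const).cexp

theorem differentiableAt_shear {κ : ℝ → ℝ} {z : ℂ} (hκ : DifferentiableAt ℝ κ (‖z‖ ^ 2)) :
    DifferentiableAt ℝ (shear κ) z := by
  have h1 : DifferentiableAt ℝ (fun z : ℂ => κ (‖z‖ ^ 2)) z :=
    hκ.comp z (f := fun z : ℂ => ‖z‖ ^ 2) (contDiff_norm_sq ℝ (n := 1)).contDiffAt.differentiableAt_one
  exact differentiableAt_id.mul
    ((Complex.ofRealCLM.differentiableAt.comp z h1).mul_const Complex.I).cexp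

/-- Shears preserve the area form of the plane. -/
theorem shear_area {κ : ℝ → ℝ} {z : ℂ} (hκ : DifferentiableAt ℝ κ (‖z‖ ^ 2)) (v w : ℂ) :
    (starRingEnd ℂ (fderiv ℝ (shear κ) z v) * fderiv ℝ (shear κ) z w).im =
      (starRingEnd ℂ v * w).im := by
  set c : ℝ := deriv κ (‖z‖ ^ 2) with hc
  have h1 : HasFDerivAt (fun z : ℂ => κ (‖z‖ ^ 2)) (c • (2 • innerSL ℝ z)) z :=
    hκ.hasDerivAt.comp_hasFDerivAt z (hasStrictFDerivAt_norm_sq z).hasFDerivAt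
  have h2 : HasFDerivAt (fun z : ℂ => ((κ (‖z‖ ^ 2) : ℝ) : ℂ) * Complex.I)
      ((Complex.ofRealCLM.comp (c • (2 • innerSL ℝ z))).smulRight Complex.I) z :=
    (Complex.ofRealCLM.hasFDerivAt.comp z h1).mul_const' Complex.I
  have h3 := (hasFDerivAt_id (𝕜 := ℝ) z).mul h2.cexp
  have h4 : fderiv ℝ (shear κ) z = _ := h3.fderiv
  set e : ℂ := Complex.exp (((κ (‖z‖ ^ 2) : ℝ) : ℂ) * Complex.I) with he
  have hee : starRingEnd ℂ e * e = 1 := by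
    rw [← Complex.normSq_eq_conj_mul_self, Complex.normSq_eq_norm_sq, he,
      Complex.norm_exp_ofReal_mul_I]
    simp
  have h5 : ∀ u : ℂ, fderiv ℝ (shear κ) z u =
      e * (u + z * ((c * (2 * (starRingEnd ℂ z * u).re) : ℝ) : ℂ) * Complex.I) := by
    intro u
    rw [h4]
    simp [Complex.inner]
    ring
  rw [h5, h5, map_mul]
  have : ∀ a b : ℂ, starRingEnd ℂ e * a * (e * b) = a * b := by
    intro a b
    calc _ = (starRingEnd ℂ e * e) * (a * b) := by ring
      _ = _ := by rw [hee, one_mul]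
  rw [this]
  simp
  ring

/-- A smooth profile supported in the interior of the planar annulus. -/
structure IsShearProfile (κ : ℝ → ℝ) : Prop where
  smooth : ∀ t, 0 < t → ContDiffAt ℝ ∞ κ t
  support : ∀ t, 0 < t → κ t ≠ 0 → 13 / 50 ≤ t ∧ t ≤ 19 / 5

theorem IsShearProfile.mul {κ : ℝ → ℝ} (hκ : IsShearProfile κ) (r : ℝ) :
    IsShearProfile fun t => r * κ t :=
  ⟨fun t ht => contDiffAt_const.mul (hκ.smooth t ht),
    fun t ht h => hκ.support t ht (right_ne_zero_of_mul h)⟩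

namespace EmbeddedAnnulus

variable {S B : Set (ℂ × ℂ)} (A : EmbeddedAnnulus S B) {κ : ℝ → ℝ}

open Classical in
/-- The shear of an embedded annulus. -/
def shearFun (κ : ℝ → ℝ) (p : S) : S :=
  if p ∈ A.target then A.toFun (shear κ (A.invFun p)) else p

theorem shearFun_shearFun (κ κ' : ℝ → ℝ) (p : S) :
    A.shearFun κ (A.shearFun κ' p) = A.shearFun (fun t => κ t + κ' t) p := by
  by_cases hp : p ∈ A.target
  · have h1 : shear κ' (A.invFun p) ∈ planarAnnulus := shear_mem (A.invFun_mem hp)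
    have h2 : A.shearFun κ' p = A.toFun (shear κ' (A.invFun p)) := if_pos hp
    rw [h2, shearFun, if_pos (A.toFun_mem h1), A.invFun_toFun h1, shear_shear, shearFun, if_pos hp]
  · have h2 : ∀ κ, A.shearFun κ p = p := fun κ => if_neg hp
    rw [h2, h2, h2]

theorem shearFun_zero (p : S) : A.shearFun (fun _ => 0) p = p := by
  by_cases hp : p ∈ A.target
  · rw [shearFun, if_pos hp, shear_eq_self rfl]
    exact A.right_inv' hp
  · exact if_neg hp

theorem twistFun_eq_shearFun (n : ℤ) (p : S) : A.twistFun n p =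
    A.shearFun (fun t => -(2 * Real.pi * n * Real.smoothTransition (t - 1 / 2))) p := rfl

/-- The neighbourhood works for all r at once, as smoothness in (r, p) jointly requires. -/
theorem shearFun_local (hκ : IsShearProfile κ) (p : S) (hp : p ∉ A.target) :
    ∀ᶠ q in 𝓝 p, ∀ r : ℝ, A.shearFun (fun t => r * κ t) q = q := by
  set K : Set ℂ := {z | 13 / 50 ≤ ‖z‖ ^ 2 ∧ ‖z‖ ^ 2 ≤ 19 / 5} with hK
  have hKs : K ⊆ planarAnnulus := by
    intro z hz
    have h0 := norm_nonneg z
    constructor <;> nlinarith [hz.1, hz.2]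
  have hKc : IsCompact K := by
    refine Metric.isCompact_of_isClosed_isBounded ?_ ?_
    · have hn : Continuous fun z : ℂ => ‖z‖ ^ 2 := by fun_prop
      exact (isClosed_le continuous_const hn).inter (isClosed_le hn continuous_const)
    · refine (Metric.isBounded_closedBall (x := (0 : ℂ)) (r := 2)).subset fun z hz => ?_
      rw [mem_closedBall_zero_iff]
      exact (hKs hz).2.le
  have hcont : ContinuousOn A.toFun K := by
    intro z hz
    have h1 := A.smooth_toFun z (by rw [A.source_eq]; exact hKs hz)
    have h2 : ContinuousAt (fun w => (A.toFun w : ℂ × ℂ)) z :=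
      h1.continuousAt Topology.IsInducing.id
    exact (Topology.IsInducing.subtypeVal.continuousAt_iff.2 h2).continuousWithinAt
  have hcl : IsClosed (A.toFun '' K) := (hKc.image_of_continuousOn hcont).isClosed
  have hpK : p ∉ A.toFun '' K := by
    rintro ⟨z, hz, rfl⟩
    exact hp (A.toFun_mem (hKs hz))
  filter_upwards [hcl.isOpen_compl.mem_nhds hpK] with q hq r
  by_cases hqt : q ∈ A.target
  · rw [shearFun, if_pos hqt, shear_eq_self]
    · exact A.right_inv' hqt
    · have hne := ne_zero_of_mem_planarAnnulus (A.invFun_mem hqt)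
      have h0 : κ (‖A.invFun q‖ ^ 2) = 0 := by
        by_contra hcon
        exact hq ⟨A.invFun q, hκ.support _ (by positivity) hcon, A.right_inv' hqt⟩
      change r * κ _ = 0
      rw [h0, mul_zero]
  · rw [shearFun, if_neg hqt]

theorem shearFun_smooth_family (hκ : IsShearProfile κ) (x : ℝ × S) :
    SmoothAt (fun y : ℝ × S => (y.1, (y.2 : ℂ × ℂ)))
      (fun y : ℝ × S => (A.shearFun (fun t => y.1 * κ t) y.2 : ℂ × ℂ)) x := by
  have hind : Topology.IsInducing fun y : ℝ × S => (y.1, (y.2 : ℂ × ℂ)) :=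
    Topology.IsInducing.id.prodMap Topology.IsInducing.subtypeVal
  by_cases hp : x.2 ∈ A.target
  · have hmem := A.invFun_mem hp
    have h1 : SmoothAt (fun y : ℝ × S => (y.1, (y.2 : ℂ × ℂ)))
        (fun y : ℝ × S => (y.1, A.invFun y.2)) x := by
      obtain ⟨V, hV, k, hk, hkV⟩ := A.smooth_invFun x.2 hp
      refine ⟨Set.univ ×ˢ V, prod_mem_nhds Filter.univ_mem hV, fun y => (y.1, k y.2), ?_,
        fun q hq => Prod.ext rfl (hkV q.2 hq.2)⟩
      exact contDiff_fst.contDiffOn.prodMk (hk.comp contDiff_snd.contDiffOn fun y hy => hy.2)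
    have h2 : SmoothAt (id : ℝ × ℂ → ℝ × ℂ) (fun y : ℝ × ℂ => shear (fun t => y.1 * κ t) y.2)
        (x.1, A.invFun x.2) := by
      refine SmoothAt.of_contDiffWithin (s := {y : ℝ × ℂ | y.2 ≠ 0}) ?_ fun y hy =>
        (contDiffAt_shear hκ.smooth hy).contDiffWithinAt
      exact (isOpen_ne.preimage continuous_snd).mem_nhds (ne_zero_of_mem_planarAnnulus hmem)
    have h3 : SmoothAt (fun y : ℝ × S => (y.1, (y.2 : ℂ × ℂ)))
        (fun y : ℝ × S => shear (fun t => y.1 * κ t) (A.invFun y.2)) x :=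
      SmoothAt.comp (ιY := id) (f := fun y : ℝ × S => (y.1, A.invFun y.2)) h2 h1
    have h4 : shear (fun t => x.1 * κ t) (A.invFun x.2) ∈ A.source := by
      rw [A.source_eq]; exact shear_mem hmem
    have h5 : SmoothAt (fun y : ℝ × S => (y.1, (y.2 : ℂ × ℂ)))
        (fun y : ℝ × S => (A.toFun (shear (fun t => y.1 * κ t) (A.invFun y.2)) : ℂ × ℂ)) x :=
      SmoothAt.comp (ιY := id) (f := fun y : ℝ × S => shear (fun t => y.1 * κ t) (A.invFun y.2))
        (g := fun w => (A.toFun w : ℂ × ℂ)) (A.smooth_toFun _ h4) h3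
    refine h5.congr hind ?_
    filter_upwards [(A.isOpen_target.preimage continuous_snd).mem_nhds hp] with q hq
    rw [shearFun, if_pos (show q.2 ∈ A.target from hq)]
  · have h1 : SmoothAt (fun y : ℝ × S => (y.1, (y.2 : ℂ × ℂ))) (fun y => (y.2 : ℂ × ℂ)) x :=
      ⟨Set.univ, Filter.univ_mem, Prod.snd, contDiff_snd.contDiffOn, fun _ _ => rfl⟩
    refine h1.congr hind ?_
    filter_upwards [continuous_snd.continuousAt.eventually (A.shearFun_local hκ x.2 hp)] with q hq
    rw [hq]

theorem shearFun_smooth (hκ : IsShearProfile κ) (p : S) :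
    SmoothAt Subtype.val (fun q => (A.shearFun κ q : ℂ × ℂ)) p := by
  have h1 : SmoothAt Subtype.val (fun q : S => ((1 : ℝ), (q : ℂ × ℂ))) p :=
    ⟨Set.univ, Filter.univ_mem, fun y => (1, y), (contDiff_const.prodMk contDiff_id).contDiffOn,
      fun _ _ => rfl⟩
  have h2 := SmoothAt.comp (f := fun q : S => ((1 : ℝ), q)) (A.shearFun_smooth_family hκ (1, p)) h1
  simpa only [one_mul] using h2

theorem shearFun_orientation (hκ : IsShearProfile κ) : OrientationPreserving (A.shearFun κ) := by
  intro φ z hφ hpos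
  have hcont : ContinuousAt φ z :=
    Topology.IsInducing.subtypeVal.continuousAt_iff.2
      (hφ.continuousAt Topology.IsInducing.id)
  by_cases hp : φ z ∈ A.target
  · have hev : ∀ᶠ w in 𝓝 z, φ w ∈ A.target := hcont (A.isOpen_target.mem_nhds hp)
    have hψd := SmoothAt.differentiableAt ((A.smooth_invFun _ hp).comp hφ)
    have hmem := A.invFun_mem hp
    have hκd : DifferentiableAt ℝ κ (‖A.invFun (φ z)‖ ^ 2) := by
      have hne := ne_zero_of_mem_planarAnnulus hmem
      exact (hκ.smooth _ (by positivity)).differentiableAt (by simp)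
    have hτd := differentiableAt_shear hκd
    have e1 : (fun w => (φ w : ℂ × ℂ)) =ᶠ[𝓝 z] fun w => (A.toFun (A.invFun (φ w)) : ℂ × ℂ) := by
      filter_upwards [hev] with w hw
      exact congrArg Subtype.val (A.right_inv' hw).symm
    have e2 : (fun w => (A.shearFun κ (φ w) : ℂ × ℂ)) =ᶠ[𝓝 z]
        fun w => (A.toFun (shear κ (A.invFun (φ w))) : ℂ × ℂ) := by
      filter_upwards [hev] with w hw
      rw [shearFun, if_pos hw]
    rw [PosAt, e1.fderiv_eq] at hpos
    have h1 := (A.posAt_comp hψd hmem).1 hpos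
    rw [PosAt, e2.fderiv_eq]
    have e5 : DifferentiableAt ℝ (fun w => shear κ (A.invFun (φ w))) z :=
      DifferentiableAt.comp (g := shear κ) z hτd hψd
    have e3 : fderiv ℝ (fun w => shear κ (A.invFun (φ w))) z =
        (fderiv ℝ (shear κ) (A.invFun (φ z))).comp (fderiv ℝ (fun w => A.invFun (φ w)) z) :=
      fderiv_comp (g := shear κ) z hτd hψd
    refine (A.posAt_comp (ψ := fun w => shear κ (A.invFun (φ w))) e5 (shear_mem hmem)).2 ?_
    rw [e3, ContinuousLinearMap.comp_apply, ContinuousLinearMap.comp_apply, shear_area hκd]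
    exact h1
  · have e1 : (fun w => (A.shearFun κ (φ w) : ℂ × ℂ)) =ᶠ[𝓝 z] fun w => (φ w : ℂ × ℂ) := by
      filter_upwards [hcont (A.shearFun_local hκ _ hp)] with w hw
      have := hw 1
      simp only [one_mul] at this
      rw [this]
    rw [PosAt, e1.fderiv_eq]
    exact hpos

/-- The shear of an embedded annulus as a diffeomorphism. -/
def shearDiffeo (hκ : IsShearProfile κ) : DiffPlus S B :=
  ⟨{ toFun := A.shearFun κ
     invFun := A.shearFun fun t => -1 * κ t
     left_inv := fun p => by
      rw [shearFun_shearFun]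
      simp only [neg_one_mul, neg_add_cancel]
      exact A.shearFun_zero p
     right_inv := fun p => by
      rw [shearFun_shearFun]
      simp only [neg_one_mul, add_neg_cancel]
      exact A.shearFun_zero p },
    A.shearFun_smooth hκ, A.shearFun_smooth (hκ.mul (-1)), A.shearFun_orientation hκ,
    A.shearFun_orientation (hκ.mul (-1)),
    fun p hp => if_neg fun h => A.disjoint_boundary p h hp⟩

/-- The angle vanishes near both ends of the annulus, so multiplying it by r keeps the map smooth
and joins it to the identity. The angle of a Dehn twist, which is 0 at one end and −2π at the other,
admits no such scaling. -/
theorem shearDiffeo_isotopic (hκ : IsShearProfile κ) : A.shearDiffeo hκ ∈ IsotopicToId S B := by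
  refine ⟨fun r => A.shearDiffeo (hκ.mul r), A.shearFun_smooth_family hκ, ?_, ?_⟩
  · refine Subtype.ext (Equiv.ext fun p => ?_)
    change A.shearFun (fun t => 0 * κ t) p = p
    simp only [zero_mul]
    exact A.shearFun_zero p
  · refine Subtype.ext (Equiv.ext fun p => ?_)
    change A.shearFun (fun t => 1 * κ t) p = A.shearFun κ p
    simp only [one_mul]

end EmbeddedAnnulus

/-! ### Half twists of ellipses -/

section Ellipse

/-- A function whose level sets are the ellipses with foci `± √q`. -/
def ellLevel (q : ℝ) (X : ℂ) : ℝ := (‖X‖ ^ 2 + ‖X ^ 2 - q‖ + q) / 2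

/-- The square root of `X² - q` which is asymptotic to `X`. -/
def ellRoot (q : ℝ) (X : ℂ) : ℂ := X * csqrt (1 - q / X ^ 2)

variable {q : ℝ}

theorem ellLevel_neg (q : ℝ) (X : ℂ) : ellLevel q (-X) = ellLevel q X := by
  rw [ellLevel, norm_neg, neg_sq, ellLevel]

theorem continuous_ellLevel : Continuous fun p : ℝ × ℂ => ellLevel p.1 p.2 := by
  unfold ellLevel
  fun_prop

theorem norm_sq_le_ellLevel (hq : 0 ≤ q) (X : ℂ) : ‖X‖ ^ 2 ≤ ellLevel q X := by
  have h1 := norm_sub_norm_le (X ^ 2) q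
  rw [norm_pow, Complex.norm_real, Real.norm_eq_abs, abs_of_nonneg hq] at h1
  rw [ellLevel]
  linarith

/-- The value of `ellLevel` is the square of the semi-major axis. The points ± 1 lie on level 1 for
every q ≤ 1, thus always inside level 5/4, where the half twist is X ↦ −X; this makes the family
affine near both branch points. -/
theorem ellLevel_one_real {X : ℂ} (hq1 : q ≤ 1) (hX : X ^ 2 = 1) :
    ellLevel q X = 1 := by
  have h1 : ‖X‖ ^ 2 = 1 := by rw [← norm_pow, hX, norm_one]
  rw [ellLevel, h1, hX, show (1 - q : ℂ) = ((1 - q : ℝ) : ℂ) by push_cast; ring, Complex.norm_real,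
    Real.norm_eq_abs, abs_of_nonneg (by linarith)]
  ring

theorem ne_zero_of_ellLevel (hq : 0 ≤ q) {X : ℂ} (hX : q < ellLevel q X) : X ≠ 0 := by
  rintro rfl
  rw [ellLevel] at hX
  simp only [norm_zero, ne_eq, OfNat.ofNat_ne_zero, not_false_eq_true, zero_pow, zero_sub, norm_neg,
    Complex.norm_real, Real.norm_eq_abs, abs_of_nonneg hq] at hX
  linarith

/-- If 1 − q / X² were real and nonpositive, X² would be a real number between 0 and q. Then X lies
on the segment between the foci, where the level is only q. -/
theorem mem_slitPlane_of_ellLevel (hq : 0 ≤ q) {X : ℂ} (hX : q < ellLevel q X) :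
    1 - q / X ^ 2 ∈ Complex.slitPlane := by
  by_contra hcon
  have hX0 := ne_zero_of_ellLevel hq hX
  set w := X ^ 2 with hw
  have hw0 : w ≠ 0 := pow_ne_zero 2 hX0
  rw [Complex.mem_slitPlane_iff, not_or, not_lt, not_not] at hcon
  obtain ⟨h1, h2⟩ := hcon
  set t : ℝ := 1 - (1 - (q : ℂ) / w).re with ht
  have ht1 : 1 ≤ t := by linarith
  have e1 : (q : ℂ) / w = t := by
    apply Complex.ext
    · rw [ht, Complex.sub_re, Complex.one_re, Complex.ofReal_re]
      ring
    · rw [Complex.sub_im, Complex.one_im] at h2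
      rw [Complex.ofReal_im]
      linarith
  have e2 : w = ((q / t : ℝ) : ℂ) := by
    have ht0 : (t : ℂ) ≠ 0 := by exact_mod_cast (by linarith : t ≠ 0)
    rw [div_eq_iff hw0] at e1
    rw [Complex.ofReal_div, e1, mul_div_cancel_left₀ _ ht0]
  have e3 : q / t ≤ q := div_le_self hq ht1
  have e4 : 0 ≤ q / t := by positivity
  rw [ellLevel, ← norm_pow, ← hw, e2, ← Complex.ofReal_sub, Complex.norm_real, Complex.norm_real,
    Real.norm_eq_abs, Real.norm_eq_abs, abs_of_nonneg e4, abs_of_nonpos (by linarith)] at hX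
  linarith

theorem ellRoot_sq (hq : 0 ≤ q) {X : ℂ} (hX : q < ellLevel q X) :
    ellRoot q X ^ 2 = X ^ 2 - q := by
  have hX0 := ne_zero_of_ellLevel hq hX
  rw [ellRoot, mul_pow, csqrt_sq (Complex.slitPlane_ne_zero (mem_slitPlane_of_ellLevel hq hX))]
  field_simp

theorem ellRoot_div_re_pos (hq : 0 ≤ q) {X : ℂ} (hX : q < ellLevel q X) :
    0 < (ellRoot q X / X).re := by
  rw [ellRoot, mul_div_cancel_left₀ _ (ne_zero_of_ellLevel hq hX)]
  exact csqrt_re_pos (mem_slitPlane_of_ellLevel hq hX)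

theorem div_re_pos_iff {X W : ℂ} (hX : X ≠ 0) : 0 < (W / X).re ↔ 0 < (W * starRingEnd ℂ X).re := by
  have h : 0 < Complex.normSq X := Complex.normSq_pos.2 hX
  rw [Complex.div_re, ← add_div, div_pos_iff_of_pos_right h]
  simp

theorem eq_ellRoot {X W : ℂ} (hX : X ≠ 0) (hre : 0 < (W * starRingEnd ℂ X).re)
    (hW : W ^ 2 = X ^ 2 - q) : ellRoot q X = W := by
  rw [ellRoot, eq_csqrt ((div_re_pos_iff hX).2 hre), mul_div_cancel₀ _ hX]
  rw [div_pow, hW]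
  field_simp

/-- The ellipses are invariant under the flow of `i √(X² - q)`. -/
theorem ellipse_rotate (hq : 0 ≤ q) {X : ℂ} (hX : q < ellLevel q X) {c s : ℝ}
    (hcs : c ^ 2 + s ^ 2 = 1) :
    ellLevel q (c * X + Complex.I * s * ellRoot q X) = ellLevel q X ∧
      ellRoot q (c * X + Complex.I * s * ellRoot q X) = c * ellRoot q X + Complex.I * s * X := by
  -- With X = (w + q / w) / 2 and Y = (w − q / w) / 2, the flow is the rotation w ↦ e^{iα} w, where
  -- c = cos α and s = sin α; hence confocal ellipses are preserved and the root rotates along.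
  set Y := ellRoot q X with hY
  have hY2 : Y ^ 2 = X ^ 2 - q := ellRoot_sq hq hX
  have hcs' : (c : ℂ) ^ 2 + (s : ℂ) ^ 2 = 1 := by exact_mod_cast hcs
  have hre := (div_re_pos_iff (ne_zero_of_ellLevel hq hX)).1 (ellRoot_div_re_pos hq hX)
  rw [← hY] at hre
  have hsq : (c * Y + Complex.I * s * X) ^ 2 = (c * X + Complex.I * s * Y) ^ 2 - q := by
    have hI := Complex.I_sq
    linear_combination (c ^ 2 - Complex.I ^ 2 * s ^ 2) * hY2 - q * hcs' + s ^ 2 * q * hI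
  have hnorm : ∀ z : ℂ, ‖z‖ ^ 2 = z.re ^ 2 + z.im ^ 2 := fun z => by
    rw [← Complex.normSq_eq_norm_sq, Complex.normSq_apply]
    ring
  have hlev : ellLevel q (c * X + Complex.I * s * Y) = ellLevel q X := by
    rw [ellLevel, ellLevel, ← hsq, ← hY2, norm_pow, norm_pow, hnorm, hnorm, hnorm, hnorm]
    simp only [Complex.add_re, Complex.add_im, Complex.mul_re, Complex.mul_im, Complex.ofReal_re,
      Complex.ofReal_im, Complex.I_re, Complex.I_im]
    linear_combination (X.re ^ 2 + X.im ^ 2 + Y.re ^ 2 + Y.im ^ 2) / 2 * hcs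
  refine ⟨hlev, eq_ellRoot (ne_zero_of_ellLevel hq (by rwa [hlev])) ?_ hsq⟩
  have e : ((c * Y + Complex.I * s * X) * starRingEnd ℂ (c * X + Complex.I * s * Y)).re =
      (c ^ 2 + s ^ 2) * (Y * starRingEnd ℂ X).re := by
    simp only [map_add, map_mul, Complex.conj_ofReal, Complex.conj_I, Complex.add_re, Complex.add_im,
      Complex.mul_re, Complex.mul_im, Complex.ofReal_re, Complex.ofReal_im, Complex.I_re,
      Complex.I_im, Complex.conj_re, Complex.conj_im, Complex.neg_re, Complex.neg_im]
    ring
  rw [e, hcs, one_mul]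
  exact hre

/-- The angle by which the half twist moves the ellipse through `X`. -/
def ellAngle (θ q : ℝ) (X : ℂ) : ℝ := θ * cutoff (5 / 4) (3 / 2) (ellLevel q X)

/-- The half twist of the ellipses with foci `± √q`. -/
def ellTwistFun (θ q : ℝ) (X : ℂ) : ℂ :=
  (Real.cos (ellAngle θ q X) : ℝ) * X + Complex.I * (Real.sin (ellAngle θ q X) : ℝ) * ellRoot q X

theorem ellAngle_inner (θ : ℝ) {X : ℂ} (hX : ellLevel q X ≤ 5 / 4) : ellAngle θ q X = θ := by
  rw [ellAngle, cutoff_eq_one (by norm_num) hX, mul_one]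

theorem ellAngle_outer (θ : ℝ) {X : ℂ} (hX : 3 / 2 ≤ ellLevel q X) : ellAngle θ q X = 0 := by
  rw [ellAngle, cutoff_eq_zero (by norm_num) hX, mul_zero]

/-- For θ = ± π the sine vanishes and with it the term containing `ellRoot`, which jumps across the
segment between the foci. Thus the half twist is smooth there. -/
theorem ellTwistFun_inner {θ : ℝ} (hθ : Real.cos θ = -1) {X : ℂ} (hX : ellLevel q X ≤ 5 / 4) :
    ellTwistFun θ q X = -X := by
  have hs : Real.sin θ = 0 := by
    have := Real.sin_sq_add_cos_sq θ
    rw [hθ] at this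
    nlinarith
  rw [ellTwistFun, ellAngle_inner θ hX, hθ, hs]
  simp

theorem ellTwistFun_outer (θ : ℝ) {X : ℂ} (hX : 3 / 2 ≤ ellLevel q X) : ellTwistFun θ q X = X := by
  rw [ellTwistFun, ellAngle_outer θ hX]
  simp

theorem ellTwistFun_level (hq : 0 ≤ q) (hq1 : q ≤ 1) {θ : ℝ} (hθ : Real.cos θ = -1) (X : ℂ) :
    ellLevel q (ellTwistFun θ q X) = ellLevel q X := by
  rcases le_or_gt (ellLevel q X) (5 / 4) with h | h
  · rw [ellTwistFun_inner hθ h, ellLevel_neg]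
  · exact (ellipse_rotate hq (by linarith) (Real.cos_sq_add_sin_sq _)).1

theorem ellTwistFun_neg (hq : 0 ≤ q) (hq1 : q ≤ 1) {θ : ℝ} (hθ : Real.cos θ = -1) (X : ℂ) :
    ellTwistFun (-θ) q (ellTwistFun θ q X) = X := by
  have hθ' : Real.cos (-θ) = -1 := by rw [Real.cos_neg, hθ]
  rcases le_or_gt (ellLevel q X) (5 / 4) with h | h
  · rw [ellTwistFun_inner hθ h, ellTwistFun_inner hθ' (by rwa [ellLevel_neg]), neg_neg]
  · obtain ⟨h1, h2⟩ := ellipse_rotate hq (by linarith : q < ellLevel q X)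
      (Real.cos_sq_add_sin_sq (ellAngle θ q X))
    have h3 : ellAngle (-θ) q (ellTwistFun θ q X) = -ellAngle θ q X := by
      rw [ellAngle, ellTwistFun_level hq hq1 hθ, ellAngle, neg_mul]
    rw [ellTwistFun, h3, Real.cos_neg, Real.sin_neg]
    rw [ellTwistFun, h2]
    have hcs : ((Real.cos (ellAngle θ q X) : ℝ) : ℂ) ^ 2 + ((Real.sin (ellAngle θ q X) : ℝ) : ℂ) ^ 2
        = 1 := by exact_mod_cast Real.cos_sq_add_sin_sq _
    have hI := Complex.I_sq
    push_cast at hcs ⊢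
    linear_combination X * hcs - X * Complex.sin (ellAngle θ q X) ^ 2 * hI

theorem contDiffAt_ellLevel {p : ℝ × ℂ} (hq : 0 ≤ p.1) (hp : p.1 < ellLevel p.1 p.2) :
    ContDiffAt ℝ ∞ (fun p : ℝ × ℂ => ellLevel p.1 p.2) p := by
  have h0 : p.2 ^ 2 - (p.1 : ℂ) ≠ 0 := by
    rw [← ellRoot_sq hq hp]
    exact pow_ne_zero 2 (mul_ne_zero (ne_zero_of_ellLevel hq hp) (csqrt_ne_zero _))
  have h1 : ContDiffAt ℝ ∞ (fun p : ℝ × ℂ => p.2 ^ 2 - (p.1 : ℂ)) p :=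
    ((contDiff_snd.pow 2).sub (Complex.ofRealCLM.contDiff.comp contDiff_fst)).contDiffAt
  exact (((((contDiff_norm_sq ℝ).comp contDiff_snd).contDiffAt).add (h1.norm ℝ h0)).add
    contDiff_fst.contDiffAt).div_const 2

theorem contDiffAt_ellRoot {p : ℝ × ℂ} (hq : 0 ≤ p.1) (hp : p.1 < ellLevel p.1 p.2) :
    ContDiffAt ℝ ∞ (fun p : ℝ × ℂ => ellRoot p.1 p.2) p := by
  have hX := ne_zero_of_ellLevel hq hp
  have h1 : ContDiffAt ℝ ∞ (fun p : ℝ × ℂ => 1 - (p.1 : ℂ) * (p.2 ^ 2)⁻¹) p :=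
    contDiffAt_const.sub ((Complex.ofRealCLM.contDiff.comp contDiff_fst).contDiffAt.mul
      ((contDiff_snd.pow 2).contDiffAt.inv (pow_ne_zero 2 hX)))
  have h2 : ContDiffAt ℝ ∞ csqrt (1 - (p.1 : ℂ) * (p.2 ^ 2)⁻¹) := by
    rw [← div_eq_mul_inv]
    exact (contDiffAt_csqrt (mem_slitPlane_of_ellLevel hq hp)).restrict_scalars ℝ
  have h3 := h2.comp p h1
  simp only [ellRoot, div_eq_mul_inv]
  exact contDiff_snd.contDiffAt.mul h3

theorem contDiffAt_ellAngle (θ : ℝ) {p : ℝ × ℂ} (hq : 0 ≤ p.1) (hp : p.1 < ellLevel p.1 p.2) :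
    ContDiffAt ℝ ∞ (fun p : ℝ × ℂ => ellAngle θ p.1 p.2) p :=
  contDiffAt_const.mul (((contDiff_cutoff _ _).contDiffAt).comp p (contDiffAt_ellLevel hq hp))

theorem contDiffAt_ellTwistFun {θ : ℝ} (hθ : Real.cos θ = -1) {p : ℝ × ℂ} (hq : 0 ≤ p.1)
    (hq1 : p.1 ≤ 1) : ContDiffAt ℝ ∞ (fun p : ℝ × ℂ => ellTwistFun θ p.1 p.2) p := by
  rcases lt_or_ge (ellLevel p.1 p.2) (5 / 4) with h | h
  · refine (contDiff_snd.neg.contDiffAt (x := p)).congr_of_eventuallyEq ?_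
    filter_upwards [continuous_ellLevel.continuousAt.eventually_lt continuousAt_const h] with y hy
    exact ellTwistFun_inner hθ hy.le
  · have hp : p.1 < ellLevel p.1 p.2 := by linarith
    have h1 := contDiffAt_ellAngle θ hq hp
    exact ((Complex.ofRealCLM.contDiff.contDiffAt.comp p (Real.contDiff_cos.contDiffAt.comp p h1)).mul
      contDiff_snd.contDiffAt).add ((contDiffAt_const.mul (Complex.ofRealCLM.contDiff.contDiffAt.comp p
        (Real.contDiff_sin.contDiffAt.comp p h1))).mul (contDiffAt_ellRoot hq hp))

theorem ellTwistFun_zero_param (θ : ℝ) (X : ℂ) :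
    ellTwistFun θ 0 X = X * Complex.exp (((θ * cutoff (5 / 4) (3 / 2) (‖X‖ ^ 2) : ℝ) : ℂ) *
      Complex.I) := by
  have h1 : ellLevel 0 X = ‖X‖ ^ 2 := by
    rw [ellLevel, Complex.ofReal_zero, sub_zero, norm_pow]
    ring
  have h2 : ellRoot 0 X = X := by
    rw [ellRoot, Complex.ofReal_zero, zero_div, sub_zero,
      eq_csqrt (w := 1) (by norm_num) (one_pow 2), mul_one]
  rw [ellTwistFun, ellAngle, h1, h2, Complex.exp_mul_I, Complex.ofReal_cos, Complex.ofReal_sin]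
  ring

end Ellipse

section EllipseFamily

variable {g i : ℕ}

theorem cos_neg_pi : Real.cos (-Real.pi) = -1 := by rw [Real.cos_neg, Real.cos_pi]

/-- The half twist of an ellipse around `p_i` and `p_{i+1}`, with foci which depend on `s`. -/
def ellTwist (g i : ℕ) (s : ℝ) : Equiv.Perm ℂ where
  toFun x := midPoint g i + ellTwistFun Real.pi (Real.smoothTransition s) (x - midPoint g i)
  invFun x := midPoint g i + ellTwistFun (-Real.pi) (Real.smoothTransition s) (x - midPoint g i)
  left_inv x := by
    beta_reduce
    rw [add_sub_cancel_left, ellTwistFun_neg (Real.smoothTransition.nonneg s)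
      (Real.smoothTransition.le_one s) Real.cos_pi, add_sub_cancel]
  right_inv x := by
    have := ellTwistFun_neg (Real.smoothTransition.nonneg s) (Real.smoothTransition.le_one s)
      cos_neg_pi (x - midPoint g i)
    rw [neg_neg] at this
    beta_reduce
    rw [add_sub_cancel_left, this, add_sub_cancel]

theorem ellLevel_outer (hi : 1 ≤ i ∧ i ≤ 2 * g + 1) {q : ℝ} (hq : 0 ≤ q) {x : ℂ}
    (hx : innerRadius g ≤ ‖x‖) : 2 ≤ ellLevel q (x - midPoint g i) := by
  have h1 := norm_sub_norm_le x (midPoint g i)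
  have h3 : ‖(midPoint g i : ℂ)‖ ≤ 2 * g := by
    have h4 : (1 : ℝ) ≤ i := by exact_mod_cast hi.1
    have h5 : (i : ℝ) ≤ 2 * g + 1 := by exact_mod_cast hi.2
    rw [Complex.norm_real, Real.norm_eq_abs, abs_le, midPoint, branchPoint]
    constructor <;> linarith
  have h6 : (0 : ℝ) ≤ g := Nat.cast_nonneg g
  rw [innerRadius] at hx
  have h7 : 7 ≤ ‖x - midPoint g i‖ := by linarith
  have h8 := norm_sq_le_ellLevel hq (x - midPoint g i)
  nlinarith

theorem ellTwist_smoothFamily (hi : 1 ≤ i ∧ i ≤ 2 * g + 1) : SmoothFamily g (ellTwist g i) := by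
  have key : ∀ θ : ℝ, Real.cos θ = -1 → ContDiff ℝ ∞ fun p : ℝ × ℂ => (midPoint g i : ℂ) +
      ellTwistFun θ (Real.smoothTransition p.1) (p.2 - midPoint g i) := by
    intro θ hθ
    refine contDiff_const.add (contDiff_iff_contDiffAt.2 fun p => ?_)
    exact (contDiffAt_ellTwistFun (p := (Real.smoothTransition p.1, p.2 - (midPoint g i : ℂ))) hθ
      (Real.smoothTransition.nonneg _) (Real.smoothTransition.le_one _)).comp p
      ((Real.smoothTransition.contDiff.comp contDiff_fst).prodMk
        (contDiff_snd.sub contDiff_const)).contDiffAt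
  refine ⟨key _ Real.cos_pi, key _ cos_neg_pi, fun s x hx => ?_⟩
  have h := ellLevel_outer hi (Real.smoothTransition.nonneg s) hx
  change (midPoint g i : ℂ) + ellTwistFun _ _ _ = x
  rw [ellTwistFun_outer _ (by linarith), add_sub_cancel]

theorem branchPoint_sub_midPoint_sq {k : ℕ} (hk : k = i ∨ k = i + 1) :
    ((branchPoint g k : ℂ) - midPoint g i) ^ 2 = 1 := by
  rcases hk with rfl | rfl
  · rw [midPoint, branchPoint]
    push_cast
    ring
  · rw [midPoint, branchPoint, branchPoint]
    push_cast
    ring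

theorem ellLevel_branchPoint_outer {k : ℕ} (hk : k ≠ i) (hk' : k ≠ i + 1) {q : ℝ} (hq : 0 ≤ q) :
    2 ≤ ellLevel q (branchPoint g k - midPoint g i) := by
  have h1 := norm_sq_le_ellLevel hq ((branchPoint g k : ℂ) - midPoint g i)
  rw [← Complex.ofReal_sub, Complex.norm_real, Real.norm_eq_abs, sq_abs] at h1
  rw [← Complex.ofReal_sub]
  have h2 : (k : ℝ) + 1 ≤ i ∨ (i : ℝ) + 2 ≤ k := by
    rcases lt_or_gt_of_ne hk with h | h
    · left; exact_mod_cast h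
    · right
      have : i + 2 ≤ k := by omega
      exact_mod_cast this
  rw [midPoint, branchPoint, branchPoint] at h1 ⊢
  rcases h2 with h | h <;> nlinarith

theorem ellTwist_affineNear (s : ℝ) (k : ℕ) : AffineNear (ellTwist g i) s (branchPoint g k) := by
  have hc : Continuous fun p : ℝ × ℂ => ellLevel (Real.smoothTransition p.1) (p.2 - midPoint g i) :=
    continuous_ellLevel.comp ((Real.smoothTransition.continuous.comp continuous_fst).prodMk
      (continuous_snd.sub continuous_const))
  by_cases hk : k = i ∨ k = i + 1
  · have h1 : ellLevel (Real.smoothTransition s) (branchPoint g k - midPoint g i) < 5 / 4 := by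
      rw [ellLevel_one_real (Real.smoothTransition.le_one s)
        (branchPoint_sub_midPoint_sq hk)]
      norm_num
    refine ⟨fun _ => 2 * midPoint g i, fun _ => -1, contDiff_const, contDiff_const,
      fun _ => by norm_num, ?_⟩
    filter_upwards [hc.continuousAt.eventually_lt (continuousAt_const (y := (5 / 4 : ℝ)))
      (x₀ := (s, (branchPoint g k : ℂ))) h1] with p hp
    change (midPoint g i : ℂ) + ellTwistFun _ _ _ = _
    rw [ellTwistFun_inner Real.cos_pi hp.le]
    ring
  · have h1 : 3 / 2 < ellLevel (Real.smoothTransition s) (branchPoint g k - midPoint g i) := by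
      have := ellLevel_branchPoint_outer (g := g) (i := i) (k := k) (by tauto) (by tauto)
        (Real.smoothTransition.nonneg s)
      linarith
    refine ⟨fun _ => 0, fun _ => 1, contDiff_const, contDiff_const, fun _ => one_ne_zero, ?_⟩
    filter_upwards [(continuousAt_const (y := (3 / 2 : ℝ))).eventually_lt hc.continuousAt
      (x₀ := (s, (branchPoint g k : ℂ))) h1] with p hp
    change (midPoint g i : ℂ) + ellTwistFun _ _ _ = _
    rw [ellTwistFun_outer _ hp.le]
    ring

theorem ellTwist_permutes (hi : 1 ≤ i ∧ i ≤ 2 * g + 1) (s : ℝ) :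
    PermutesBranchPoints g (ellTwist g i s) := by
  intro k hk
  by_cases hki : k = i ∨ k = i + 1
  · refine ⟨2 * i + 1 - k, by rw [Finset.mem_Icc]; omega, ?_⟩
    change (midPoint g i : ℂ) + ellTwistFun _ _ _ = _
    rw [ellTwistFun_inner Real.cos_pi]
    · have : ((2 * i + 1 - k : ℕ) : ℂ) = 2 * i + 1 - k := by
        rw [Nat.cast_sub (by omega)]
        push_cast
        ring
      rw [midPoint, branchPoint, branchPoint, branchPoint]
      push_cast
      rw [this]
      ring
    · rw [ellLevel_one_real (Real.smoothTransition.le_one s)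
        (branchPoint_sub_midPoint_sq hki)]
      norm_num
  · refine ⟨k, hk, ?_⟩
    have := ellLevel_branchPoint_outer (g := g) (i := i) (k := k) (by tauto) (by tauto)
        (Real.smoothTransition.nonneg s)
    change (midPoint g i : ℂ) + ellTwistFun _ _ _ = _
    rw [ellTwistFun_outer _ (by linarith), add_sub_cancel]

/-- The half twist of the ellipses with foci `p_i` and `p_{i+1}` as a base diffeomorphism. -/
def ellDiffeo (hi : 1 ≤ i ∧ i ≤ 2 * g + 1) : BaseDiffeo g :=
  ⟨ellTwist g i 1, (ellTwist_smoothFamily hi).mem_baseDiffeo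
    (fun s k _ => ellTwist_affineNear s k) (ellTwist_permutes hi) 1⟩

/-- The foci slide apart from the common midpoint, where the twist is the disc twist of
`isBlock_pair`, to the branch points p_i and p_{i+1}. In this last position the confocal ellipses
lift to the circles |z| = const of `chainAnnulus`, so that the lift can be compared with a Dehn
twist. -/
theorem halfTwist_eq_cl_ellDiffeo (hi : 1 ≤ i ∧ i ≤ 2 * g + 1) :
    halfTwist g i = BaseDiffeo.cl (ellDiffeo hi) := by
  have h := isBlock_pair (g := g) hi.1 (by omega)
  rw [halfTwist_eq h]
  refine (ellTwist_smoothFamily hi).cl_eq (fun s k _ => ellTwist_affineNear s k)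
    (ellTwist_permutes hi) _ _ (Equiv.ext fun x => ?_) rfl
  change diskTwistFun (blockCenter g i (i + 1)) _ _ _ x =
    (midPoint g i : ℂ) + ellTwistFun Real.pi (Real.smoothTransition 0) (x - midPoint g i)
  have e : blockCenter g i (i + 1) = midPoint g i := by
    rw [blockCenter, midPoint, branchPoint]
    push_cast
    ring
  rw [Real.smoothTransition.zero_of_nonpos le_rfl, ellTwistFun_zero_param, e, diskTwistFun]

theorem ellDiffeo_apply (hi : 1 ≤ i ∧ i ≤ 2 * g + 1) (x : ℂ) :
    ((ellDiffeo hi : BaseDiffeo g) : Equiv.Perm ℂ) x =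
      midPoint g i + ellTwistFun Real.pi 1 (x - midPoint g i) := by
  change (midPoint g i : ℂ) + ellTwistFun Real.pi (Real.smoothTransition 1) _ = _
  rw [Real.smoothTransition.one_of_one_le le_rfl]

end EllipseFamily

/-! ### The twists about the curves of the chain -/

section ChainTwist

variable {g i : ℕ}

/-- The quotient of `√(X² - 1)` at the image of `X` under the half twist, and at `X`. -/
def ellRatio (X : ℂ) : ℂ :=
  (Real.cos (ellAngle Real.pi 1 X) : ℝ) +
    Complex.I * (Real.sin (ellAngle Real.pi 1 X) : ℝ) * (X / ellRoot 1 X)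

theorem ellRatio_inner {X : ℂ} (hX : ellLevel 1 X ≤ 5 / 4) : ellRatio X = -1 := by
  rw [ellRatio, ellAngle_inner _ hX, Real.cos_pi, Real.sin_pi]
  simp

theorem ellRatio_outer {X : ℂ} (hX : 3 / 2 ≤ ellLevel 1 X) : ellRatio X = 1 := by
  rw [ellRatio, ellAngle_outer _ hX]
  simp

theorem ellRoot_ne_zero {X : ℂ} (hX : 1 < ellLevel 1 X) : ellRoot 1 X ≠ 0 :=
  mul_ne_zero (ne_zero_of_ellLevel zero_le_one hX) (csqrt_ne_zero _)

theorem ellRatio_mul {X : ℂ} (hX : 1 < ellLevel 1 X) : ellRatio X * ellRoot 1 X =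
    (Real.cos (ellAngle Real.pi 1 X) : ℝ) * ellRoot 1 X +
      Complex.I * (Real.sin (ellAngle Real.pi 1 X) : ℝ) * X := by
  rw [ellRatio, add_mul, mul_assoc _ (X / _), div_mul_cancel₀ _ (ellRoot_ne_zero hX)]

theorem ellRatio_mul' {X : ℂ} (hX : 1 < ellLevel 1 X) :
    ellRatio X * ellRoot 1 X = ellRoot 1 (ellTwistFun Real.pi 1 X) := by
  rw [ellRatio_mul hX]
  exact (ellipse_rotate zero_le_one hX (Real.cos_sq_add_sin_sq _)).2.symm

theorem ellRatio_ne_zero (X : ℂ) : ellRatio X ≠ 0 := by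
  rcases le_or_gt (ellLevel 1 X) (5 / 4) with h | h
  · rw [ellRatio_inner h]
    norm_num
  · have h1 : 1 < ellLevel 1 X := by linarith
    have h2 := ellRoot_ne_zero (X := ellTwistFun Real.pi 1 X)
      (by rwa [ellTwistFun_level zero_le_one le_rfl Real.cos_pi])
    rw [← ellRatio_mul' h1] at h2
    exact left_ne_zero_of_mul h2

theorem ellRatio_sq (X : ℂ) :
    ellTwistFun Real.pi 1 X ^ 2 - 1 = ellRatio X ^ 2 * (X ^ 2 - 1) := by
  rcases le_or_gt (ellLevel 1 X) (5 / 4) with h | h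
  · rw [ellRatio_inner h, ellTwistFun_inner Real.cos_pi h]
    ring
  · have h1 : 1 < ellLevel 1 X := by linarith
    have h2 := ellRoot_sq zero_le_one h1
    have h3 := ellRoot_sq zero_le_one (X := ellTwistFun Real.pi 1 X)
      (by rwa [ellTwistFun_level zero_le_one le_rfl Real.cos_pi])
    rw [Complex.ofReal_one] at h2 h3
    rw [← h2, ← h3, ← mul_pow, ellRatio_mul' h1]

theorem contDiff_ellRatio : ContDiff ℝ ∞ ellRatio := by
  refine contDiff_iff_contDiffAt.2 fun X => ?_
  have hc : Continuous (ellLevel 1) :=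
    continuous_ellLevel.comp (continuous_const.prodMk continuous_id)
  rcases lt_or_ge (ellLevel 1 X) (5 / 4) with h | h
  · refine (contDiffAt_const (c := (-1 : ℂ))).congr_of_eventuallyEq ?_
    filter_upwards [hc.continuousAt.eventually_lt continuousAt_const h] with y hy
    exact ellRatio_inner hy.le
  · have hp : 1 < ellLevel 1 X := by linarith
    have hpair : ContDiffAt ℝ ∞ (fun X : ℂ => ((1 : ℝ), X)) X :=
      (contDiff_const.prodMk contDiff_id).contDiffAt
    have h1 := (contDiffAt_ellAngle Real.pi (p := ((1 : ℝ), X)) zero_le_one hp).comp X hpair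
    have h2 := (contDiffAt_ellRoot (p := ((1 : ℝ), X)) zero_le_one hp).comp X hpair
    have h3 : ContDiffAt ℝ ∞ (fun X => X * (ellRoot 1 X)⁻¹) X :=
      contDiffAt_id.mul (h2.inv (ellRoot_ne_zero hp))
    have h4 := (Complex.ofRealCLM.contDiff.contDiffAt.comp X
      (Real.contDiff_cos.contDiffAt.comp X h1)).add ((contDiffAt_const (c := Complex.I)).mul
        (Complex.ofRealCLM.contDiff.contDiffAt.comp X (Real.contDiff_sin.contDiffAt.comp X h1))
        |>.mul h3)
    exact h4

theorem strip_of_ellLevel {x : ℂ} (hx : ellLevel 1 (x - midPoint g i) < 2) : x ∈ strip g i := by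
  have h1 := norm_sq_le_ellLevel zero_le_one (x - midPoint g i)
  have h2 := Complex.abs_re_le_norm (x - midPoint g i)
  rw [Complex.sub_re, Complex.ofReal_re] at h2
  have h3 := norm_nonneg (x - (midPoint g i : ℂ))
  change |x.re - midPoint g i| < 3
  nlinarith

theorem ellDiffeo_level (hi : 1 ≤ i ∧ i ≤ 2 * g + 1) (x : ℂ) :
    ellLevel 1 (((ellDiffeo hi : BaseDiffeo g) : Equiv.Perm ℂ) x - midPoint g i) =
      ellLevel 1 (x - midPoint g i) := by
  rw [ellDiffeo_apply, add_sub_cancel_left, ellTwistFun_level zero_le_one le_rfl Real.cos_pi]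

theorem ellDiffeo_outer (hi : 1 ≤ i ∧ i ≤ 2 * g + 1) {x : ℂ}
    (hx : 3 / 2 ≤ ellLevel 1 (x - midPoint g i)) :
    ((ellDiffeo hi : BaseDiffeo g) : Equiv.Perm ℂ) x = x := by
  rw [ellDiffeo_apply, ellTwistFun_outer _ hx, add_sub_cancel]

-- Near the curve `poly` factors as (X² − 1) times the square of `coRoot`, X being the coordinate
-- relative to the midpoint, and the root is the product of the quotients of the two square roots.
-- On the levels from 3/2 to 2 it is already 1, so it extends by 1.
open Classical in
theorem ellDiffeo_root (hi : 1 ≤ i ∧ i ≤ 2 * g + 1) :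
    BaseDiffeo.root (ellDiffeo hi) = fun x => if ellLevel 1 (x - midPoint g i) < 2 then
      coRoot g i (((ellDiffeo hi : BaseDiffeo g) : Equiv.Perm ℂ) x) / coRoot g i x *
        ellRatio (x - midPoint g i) else 1 := by
  set f := ellDiffeo hi with hf
  have hc : Continuous fun x : ℂ => ellLevel 1 (x - midPoint g i) :=
    continuous_ellLevel.comp (continuous_const.prodMk (continuous_id.sub continuous_const))
  have hself : ∀ x, 3 / 2 ≤ ellLevel 1 (x - midPoint g i) →
      (if ellLevel 1 (x - midPoint g i) < 2 then coRoot g i ((f : Equiv.Perm ℂ) x) / coRoot g i x *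
        ellRatio (x - midPoint g i) else 1) = 1 := by
    intro x hx
    split_ifs with h
    · rw [ellDiffeo_outer hi hx, div_self (coRoot_ne_zero g i x), ellRatio_outer hx, one_mul]
    · rfl
  have hlev := ellDiffeo_level hi
  rw [← hf] at hlev
  refine BaseDiffeo.root_eq _ ⟨contDiff_iff_contDiffAt.2 fun x => ?_, fun x => ?_, fun x => ?_,
    fun x hx => if_neg (not_lt.2 (ellLevel_outer hi zero_le_one hx))⟩
  · rcases lt_or_ge (ellLevel 1 (x - midPoint g i)) 2 with h | h
    · have h1 : ∀ y ∈ strip g i, ContDiffAt ℝ ∞ (coRoot g i) y := fun y hy =>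
        ((contDiffOn_coRoot g i).contDiffAt ((isOpen_strip g i).mem_nhds hy)).restrict_scalars ℝ
      have h2 : ContDiffAt ℝ ∞ (fun y => coRoot g i ((f : Equiv.Perm ℂ) y) * (coRoot g i y)⁻¹ *
          ellRatio (y - midPoint g i)) x :=
        (((h1 _ (strip_of_ellLevel (by rwa [hlev]))).comp x f.2.1.contDiffAt).mul
          ((h1 x (strip_of_ellLevel h)).inv (coRoot_ne_zero g i x))).mul
          (contDiff_ellRatio.comp (contDiff_id.sub contDiff_const)).contDiffAt
      refine h2.congr_of_eventuallyEq ?_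
      filter_upwards [hc.continuousAt.eventually_lt continuousAt_const h] with y hy
      rw [if_pos hy, div_eq_mul_inv]
    · refine (contDiffAt_const (c := (1 : ℂ))).congr_of_eventuallyEq ?_
      have h' : 3 / 2 < ellLevel 1 (x - midPoint g i) := by linarith
      filter_upwards [continuousAt_const.eventually_lt hc.continuousAt h'] with y hy
      exact hself y hy.le
  · split_ifs with h
    · exact mul_ne_zero (div_ne_zero (coRoot_ne_zero g i _) (coRoot_ne_zero g i _))
        (ellRatio_ne_zero _)
    · exact one_ne_zero
  · split_ifs with h
    · have e : (f : Equiv.Perm ℂ) x - midPoint g i = ellTwistFun Real.pi 1 (x - midPoint g i) := by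
        rw [hf, ellDiffeo_apply, add_sub_cancel_left]
      have hne := coRoot_ne_zero g i x
      rw [poly, poly, prod_eq_coRoot hi (strip_of_ellLevel h),
        prod_eq_coRoot hi (strip_of_ellLevel (by rwa [hlev])), e, ellRatio_sq]
      field_simp
    · rw [hf, ellDiffeo_outer hi (by linarith), one_pow, one_mul]

theorem parallelogram (a b : ℂ) :
    ‖a + b‖ ^ 2 + ‖a - b‖ ^ 2 = 2 * (‖a‖ ^ 2 + ‖b‖ ^ 2) := by
  have := parallelogram_law_with_norm ℝ a b
  simpa only [← sq] using this

/-- The circles of radii |z| and 1 / |z| lie over the same ellipse with foci ± 1. -/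
theorem ellLevel_joukowski {z : ℂ} (hz : z ≠ 0) :
    ellLevel 1 ((z + z⁻¹) / 2) = (‖z‖ ^ 2 + (‖z‖ ^ 2)⁻¹ + 2) / 4 := by
  have h1 : ((z + z⁻¹) / 2) ^ 2 - (1 : ℝ) = ((z - z⁻¹) / 2) ^ 2 := by
    push_cast
    field_simp
    ring
  have h2 := parallelogram z z⁻¹
  rw [norm_inv, inv_pow] at h2
  rw [ellLevel, h1, norm_pow, norm_div, norm_div, Complex.norm_two]
  linarith

theorem joukowski_rotate (z : ℂ) (α : ℝ) :
    (z * Complex.exp ((α : ℂ) * Complex.I) + (z * Complex.exp ((α : ℂ) * Complex.I))⁻¹) / 2 =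
        (Real.cos α : ℝ) * ((z + z⁻¹) / 2) + Complex.I * (Real.sin α : ℝ) * ((z - z⁻¹) / 2) ∧
      (z * Complex.exp ((α : ℂ) * Complex.I) - (z * Complex.exp ((α : ℂ) * Complex.I))⁻¹) / 2 =
        (Real.cos α : ℝ) * ((z - z⁻¹) / 2) + Complex.I * (Real.sin α : ℝ) * ((z + z⁻¹) / 2) := by
  have h : (z * Complex.exp ((α : ℂ) * Complex.I))⁻¹ = z⁻¹ * Complex.exp (-((α : ℂ) * Complex.I)) := by
    rw [mul_inv, Complex.exp_neg]
  rw [h, ← neg_mul, Complex.exp_mul_I, Complex.exp_mul_I, Complex.cos_neg, Complex.sin_neg,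
    Complex.ofReal_cos, Complex.ofReal_sin]
  constructor <;> ring

/-- The angle of the lifted half twist on the circle `|z|² = t`. -/
def chainAngle (t : ℝ) : ℝ :=
  if t ≤ 1 then -(Real.pi * cutoff (5 / 4) (3 / 2) ((t + t⁻¹ + 2) / 4))
  else Real.pi * cutoff (5 / 4) (3 / 2) ((t + t⁻¹ + 2) / 4) - 2 * Real.pi

theorem chainAngle_inner {t : ℝ} (ht : (t + t⁻¹ + 2) / 4 ≤ 5 / 4) : chainAngle t = -Real.pi := by
  rw [chainAngle, cutoff_eq_one (by norm_num) ht]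
  split_ifs <;> ring

theorem contDiffAt_chainAngle {t : ℝ} (ht : 0 < t) : ContDiffAt ℝ ∞ chainAngle t := by
  have hb : ∀ t : ℝ, 0 < t → ContDiffAt ℝ ∞ (fun t : ℝ => (t + t⁻¹ + 2) / 4) t := fun t ht =>
    ((contDiffAt_id.add (contDiffAt_id.inv ht.ne')).add contDiffAt_const).div_const 4
  have hφ : ContDiffAt ℝ ∞ (fun t : ℝ => Real.pi * cutoff (5 / 4) (3 / 2) ((t + t⁻¹ + 2) / 4)) t :=
    contDiffAt_const.mul ((contDiff_cutoff _ _).contDiffAt.comp t (hb t ht))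
  rcases lt_or_ge ((t + t⁻¹ + 2) / 4) (5 / 4) with h | h
  · refine (contDiffAt_const (c := -Real.pi)).congr_of_eventuallyEq ?_
    filter_upwards [(hb t ht).continuousAt.eventually_lt continuousAt_const h] with y hy
    exact chainAngle_inner hy.le
  · have hne : t ≠ 1 := by
      rintro rfl
      norm_num at h
    rcases lt_or_gt_of_ne hne with h1 | h1
    · refine hφ.neg.congr_of_eventuallyEq ?_
      filter_upwards [gt_mem_nhds h1] with y hy
      rw [chainAngle, if_pos (le_of_lt hy)]
    · refine (hφ.sub (contDiffAt_const (c := 2 * Real.pi))).congr_of_eventuallyEq ?_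
      filter_upwards [lt_mem_nhds h1] with y hy
      rw [chainAngle, if_neg (not_le.2 hy)]

/-- Going from the inner end of the annulus to the outer one, the angle of the lifted half twist
passes from 0 through −π at the core to −2π, like that of the right-handed Dehn twist. The
difference of the two angles therefore vanishes near both ends. -/
theorem isShearProfile_chain : IsShearProfile fun t =>
    chainAngle t + 2 * Real.pi * Real.smoothTransition (t - 1 / 2) := by
  refine ⟨fun t ht => (contDiffAt_chainAngle ht).add (contDiffAt_const.mul
    (Real.smoothTransition.contDiff.comp (contDiff_id.sub contDiff_const)).contDiffAt),
    fun t ht => ?_⟩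
  contrapose!
  intro h
  -- Level 3/2 means t + 1/t = 4, that is t = 2 ± √3; the rational bounds 13/50 and 19/5 enclose
  -- these values and lie in the range (1/4, 4) of |z|².
  have hout : t < 13 / 50 ∨ 19 / 5 < t → 3 / 2 ≤ (t + t⁻¹ + 2) / 4 := by
    intro h'
    have e : t * t⁻¹ = 1 := mul_inv_cancel₀ ht.ne'
    have hi := inv_pos.2 ht
    have : 4 ≤ t + t⁻¹ := by
      by_contra! hcon
      have h2 := mul_lt_mul_of_pos_left hcon ht
      rcases h' with h' | h' <;> nlinarith
    linarith
  rcases lt_or_ge t (13 / 50) with h1 | h1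
  · rw [chainAngle, if_pos (by linarith), cutoff_eq_zero (by norm_num) (hout (Or.inl h1)),
      Real.smoothTransition.zero_of_nonpos (by linarith)]
    ring
  · have h2 := h h1
    rw [chainAngle, if_neg (by linarith), cutoff_eq_zero (by norm_num) (hout (Or.inr h2)),
      Real.smoothTransition.one_of_one_le (by linarith)]
    ring

/-- In the annulus coordinate the lifted half twist is a shear. -/
theorem joukowski_shear {z : ℂ} (hz : z ≠ 0) :
    (shear chainAngle z + (shear chainAngle z)⁻¹) / 2 = ellTwistFun Real.pi 1 ((z + z⁻¹) / 2) ∧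
      (shear chainAngle z - (shear chainAngle z)⁻¹) / 2 =
        ellRatio ((z + z⁻¹) / 2) * ((z - z⁻¹) / 2) := by
  have hlev := ellLevel_joukowski hz
  obtain ⟨h1, h2⟩ := joukowski_rotate z (chainAngle (‖z‖ ^ 2))
  rw [shear, h1, h2]
  clear h1 h2
  set X := (z + z⁻¹) / 2 with hX
  set W := (z - z⁻¹) / 2 with hW
  have hangle : ellAngle Real.pi 1 X =
      Real.pi * cutoff (5 / 4) (3 / 2) ((‖z‖ ^ 2 + (‖z‖ ^ 2)⁻¹ + 2) / 4) := by
    rw [ellAngle, hlev]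
  rcases le_or_gt (ellLevel 1 X) (5 / 4) with h | h
  · rw [ellTwistFun_inner Real.cos_pi h, ellRatio_inner h, chainAngle_inner (by rwa [← hlev]),
      Real.cos_neg, Real.sin_neg, Real.cos_pi, Real.sin_pi]
    constructor <;> simp
  · have hlt : 1 < ellLevel 1 X := by linarith
    have hX0 := ne_zero_of_ellLevel zero_le_one hlt
    have hWsq : W ^ 2 = X ^ 2 - (1 : ℝ) := by
      rw [hW, hX]
      push_cast
      field_simp
      ring
    have hn : 0 < ‖z‖ ^ 2 := by positivity
    have hre : (W * starRingEnd ℂ X).re = (‖z‖ ^ 2 - (‖z‖ ^ 2)⁻¹) / 4 := by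
      have e1 : starRingEnd ℂ z * z = ((‖z‖ ^ 2 : ℝ) : ℂ) := by
        rw [← Complex.normSq_eq_conj_mul_self, Complex.normSq_eq_norm_sq]
      have e2 : starRingEnd ℂ z⁻¹ * z⁻¹ = (((‖z‖ ^ 2)⁻¹ : ℝ) : ℂ) := by
        rw [← Complex.normSq_eq_conj_mul_self, Complex.normSq_eq_norm_sq, norm_inv, inv_pow]
      have e3 : W * starRingEnd ℂ X = (((‖z‖ ^ 2 - (‖z‖ ^ 2)⁻¹) / 4 : ℝ) : ℂ) +
          (z * starRingEnd ℂ z⁻¹ - z⁻¹ * starRingEnd ℂ z) / 4 := by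
        rw [hW, hX, map_div₀, map_add, Complex.ofReal_div, Complex.ofReal_sub, ← e1, ← e2]
        simp only [map_ofNat, Complex.ofReal_ofNat]
        ring
      have e4 : (z * starRingEnd ℂ z⁻¹ - z⁻¹ * starRingEnd ℂ z).re = 0 := by
        simp only [Complex.sub_re, Complex.mul_re, Complex.conj_re, Complex.conj_im]
        ring
      rw [e3, Complex.add_re, Complex.ofReal_re, Complex.div_ofNat_re, e4]
      ring
    have hne : ‖z‖ ^ 2 ≠ 1 := by
      intro h1
      rw [hlev, h1] at h
      norm_num at h
    rcases lt_or_gt_of_ne hne with h1 | h1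
    -- Inside the unit circle the root asymptotic to X is −(z − 1/z) / 2, so the ellipse turns
    -- against z: this is the sign change in `chainAngle`. The 2π subtracted outside makes the two
    -- branches agree at the core.
    · have hinv : 1 < (‖z‖ ^ 2)⁻¹ := (one_lt_inv₀ hn).2 h1
      have hroot : ellRoot 1 X = -W := eq_ellRoot hX0
        (by rw [neg_mul, Complex.neg_re, hre]; linarith) (by rw [neg_sq, hWsq])
      have hr := ellRatio_mul hlt
      rw [chainAngle, if_pos h1.le, ← hangle, Real.cos_neg, Real.sin_neg, ellTwistFun]
      rw [hroot] at hr ⊢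
      constructor
      · push_cast
        ring
      · push_cast at hr ⊢
        linear_combination hr
    · have hinv : (‖z‖ ^ 2)⁻¹ < 1 := inv_lt_one_of_one_lt₀ h1
      have hroot : ellRoot 1 X = W := eq_ellRoot hX0 (by rw [hre]; linarith) hWsq
      have hr := ellRatio_mul hlt
      rw [chainAngle, if_neg (not_le.2 h1), ← hangle, Real.cos_sub_two_pi, Real.sin_sub_two_pi,
        ellTwistFun]
      rw [hroot] at hr ⊢
      exact ⟨rfl, hr.symm⟩

open Classical in
theorem chain_toFun (hi : 1 ≤ i ∧ i ≤ 2 * g + 1) {z : ℂ} (hz : z ∈ planarAnnulus) :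
    ((chainAnnulus g i hi).toFun z : ℂ × ℂ) = (midPoint g i + (z + z⁻¹) / 2,
      (z - z⁻¹) / 2 * coRoot g i (midPoint g i + (z + z⁻¹) / 2)) := by
  change (((if h : z ∈ planarAnnulus then _ else _ : surface g)) : ℂ × ℂ) = _
  rw [dif_pos hz]

/-- The annulus coordinate is z = X + W with inverse X − W. By the parallelogram law the squares of
their norms add up to 4 · level − 2 < 4, so both norms are less than 2, and the norm of z exceeds
1/2. -/
theorem chain_target_of_level (hi : 1 ≤ i ∧ i ≤ 2 * g + 1) {p : surface g}
    (hp : ellLevel 1 (p.1.1 - midPoint g i) < 3 / 2) : p ∈ (chainAnnulus g i hi).target := by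
  have hs : p.1.1 ∈ strip g i := strip_of_ellLevel (by linarith)
  refine ⟨hs, ?_⟩
  set X := p.1.1 - midPoint g i with hX
  set W := p.1.2 / coRoot g i p.1.1 with hW
  have hWsq : W ^ 2 = X ^ 2 - 1 := by
    rw [hW, div_pow, p.2.1, prod_eq_coRoot hi hs, mul_div_assoc,
      div_self (pow_ne_zero 2 (coRoot_ne_zero g i _)), mul_one]
  have h1 := parallelogram X W
  have h2 : ‖W‖ ^ 2 = ‖X ^ 2 - (1 : ℝ)‖ := by
    rw [← norm_pow, hWsq, Complex.ofReal_one]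
  rw [ellLevel, ← h2] at hp
  have h3 : ‖X + W‖ * ‖X - W‖ = 1 := by
    rw [← norm_mul, show (X + W) * (X - W) = 1 by linear_combination -hWsq, norm_one]
  have h4 := norm_nonneg (X + W)
  have h5 := norm_nonneg (X - W)
  have h6 : ‖X + W‖ < 2 := by nlinarith
  have h7 : ‖X - W‖ < 2 := by nlinarith
  exact ⟨by nlinarith, h6⟩

/-- In the annulus coordinate the lift is the shear by `chainAngle`, which is the angle of the Dehn
twist plus the profile of `isShearProfile_chain`. Off the annulus both sides are the identity. The
shear factor is isotopic to the identity. -/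
theorem lift_ellDiffeo (hi : 1 ≤ i ∧ i ≤ 2 * g + 1) :
    BaseDiffeo.lift (ellDiffeo hi) =
      (chainAnnulus g i hi).shearDiffeo isShearProfile_chain * (chainAnnulus g i hi).dehnTwist := by
  refine Subtype.ext (Equiv.ext fun p => Subtype.ext ?_)
  set A := chainAnnulus g i hi with hA
  change (((ellDiffeo hi : BaseDiffeo g) : Equiv.Perm ℂ) p.1.1,
    BaseDiffeo.root (ellDiffeo hi) p.1.1 * p.1.2) = (A.shearFun _ (A.twistFun 1 p) : ℂ × ℂ)
  rw [EmbeddedAnnulus.twistFun_eq_shearFun, EmbeddedAnnulus.shearFun_shearFun]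
  have e : (fun t => chainAngle t + 2 * Real.pi * Real.smoothTransition (t - 1 / 2) +
      -(2 * Real.pi * ((1 : ℤ) : ℝ) * Real.smoothTransition (t - 1 / 2))) = chainAngle := by
    funext t
    push_cast
    ring
  rw [e, ellDiffeo_root]
  beta_reduce
  by_cases hp : p ∈ A.target
  · have hz := A.invFun_mem hp
    have hr : A.toFun (A.invFun p) = p := A.right_inv' hp
    rw [EmbeddedAnnulus.shearFun, if_pos hp, chain_toFun hi (shear_mem hz)]
    set z := A.invFun p with hzdef
    have hz0 := ne_zero_of_mem_planarAnnulus hz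
    have hr' := congrArg Subtype.val hr
    rw [chain_toFun hi hz] at hr'
    have hx : p.1.1 = midPoint g i + (z + z⁻¹) / 2 := by rw [← hr']
    have hy : p.1.2 = (z - z⁻¹) / 2 * coRoot g i p.1.1 := by rw [hx, ← hr']
    have hX : p.1.1 - midPoint g i = (z + z⁻¹) / 2 := by rw [hx, add_sub_cancel_left]
    obtain ⟨h1, h2⟩ := joukowski_shear hz0
    have hlev : ellLevel 1 (p.1.1 - midPoint g i) < 2 := by
      rw [hX, ellLevel_joukowski hz0]
      have h3 : ‖z‖ ^ 2 < 4 := by nlinarith [hz.2, norm_nonneg z]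
      have h4 : 1 / 4 < ‖z‖ ^ 2 := by nlinarith [hz.1]
      have h5 : (‖z‖ ^ 2)⁻¹ < 4 := by
        rw [inv_lt_comm₀ (by positivity) (by norm_num)]
        linarith
      have h6 : ‖z‖ ^ 2 * (‖z‖ ^ 2)⁻¹ = 1 := mul_inv_cancel₀ (by positivity)
      nlinarith
    rw [if_pos hlev, h1, h2, ellDiffeo_apply, hX, hy]
    refine Prod.ext rfl ?_
    change coRoot g i _ / coRoot g i p.1.1 * ellRatio _ * (_ * coRoot g i p.1.1) = _
    have hne := coRoot_ne_zero g i p.1.1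
    field_simp
  · have hlev : 3 / 2 ≤ ellLevel 1 (p.1.1 - midPoint g i) := by
      by_contra! hcon
      exact hp (chain_target_of_level hi hcon)
    rw [EmbeddedAnnulus.shearFun, if_neg hp, ellDiffeo_outer hi hlev]
    refine Prod.ext rfl ?_
    change (if _ then _ else _) * p.1.2 = p.1.2
    split_ifs with h
    · rw [div_self (coRoot_ne_zero g i _), ellRatio_outer hlev, one_mul, one_mul]
    · rw [one_mul]

/-- The twists about the curves of the chain are lifts of half twists. -/
theorem tc_eq_halfTwist (hi : 1 ≤ i ∧ i ≤ 2 * g + 1) : tc g i = halfTwist g i := by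
  have h : c g i = chainAnnulus g i hi := dif_pos hi
  rw [halfTwist_eq_cl_ellDiffeo hi, tc, h]
  change _ = QuotientGroup.mk' _ (BaseDiffeo.lift (ellDiffeo hi))
  rw [lift_ellDiffeo, map_mul]
  have h1 : QuotientGroup.mk' (IsotopicToId (surface g) (surfaceBoundary g))
      ((chainAnnulus g i hi).shearDiffeo isShearProfile_chain) = 1 :=
    (QuotientGroup.eq_one_iff _).2 (EmbeddedAnnulus.shearDiffeo_isotopic _ _)
  rw [h1, one_mul]
  rfl

end ChainTwist

/-! ### The relations -/

theorem isBraid_tc (g : ℕ) : IsBraid (tc g) (2 * g + 1) := by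
  have h := isBraid_halfTwist g
  have e : ∀ i, 1 ≤ i → i ≤ 2 * g + 1 → tc g i = halfTwist g i := fun i h1 h2 =>
    tc_eq_halfTwist ⟨h1, h2⟩
  refine ⟨fun i j h1 h2 h3 => ?_, fun i h1 h2 => ?_⟩
  · rw [e i h1 (by omega), e j (by omega) h3, h.comm i j h1 h2 h3]
  · rw [e i h1 (by omega), e (i + 1) (by omega) h2, h.braid i h1 h2]

/-- The odd chain relation. -/
theorem delta_mul_delta'_eq_chain (g : ℕ) :
    (delta g).twistClass * (delta' g).twistClass = (chainFactorization g).prod := by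
  have e : (chainWord g 1 (2 * g + 1)).prod = ascProd (halfTwist g) 1 (2 * g + 1) := by
    rw [chainWord, ascProd]
    congr 1
    refine List.map_congr_left fun k hk => tc_eq_halfTwist ?_
    rw [List.Ico.mem] at hk
    omega
  rw [delta_mul_delta', chainFactorization, prod_wordPow, e,
    ← blockClass_sq (g := g) (j := 2 * g + 1) le_rfl]

theorem wordD_eq (g : ℕ) : wordD g = (List.Ico 4 (2 * g + 2)).map (leftConj (tc g)) :=
  List.map_congr_left fun j _ => twistClass_d g j

theorem wordE_eq (g : ℕ) : wordE g = ((List.Ico 4 (2 * g + 2)).map (rightConj (tc g))).reverse :=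
  congrArg List.reverse (List.map_congr_left fun j _ => twistClass_e g j)

theorem hurwitzClass_chainFactorization {g : ℕ} (hg : 1 ≤ g) :
    hurwitzClass (chainFactorization g) =
      hurwitzClass [tc g 1, tc g 2, tc g 3] ^ (2 * g - 2) *
        hurwitzClass [tc g 1, tc g 2, tc g 3] ^ 4 *
        hurwitzClass [tc g 3, tc g 2, tc g 1] ^ (2 * g - 2) * hurwitzClass (wordD g) *
        hurwitzClass (wordE g) * hurwitzClass (chainWord g 5 (2 * g + 1)) ^ (2 * g - 2) := by
  have h := (isBraid_tc g).hurwitz_chain (m := 2 * g - 2) (by omega)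
  rw [show 2 * g - 2 + 3 = 2 * g + 1 by omega, show 2 * g - 2 + 4 = 2 * g + 2 by omega] at h
  rw [wordD_eq, wordE_eq]
  exact h

/-- The fourth powers of σ_3σ_2σ_1 and σ_1σ_2σ_3 are both the full twist on four strands. -/
theorem hurwitzClass_desc_pow_four {g : ℕ} (hg : 1 ≤ g) (k : ℕ) :
    hurwitzClass [tc g 3, tc g 2, tc g 1] ^ (4 * k) =
      hurwitzClass [tc g 1, tc g 2, tc g 3] ^ (4 * k) := by
  rw [pow_mul, pow_mul]
  congr 1
  have h := (isBraid_tc g).letter.descProd_pow (j := 3) (by omega)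
  rw [ascProd_letter, descProd_letter] at h
  exact h

theorem hurwitzEquiv_odd {g : ℕ} (hg : 1 ≤ g) (hodd : Odd g) :
    HurwitzEquiv (oddFactorization g) (chainFactorization g) := by
  -- For g = 2k + 1 the exponent 2g − 2 is 4k, so all descending triples turn into ascending ones,
  -- (2g − 2) + 4 + (2g − 2) = 4g in total.
  obtain ⟨k, rfl⟩ := hodd
  rw [← hurwitzClass_eq, hurwitzClass_chainFactorization hg,
    show 2 * (2 * k + 1) - 2 = 4 * k by omega, hurwitzClass_desc_pow_four hg, ← pow_add, ← pow_add,
    oddFactorization]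
  simp only [hurwitzClass_append, hurwitzClass_wordPow]
  rw [show 2 * (2 * k + 1) - 2 = 4 * k by omega,
    show 4 * k + 4 + 4 * k = 4 * (2 * k + 1) by omega]

theorem hurwitzEquiv_even {g : ℕ} (hg : 1 ≤ g) (heven : Even g) :
    HurwitzEquiv (evenFactorization g) (chainFactorization g) := by
  -- For g = 2k + 2 the exponent 2g − 2 is 4k + 2. Two descending triples remain, and the ascending
  -- ones number 8k + 6 = 4(g − 1) + 2.
  obtain ⟨k, rfl⟩ : ∃ k, g = 2 * k + 2 := by
    obtain ⟨k, rfl⟩ := heven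
    exact ⟨k - 1, by omega⟩
  rw [← hurwitzClass_eq, hurwitzClass_chainFactorization hg,
    show 2 * (2 * k + 2) - 2 = 4 * k + 2 by omega,
    pow_add (hurwitzClass [tc (2 * k + 2) 3, tc (2 * k + 2) 2, tc (2 * k + 2) 1]),
    hurwitzClass_desc_pow_four hg, ← mul_assoc, ← pow_add, ← pow_add, evenFactorization]
  simp only [hurwitzClass_append, hurwitzClass_wordPow]
  rw [show 2 * (2 * k + 2) - 2 = 4 * k + 2 by omega,
    show 4 * k + 2 + 4 + 4 * k = 4 * (2 * k + 2 - 1) + 2 by omega]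

end

end SurfaceMCG

theorem mainTheorem8 (g : ℕ) (hg : 3 ≤ g) :
    (Odd g →
      (SurfaceMCG.delta g).twistClass * (SurfaceMCG.delta' g).twistClass =
          (SurfaceMCG.tc g 1 * SurfaceMCG.tc g 2 * SurfaceMCG.tc g 3) ^ (4 * g) *
            (SurfaceMCG.wordD g).prod * (SurfaceMCG.wordE g).prod *
            (SurfaceMCG.chainWord g 5 (2 * g + 1)).prod ^ (2 * g - 2) ∧
        SurfaceMCG.HurwitzEquiv (SurfaceMCG.oddFactorization g)
          (SurfaceMCG.chainFactorization g)) ∧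
    (Even g →
      (SurfaceMCG.delta g).twistClass * (SurfaceMCG.delta' g).twistClass =
          (SurfaceMCG.tc g 1 * SurfaceMCG.tc g 2 * SurfaceMCG.tc g 3) ^ (4 * (g - 1) + 2) *
            (SurfaceMCG.tc g 3 * SurfaceMCG.tc g 2 * SurfaceMCG.tc g 1) ^ 2 *
            (SurfaceMCG.wordD g).prod * (SurfaceMCG.wordE g).prod *
            (SurfaceMCG.chainWord g 5 (2 * g + 1)).prod ^ (2 * g - 2) ∧
        SurfaceMCG.HurwitzEquiv (SurfaceMCG.evenFactorization g)
          (SurfaceMCG.chainFactorization g)) := by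
  have hg' : 1 ≤ g := by omega
  refine ⟨fun hodd => ⟨?_, SurfaceMCG.hurwitzEquiv_odd hg' hodd⟩,
    fun heven => ⟨?_, SurfaceMCG.hurwitzEquiv_even hg' heven⟩⟩
  · rw [SurfaceMCG.delta_mul_delta'_eq_chain, ← (SurfaceMCG.hurwitzEquiv_odd hg' hodd).prod_eq,
      SurfaceMCG.oddFactorization, List.prod_append, List.prod_append, List.prod_append,
      SurfaceMCG.prod_wordPow, SurfaceMCG.prod_wordPow]
    simp [mul_assoc]
  · rw [SurfaceMCG.delta_mul_delta'_eq_chain, ← (SurfaceMCG.hurwitzEquiv_even hg' heven).prod_eq,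
      SurfaceMCG.evenFactorization, List.prod_append, List.prod_append, List.prod_append,
      List.prod_append, SurfaceMCG.prod_wordPow, SurfaceMCG.prod_wordPow, SurfaceMCG.prod_wordPow]
    simp [mul_assoc]
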